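/- Let $N\ge 2$. The flower graph $\Gamma_N$ consists of $N$ loops, each parametrised by $[-\pi,\pi]$, and a half-line $[0,\infty)$, all joined at one vertex. A function $\Phi=(\phi_1,\dots,\phi_N,\phi_0)$ belongs to $H^2_{\rm NK}(\Gamma_N)$ if $\phi_j\in H^2(-\pi,\pi)$ for $1\le j\le N$, $\phi_0\in H^2(0,\infty)$, $\phi_j(\pm\pi)=\phi_0(0)$ for all $1\le j\le N$, and $\sum_{j=1}^N[\phi_j'(\pi)-\phi_j'(-\pi)]=\phi_0'(0)$. For $\omega<0$, call a real $\Phi\in H^2_{\rm NK}(\Gamma_N)$ a state at $\omega$ if it solves $\omega\Phi=-\Phi''-2\Phi^3$ on every edge, is positive, is single-lobe (on each loop either the maximum is attained at a single point, which is internal, and the minimum at the vertex, or the minimum is attained at a single point, which is internal, and the maximum at the vertex), is even on each loop, and $\phi_0$ is strictly decreasing on $[0,\infty)$. The symmetric state at $\omega$ is the state with $\phi_1=\dots=\phi_N$ strictly decreasing on $[0,\pi]$. A bifurcation frequency is an $\omega_*<0$ at which the linearisation $-\Delta-\omega_*-6\Phi^2$ at the symmetric state $\Phi$, with domain $H^2_{\rm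 NK}(\Gamma_N)$, has a nontrivial kernel. The mass of $\Phi$ is $Q(\Phi)=\|\Phi\|_{L^2(\Gamma_N)}^2$. There is $\omega_\infty<0$, smaller than every bifurcation frequency $\omega_*$, such that for every $\omega<\omega_\infty$ there are, up to permutations of the components in the $N$ loops, exactly $N$ states $\Phi^{(1)}(\cdot,\omega),\dots,\Phi^{(N)}(\cdot,\omega)$ at $\omega$. For $1\le K\le N$, after ordering the loops, the first $K$ loop components of $\Phi^{(K)}$ are equal and strictly decreasing on $[0,\pi]$, the other $N-K$ loop components are equal and strictly increasing on $[0,\pi]$, and the former have larger $L^\infty$ norm than the latter; $\Phi^{(N)}$ is the unique symmetric state at $\omega$. For every $K$ the map $(-\infty,\omega_\infty)\ni\omega\mapsto\Phi^{(K)}(\cdot,\omega)\in H^2_{\rm NK}(\Gamma_N)$ is $C^1$, and the mass $\mu^{(K)}(\omega)=Q(\Phi^{(K)}(\cdot,\omega))$ is a $C^1$, strictly decreasing function of $\omega\in(-\infty,\omega_\infty)$ with $\mu^{(K)}(\omega)\to\infty$ as $\omega\to-\infty$. Moreover $\mu^{(1)}(\omega)<\mu^{(2)}(\omega)<\dots<\mu^{(N)}(\omega)$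 for every $\omega<\omega_\infty$. -/

import Mathlib

open MeasureTheory Set Filter Topology

noncomputable section

namespace FlowerGraph

/-- A bounded edge (loop) of the flower graph, parametrised by `[-π, π]`; both end points are
the vertex. -/
abbrev loopEdge : Set ℝ := Icc (-Real.pi) Real.pi

/-- The unbounded edge (half-line) `[0, ∞)`; the point `0` is the vertex. -/
abbrev rayEdge : Set ℝ := Ici 0

/-- A real function on the flower graph with `N` loops, given by its components
`φ₁, …, φ_N` and `φ₀`. Only the values on `[-π, π]`, respectively on `[0, ∞)`, are meaningful:
functions are compared by `GraphFun.EqOnGraph`, and everything below only depends on these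
values. -/
structure GraphFun (N : ℕ) where
  /-- the components on the loops -/
  loop : Fin N → ℝ → ℝ
  /-- the component on the half-line -/
  ray : ℝ → ℝ

/-- First derivative along an edge `s` (one-sided at an end point of the edge). -/
def d1 (s : Set ℝ) (f : ℝ → ℝ) : ℝ → ℝ := derivWithin f s

/-- Second derivative along an edge `s`. -/
def d2 (s : Set ℝ) (f : ℝ → ℝ) : ℝ → ℝ := derivWithin (derivWithin f s) s

/-- `f` is (the continuously differentiable representative of) an element of `H²(s)`, where `s`
is a closed interval: `f` is differentiable on `s`, `f'` is locally absolutely continuous on `s`,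
and `f, f', f'' ∈ L²(s)`. -/
def MemH2 (s : Set ℝ) (f : ℝ → ℝ) : Prop :=
  DifferentiableOn ℝ f s ∧
  (∀ a ∈ s, ∀ b ∈ s, AbsolutelyContinuousOnInterval (d1 s f) a b) ∧
  MemLp f 2 (volume.restrict s) ∧
  MemLp (d1 s f) 2 (volume.restrict s) ∧
  MemLp (d2 s f) 2 (volume.restrict s)

/-- The space `L²(s)` of an edge. -/
abbrev EdgeL2 (s : Set ℝ) : Type := Lp ℝ 2 (volume.restrict s : Measure ℝ)

/-- The Hilbert space `L²(s) × L²(s) × L²(s)`; through `f ↦ (f, f', f'')` the Sobolev space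
`H²(s)` is isometrically a closed subspace of it. -/
abbrev EdgeJet (s : Set ℝ) : Type := PiLp 2 (fun _ : Fin 3 => EdgeL2 s)

/-- The Hilbert space which contains `H²(Γ_N) = H²(-π, π)^N × H²(0, ∞)` isometrically as a
closed subspace. -/
abbrev GraphJet (N : ℕ) : Type :=
  WithLp 2 (PiLp 2 (fun _ : Fin N => EdgeJet loopEdge) × EdgeJet rayEdge)

open Classical in
/-- The class of `f` in `L²(s)` (and `0` if `f` is not in `L²(s)`). -/
def toL2 (s : Set ℝ) (f : ℝ → ℝ) : EdgeL2 s :=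
  if h : MemLp f 2 (volume.restrict s) then h.toLp f else 0

/-- The triple `(f, f', f'')`. For `f ∈ H²(s)` its norm is the `H²(s)` norm of `f`. -/
def edgeJet (s : Set ℝ) (f : ℝ → ℝ) : EdgeJet s :=
  WithLp.toLp 2 ![toL2 s f, toL2 s (d1 s f), toL2 s (d2 s f)]

namespace GraphFun

variable {N : ℕ}

/-- Equality as functions on the graph. -/
def EqOnGraph (Φ Ψ : GraphFun N) : Prop :=
  (∀ j, EqOn (Φ.loop j) (Ψ.loop j) loopEdge) ∧ EqOn Φ.ray Ψ.ray rayEdge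

/-- Permutation of the components in the loops. -/
def permute (σ : Equiv.Perm (Fin N)) (Φ : GraphFun N) : GraphFun N :=
  ⟨fun j => Φ.loop (σ j), Φ.ray⟩

/-- The element of `H²(Γ_N)` that is given by a graph function, as a point of the Hilbert space
`GraphJet N`. -/
def toH2 (Φ : GraphFun N) : GraphJet N :=
  WithLp.toLp 2 (WithLp.toLp 2 (fun j => edgeJet loopEdge (Φ.loop j)), edgeJet rayEdge Φ.ray)

/-- `Φ ∈ H²_NK(Γ_N)`: every component is in `H²` of its edge, and the Neumann–Kirchhoff
conditions (continuity and balance of the derivatives) hold at the vertex. -/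
def MemH2NK (Φ : GraphFun N) : Prop :=
  (∀ j, MemH2 loopEdge (Φ.loop j)) ∧ MemH2 rayEdge Φ.ray ∧
  (∀ j, Φ.loop j Real.pi = Φ.ray 0 ∧ Φ.loop j (-Real.pi) = Φ.ray 0) ∧
  ∑ j, (d1 loopEdge (Φ.loop j) Real.pi - d1 loopEdge (Φ.loop j) (-Real.pi)) =
    d1 rayEdge Φ.ray 0

/-- The stationary NLS equation `ω Φ = -ΔΦ - 2Φ³`, in `L²(Γ_N)`. -/
def SolvesNLS (ω : ℝ) (Φ : GraphFun N) : Prop :=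
  (∀ j, ∀ᵐ x ∂(volume.restrict loopEdge),
    ω * Φ.loop j x = -d2 loopEdge (Φ.loop j) x - 2 * Φ.loop j x ^ 3) ∧
  (∀ᵐ x ∂(volume.restrict rayEdge), ω * Φ.ray x = -d2 rayEdge Φ.ray x - 2 * Φ.ray x ^ 3)

/-- `Φ` is positive on the graph. -/
def IsPositive (Φ : GraphFun N) : Prop :=
  (∀ j, ∀ x ∈ loopEdge, 0 < Φ.loop j x) ∧ ∀ x ∈ rayEdge, 0 < Φ.ray x

/-- On a loop, either the maximum is attained at a single point, which is internal, and the minimum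
is attained at the vertex, or the minimum is attained at a single point, which is internal, and
the maximum is attained at the vertex. -/
def IsSingleLobe (f : ℝ → ℝ) : Prop :=
  (∃ c ∈ Ioo (-Real.pi) Real.pi, (∀ x ∈ loopEdge, x ≠ c → f x < f c) ∧
    IsMinOn f loopEdge (-Real.pi) ∧ IsMinOn f loopEdge Real.pi) ∨
  (∃ c ∈ Ioo (-Real.pi) Real.pi, (∀ x ∈ loopEdge, x ≠ c → f c < f x) ∧
    IsMaxOn f loopEdge (-Real.pi) ∧ IsMaxOn f loopEdge Real.pi)

/-- Positive single-lobe states in `H²_NK(Γ_N)` of the stationary NLS equation with frequency `ω`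
that are symmetric (even) on each loop and decreasing on the half-line. -/
def IsState (ω : ℝ) (Φ : GraphFun N) : Prop :=
  Φ.MemH2NK ∧ Φ.SolvesNLS ω ∧ Φ.IsPositive ∧ (∀ j, IsSingleLobe (Φ.loop j)) ∧
  (∀ j, ∀ x ∈ loopEdge, Φ.loop j (-x) = Φ.loop j x) ∧
  StrictAntiOn Φ.ray rayEdge

/-- The positive single-lobe symmetric state: all components in the loops coincide and are
decreasing on `[0, π]`. -/
def IsSymmetricState (ω : ℝ) (Φ : GraphFun N) : Prop :=
  Φ.IsState ω ∧ (∀ i j, EqOn (Φ.loop i) (Φ.loop j) loopEdge) ∧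
  ∀ j, StrictAntiOn (Φ.loop j) (Icc 0 Real.pi)

/-- The linearised operator `𝓛 = -Δ - ω - 6Φ²`, with domain `H²_NK(Γ_N)`, has a nonzero kernel. -/
def HasKernel (ω : ℝ) (Φ : GraphFun N) : Prop :=
  ∃ V : GraphFun N, V.MemH2NK ∧ ¬ V.EqOnGraph ⟨fun _ _ => 0, fun _ => 0⟩ ∧
    (∀ j, ∀ᵐ x ∂(volume.restrict loopEdge),
      -d2 loopEdge (V.loop j) x - ω * V.loop j x - 6 * Φ.loop j x ^ 2 * V.loop j x = 0) ∧
    (∀ᵐ x ∂(volume.restrict rayEdge),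
      -d2 rayEdge V.ray x - ω * V.ray x - 6 * Φ.ray x ^ 2 * V.ray x = 0)

/-- Amplitude (`L^∞` norm) of a component in a loop. -/
def amplitude (f : ℝ → ℝ) : ℝ := sSup ((fun x => |f x|) '' loopEdge)

/-- The `K`-split profile (with `K = N` allowed): the first `K` components coincide, the other
`N - K` components coincide, the first ones have larger amplitude than the other ones. -/
def IsSplit (K : ℕ) (Φ : GraphFun N) : Prop :=
  (∀ i j : Fin N, i.val < K → j.val < K → EqOn (Φ.loop i) (Φ.loop j) loopEdge) ∧
  (∀ i j : Fin N, K ≤ i.val → K ≤ j.val → EqOn (Φ.loop i) (Φ.loop j) loopEdge) ∧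
  (∀ i j : Fin N, i.val < K → K ≤ j.val → amplitude (Φ.loop j) < amplitude (Φ.loop i))

/-- The mass `Q(Φ) = ‖Φ‖²` in `L²(Γ_N)`. -/
def mass (Φ : GraphFun N) : ℝ :=
  (∑ j, ∫ x in loopEdge, Φ.loop j x ^ 2) + (∫ x in rayEdge, Φ.ray x ^ 2)

end GraphFun

/-- `ω < 0` is a frequency at which the positive single-lobe symmetric state undergoes a
bifurcation, that is, at which its linearised operator has a nontrivial kernel. -/
def IsBifurcationFrequency (N : ℕ) (ω : ℝ) : Prop :=
  ω < 0 ∧ ∃ Φ : GraphFun N, Φ.IsSymmetricState ω ∧ Φ.HasKernel ω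

end FlowerGraph

end

namespace FlowerGraph

/-! Put `l = √(-ω)` and `T = π l`. After scaling by `l`, every component of a state solves `u'' = u
- 2u³`. Evenness makes a loop component equal to `l * prof (l x) a`, where `prof · a` is the even
solution with value `a` at `0`. On the half-line the conserved energy is integrable, hence zero, so
that component is a tail of the soliton `sech = prof · 1`. A state is thus a family of amplitudes
`a_j` with a common vertex value `p = prof T a_j` and `∑ 2 profD T a_j + p √(1 - p²) = 0`.

For large `T` the value `p` is small, and a single lobe of vertex value `p` is either a peak
(`IsPeak`: amplitude near `1`, small after time `3`) or low (`IsLow`: below `2/5` throughout). In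
each class `p` determines the amplitude. Up to permutation a state is therefore a number `K ≥ 1` of
peaks together with a zero of `vertexBalance` (`exists_perm_ampPair`).

The engine is the comparison principle `linear_ode_growth`: if `D'' = c D` with `c ≥ 0`, then
positive data keep growing. It applies to the amplitude derivative `profA` and to differences of two
profiles wherever `|prof| < 2/5`. Low profiles are in this range from time `0`. For peaks the core
`[0, 3]` is not; there the explicit formula `profA_one` at the soliton shows that `profA` and
`profDA` are negative at time `3`, which persists for nearby amplitudes (`central_spec`) and then
propagates to `T`. Hence raising a peak's amplitude lowers its value and its slope at the vertex,
every term of the balance is monotone, and the zero is unique (`IsAmpPair.unique`). It exists by the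
intermediate value theorem (`exists_isAmpPair`), and the same signs in the linearised system give
`C¹` dependence on `T` (`contDiffAt_ampPair`). They also exclude a kernel at the symmetric state
(`not_hasKernel`).

The mass is `l * scaledMass N K T`. A half-loop with a peak carries mass close to `∫₀^∞ sech² = 1`,
while low loops and the half-line contribute little because `p = O(T⁻²)`; so `scaledMass` is within
`1/2` of `2K` (`exists_scaledMass_close`). Differentiating the balance in `T` shows that `T` times
the derivative of `scaledMass` is `O(1/T)` (`exists_deriv_scaledMass_bound`). The derivative of the
mass in `l` is thus close to `2K`, which gives monotonicity, and the gaps of size about `2l` order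
the branches.

The profiles themselves come from a pendulum: the primitive `θ` of `u` satisfies `θ'' = c sin 2θ`, a
globally Lipschitz system, so no blow-up has to be excluded. Smoothness in time and amplitude
follows from the implicit function theorem for a Volterra equation on `C([0,1])`. -/

theorem exists_global_of_uniform_time {E : Type*} [NormedAddCommGroup E] [NormedSpace ℝ E]
    [CompleteSpace E] {v : E → E} (hv : ContDiff ℝ 1 v) {ε : ℝ} (hε : 0 < ε)
    (h : ∀ x : E, ∃ γ : ℝ → E, γ 0 = x ∧ ∀ t ∈ Ioo (-ε) ε, HasDerivAt γ (v (γ t)) t) (x : E) :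
    ∃ γ : ℝ → E, γ 0 = x ∧ ∀ t, HasDerivAt γ (v (γ t)) t := by
  -- The continuation of integral curves with a uniform existence time is a statement about
  -- manifolds; here `E` is a manifold over itself and its tangent spaces are `E`.
  let v' : (x : E) → TangentSpace (modelWithCornersSelf ℝ E) x := v
  have hv' : ContMDiff (modelWithCornersSelf ℝ E) (modelWithCornersSelf ℝ E).tangent 1
      (fun x => (⟨x, v' x⟩ : TangentBundle (modelWithCornersSelf ℝ E) E)) :=
    contMDiff_vectorSpace_iff_contDiff.2 hv
  obtain ⟨γ, h0, h⟩ := exists_isMIntegralCurve_of_isMIntegralCurveOn hv' hε (fun x => by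
      obtain ⟨γ, h0, h⟩ := h x
      exact ⟨γ, h0, fun t ht => (h t ht).hasFDerivAt.hasMFDerivAt.hasMFDerivWithinAt⟩) x
  refine ⟨γ, h0, fun t => ?_⟩
  have h1 := (h t).hasFDerivAt
  exact h1

/-! ### Global solvability of the pendulum equation -/

section Pendulum

/-- The vector field of the pendulum equation `θ'' = c sin (2 θ)`. -/
noncomputable def pendulumField (c : ℝ) (x : ℝ × ℝ) : ℝ × ℝ := (x.2, c * Real.sin (2 * x.1))

theorem contDiff_pendulumField (c : ℝ) : ContDiff ℝ 1 (pendulumField c) := by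
  unfold pendulumField
  fun_prop

theorem lipschitzWith_pendulumField (c : ℝ) :
    LipschitzWith (1 + 2 * ‖c‖₊) (pendulumField c) := by
  refine LipschitzWith.of_dist_le_mul fun x y => ?_
  rw [Prod.dist_eq]
  have h1 : dist x.1 y.1 ≤ dist x y := le_max_left _ _
  have h2 : dist x.2 y.2 ≤ dist x y := le_max_right _ _
  have h0 : 0 ≤ dist x y := dist_nonneg
  have hs : |Real.sin (2 * x.1) - Real.sin (2 * y.1)| ≤ 2 * dist x.1 y.1 := by
    have := Real.lipschitzWith_sin.dist_le_mul (2 * x.1) (2 * y.1)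
    simp only [Real.dist_eq, NNReal.coe_one, one_mul] at this ⊢
    rw [← mul_sub, abs_mul, abs_two] at this
    exact this
  simp only [pendulumField, NNReal.coe_add, NNReal.coe_one, NNReal.coe_mul, NNReal.coe_ofNat,
    coe_nnnorm, Real.norm_eq_abs]
  refine max_le ?_ ?_
  · nlinarith [abs_nonneg c]
  · rw [Real.dist_eq, ← mul_sub, abs_mul]
    nlinarith [abs_nonneg c, mul_le_mul_of_nonneg_left hs (abs_nonneg c),
      mul_le_mul_of_nonneg_left h1 (abs_nonneg c)]

/-- The field grows at most linearly with slope `1`, so the time `1 / 2` serves every initial point.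
-/
theorem exists_local_pendulum (c : ℝ) (x : ℝ × ℝ) :
    ∃ γ : ℝ → ℝ × ℝ, γ 0 = x ∧
      ∀ t ∈ Ioo (-(1 / 2) : ℝ) (1 / 2), HasDerivAt γ (pendulumField c (γ t)) t := by
  have h0 : (0 : ℝ) ∈ Icc (-(1 / 2) : ℝ) (1 / 2) := by constructor <;> norm_num
  -- On the ball of radius `R` about `x` the field is at most `max (‖x‖ + R) ‖c‖ ≤ 2R`, and `2R ·
  -- (1/2) ≤ R` keeps the curve inside.
  set R : NNReal := ‖x‖₊ + ‖c‖₊ + 1 with hR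
  have hp : IsPicardLindelof (fun _ => pendulumField c) (tmin := -(1 / 2)) (tmax := 1 / 2)
      ⟨0, h0⟩ x R 0 (2 * R) (1 + 2 * ‖c‖₊) := by
    refine ⟨fun t _ => (lipschitzWith_pendulumField c).lipschitzOnWith,
      fun y _ => continuousOn_const, fun t _ y hy => ?_, ?_⟩
    · have hy1 : ‖y‖ ≤ ‖x‖ + R := by
        have := norm_le_of_mem_closedBall hy
        exact this
      have hy2 : ‖y.2‖ ≤ ‖y‖ := norm_snd_le y
      have hs : ‖Real.sin (2 * y.1)‖ ≤ 1 := by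
        rw [Real.norm_eq_abs]; exact Real.abs_sin_le_one _
      have hRR : (R : ℝ) = ‖x‖ + ‖c‖ + 1 := by simp [hR]
      simp only [pendulumField, Prod.norm_mk, NNReal.coe_mul, NNReal.coe_ofNat, norm_mul]
      refine max_le ?_ ?_
      · rw [hRR] at *; linarith [norm_nonneg c]
      · rw [hRR]; nlinarith [norm_nonneg c, norm_nonneg x]
    · simp only [NNReal.coe_mul, NNReal.coe_ofNat, NNReal.coe_zero]
      rw [show max ((1 : ℝ) / 2 - 0) (0 - -(1 / 2)) = 1 / 2 by norm_num]
      linarith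
  obtain ⟨γ, hγ0, hγ⟩ := hp.exists_eq_forall_mem_Icc_hasDerivWithinAt₀
  exact ⟨γ, hγ0, fun t ht => (hγ t (Ioo_subset_Icc_self ht)).hasDerivAt (Icc_mem_nhds ht.1 ht.2)⟩

theorem exists_pendulum (c : ℝ) (x : ℝ × ℝ) :
    ∃ γ : ℝ → ℝ × ℝ, γ 0 = x ∧ ∀ t, HasDerivAt γ (pendulumField c (γ t)) t :=
  exists_global_of_uniform_time (contDiff_pendulumField c) (by norm_num)
    (exists_local_pendulum c) x

end Pendulum

/-! ### Profiles of the cubic equation as pendulum velocities -/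

section Profile

/-- Phase-space orbit of the pendulum whose velocity is the even solution of
`u'' = u - 2u³` with `u 0 = a`. -/
noncomputable def orbit (a : ℝ) : ℝ → ℝ × ℝ :=
  (exists_pendulum (-(2 * a ^ 2 - 1) / 2) (0, a)).choose

/-- The integral of the profile; the amplitude function of the elliptic function `prof`. -/
noncomputable def ang (t a : ℝ) : ℝ := (orbit a t).1

/-- The even solution of `u'' = u - 2u³` with `u 0 = a`. -/
noncomputable def prof (t a : ℝ) : ℝ := (orbit a t).2

/-- The time derivative of `prof`. -/
noncomputable def profD (t a : ℝ) : ℝ := -(2 * a ^ 2 - 1) / 2 * Real.sin (2 * ang t a)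

theorem orbit_zero (a : ℝ) : orbit a 0 = (0, a) :=
  (exists_pendulum (-(2 * a ^ 2 - 1) / 2) (0, a)).choose_spec.1

theorem hasDerivAt_orbit (a t : ℝ) :
    HasDerivAt (orbit a) (pendulumField (-(2 * a ^ 2 - 1) / 2) (orbit a t)) t :=
  (exists_pendulum (-(2 * a ^ 2 - 1) / 2) (0, a)).choose_spec.2 t

@[simp] theorem ang_zero (a : ℝ) : ang 0 a = 0 := by simp [ang, orbit_zero]
@[simp] theorem prof_zero (a : ℝ) : prof 0 a = a := by simp [prof, orbit_zero]
@[simp] theorem profD_zero (a : ℝ) : profD 0 a = 0 := by simp [profD]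

theorem hasDerivAt_ang (t a : ℝ) : HasDerivAt (fun s => ang s a) (prof t a) t :=
  (hasDerivAt_orbit a t).fst

theorem hasDerivAt_prof (t a : ℝ) : HasDerivAt (fun s => prof s a) (profD t a) t :=
  (hasDerivAt_orbit a t).snd

/-- Conservation of the pendulum energy. It turns the sine force into a cubic in `prof`, and later
turns extrema of `prof` into statements about `sin² (ang)`. -/
theorem prof_sq (t a : ℝ) :
    prof t a ^ 2 = a ^ 2 - (2 * a ^ 2 - 1) * Real.sin (ang t a) ^ 2 := by
  have h : ∀ s, HasDerivAt
      (fun s => prof s a ^ 2 + (2 * a ^ 2 - 1) * Real.sin (ang s a) ^ 2) 0 s := by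
    intro s
    have h1 := ((hasDerivAt_prof s a).pow 2).add
      ((((hasDerivAt_ang s a).sin).pow 2).const_mul (2 * a ^ 2 - 1))
    refine h1.congr_deriv ?_
    simp only [profD, Real.sin_two_mul]
    push_cast
    ring
  have h2 := is_const_of_deriv_eq_zero (fun s => (h s).differentiableAt) (fun s => (h s).deriv) t 0
  simp at h2
  linarith

/-- The pendulum gives `u'' = -(2a² - 1)(1 - 2 sin² θ) u`, and the energy identity replaces `(2a² -
1) sin² θ` by `a² - u²`. -/
theorem hasDerivAt_profD (t a : ℝ) :
    HasDerivAt (fun s => profD s a) (prof t a - 2 * prof t a ^ 3) t := by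
  have h := (((hasDerivAt_ang t a).const_mul 2).sin).const_mul (-(2 * a ^ 2 - 1) / 2)
  refine h.congr_deriv ?_
  have h3 : prof t a ^ 3 = prof t a * prof t a ^ 2 := by ring
  rw [h3, prof_sq, Real.cos_two_mul, Real.cos_sq']
  ring

theorem prof_energy (t a : ℝ) :
    profD t a ^ 2 = prof t a ^ 2 - prof t a ^ 4 + (a ^ 4 - a ^ 2) := by
  have h4 : prof t a ^ 4 = (prof t a ^ 2) ^ 2 := by ring
  rw [h4, prof_sq, profD, Real.sin_two_mul, mul_pow, mul_pow, mul_pow, Real.cos_sq']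
  ring

theorem continuous_prof_left (a : ℝ) : Continuous fun t => prof t a :=
  continuous_iff_continuousAt.2 fun t => (hasDerivAt_prof t a).continuousAt

theorem continuous_profD_left (a : ℝ) : Continuous fun t => profD t a :=
  continuous_iff_continuousAt.2 fun t => (hasDerivAt_profD t a).continuousAt

theorem profD_eq (t a : ℝ) : profD t a = -(2 * a ^ 2 - 1) / 2 * Real.sin (2 * ang t a) := rfl

end Profile

attribute [irreducible] orbit ang prof profD

/-! ### Second-order linear equations: uniqueness and comparison -/

section LinearODE

/-- Grönwall's inequality for the pair `(f, f')`, with constant `1 + |C|`. -/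
theorem eq_zero_of_linear_ode {f f' c : ℝ → ℝ} {s T C : ℝ}
    (hf : ∀ t ∈ Icc s T, HasDerivWithinAt f (f' t) (Icc s T) t)
    (hf' : ∀ t ∈ Icc s T, HasDerivWithinAt f' (c t * f t) (Icc s T) t)
    (hc : ∀ t ∈ Icc s T, |c t| ≤ C) (h0 : f s = 0) (h0' : f' s = 0) :
    ∀ t ∈ Icc s T, f t = 0 ∧ f' t = 0 := by
  have key := eq_zero_of_abs_deriv_le_mul_abs_self_of_eq_zero_right (f := fun t => (f t, f' t))
    (f' := fun t => (f' t, c t * f t)) (K := 1 + |C|) (a := s) (b := T)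
    (fun t ht => ((hf t ht).continuousWithinAt.prodMk (hf' t ht).continuousWithinAt))
    (fun t ht => by
      have ht' := Ico_subset_Icc_self ht
      exact ((hf t ht').prodMk (hf' t ht')).mono_of_mem_nhdsWithin
        (Icc_mem_nhdsGE_of_mem ht))
    (by simp [h0, h0'])
    (fun t ht => by
      have hct := (hc t (Ico_subset_Icc_self ht)).trans (le_abs_self C)
      have h1 : |f t| ≤ max |f t| |f' t| := le_max_left _ _
      have h2 : |f' t| ≤ max |f t| |f' t| := le_max_right _ _
      have h3 := abs_nonneg (f t)
      simp only [Prod.norm_mk, Real.norm_eq_abs, abs_mul]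
      refine max_le ?_ ?_
      · nlinarith [abs_nonneg C]
      · have := mul_le_mul hct h1 h3 (abs_nonneg C)
        nlinarith)
  intro t ht
  exact Prod.mk.inj (key t ht)

/-- Comparison: if `D'' = c D` with `c ≥ 0`, `D s > 0` and `D' s ≥ 0`, then `D` and `D'` are
nondecreasing. -/
theorem linear_ode_growth {D D' c : ℝ → ℝ} {s T : ℝ}
    (hD : ∀ t ∈ Icc s T, HasDerivAt D (D' t) t)
    (hD' : ∀ t ∈ Icc s T, HasDerivAt D' (c t * D t) t)
    (hc : ∀ t ∈ Icc s T, 0 ≤ c t) (h0 : 0 < D s) (h0' : 0 ≤ D' s) :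
    ∀ t ∈ Icc s T, D s ≤ D t ∧ D' s ≤ D' t := by
  have hDc : ContinuousOn D (Icc s T) := fun t ht => (hD t ht).continuousAt.continuousWithinAt
  have hDc' : ContinuousOn D' (Icc s T) := fun t ht => (hD' t ht).continuousAt.continuousWithinAt
  have hsub : interior (Icc s T) ⊆ Icc s T := interior_subset
  -- The derivative of `D D'` is `D'² + c D²`, nonnegative whatever the sign of `D`. So `D²` is
  -- nondecreasing, and `D` cannot reach `0`.
  have hprod : MonotoneOn (fun t => D t * D' t) (Icc s T) := by
    refine monotoneOn_of_deriv_nonneg (convex_Icc s T) (hDc.mul hDc')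
      (fun t ht => ((hD t (hsub ht)).mul (hD' t (hsub ht))).differentiableAt.differentiableWithinAt)
      (fun t ht => ?_)
    have h1 := ((hD t (hsub ht)).mul (hD' t (hsub ht))).deriv
    change 0 ≤ deriv (D * D') t
    rw [h1]
    have := mul_nonneg (hc t (hsub ht)) (sq_nonneg (D t))
    nlinarith [sq_nonneg (D' t)]
  have hsq : MonotoneOn (fun t => D t ^ 2) (Icc s T) := by
    refine monotoneOn_of_deriv_nonneg (convex_Icc s T) (hDc.pow 2)
      (fun t ht => ((hD t (hsub ht)).pow 2).differentiableAt.differentiableWithinAt)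
      (fun t ht => ?_)
    have h1 := ((hD t (hsub ht)).pow 2).deriv
    change 0 ≤ deriv (D ^ 2) t
    rw [h1]
    have ht' := hsub ht
    have h2 := hprod (left_mem_Icc.2 (ht'.1.trans ht'.2)) ht' ht'.1
    have h3 := mul_nonneg h0.le h0'
    simp only at h2
    push_cast
    nlinarith
  have hpos : ∀ t ∈ Icc s T, 0 < D t := by
    intro t ht
    by_contra hneg
    push Not at hneg
    obtain ⟨r, hr, hr0⟩ : (0 : ℝ) ∈ D '' Icc s t :=
      intermediate_value_Icc' ht.1 (hDc.mono (Icc_subset_Icc_right ht.2)) ⟨hneg, h0.le⟩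
    have h2 := hsq (left_mem_Icc.2 (ht.1.trans ht.2)) ⟨hr.1, hr.2.trans ht.2⟩ hr.1
    simp only [hr0] at h2
    nlinarith
  have hmono' : MonotoneOn D' (Icc s T) := by
    refine monotoneOn_of_deriv_nonneg (convex_Icc s T) hDc'
      (fun t ht => (hD' t (hsub ht)).differentiableAt.differentiableWithinAt) (fun t ht => ?_)
    rw [(hD' t (hsub ht)).deriv]
    exact mul_nonneg (hc t (hsub ht)) (hpos t (hsub ht)).le
  have hmono : MonotoneOn D (Icc s T) := by
    refine monotoneOn_of_deriv_nonneg (convex_Icc s T) hDc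
      (fun t ht => (hD t (hsub ht)).differentiableAt.differentiableWithinAt) (fun t ht => ?_)
    rw [(hD t (hsub ht)).deriv]
    have ht' := hsub ht
    exact h0'.trans (hmono' (left_mem_Icc.2 (ht'.1.trans ht'.2)) ht' ht'.1)
  intro t ht
  have hs := left_mem_Icc.2 (ht.1.trans ht.2)
  exact ⟨hmono hs ht ht.1, hmono' hs ht ht.1⟩

/-- Time-reversed form of `linear_ode_growth`. -/
theorem linear_ode_growth_left {D D' c : ℝ → ℝ} {s T : ℝ}
    (hD : ∀ t ∈ Icc s T, HasDerivAt D (D' t) t)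
    (hD' : ∀ t ∈ Icc s T, HasDerivAt D' (c t * D t) t)
    (hc : ∀ t ∈ Icc s T, 0 ≤ c t) (h0 : 0 < D T) (h0' : D' T ≤ 0) :
    ∀ t ∈ Icc s T, D T ≤ D t ∧ D' t ≤ D' T := by
  have hmem : ∀ t ∈ Icc (-T) (-s), -t ∈ Icc s T := fun t ht =>
    ⟨by linarith [ht.2], by linarith [ht.1]⟩
  have key := linear_ode_growth (D := fun t => D (-t)) (D' := fun t => -D' (-t))
    (c := fun t => c (-t)) (s := -T) (T := -s)
    (fun t ht => by
      have := (hD (-t) (hmem t ht)).comp t (hasDerivAt_neg t)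
      exact this.congr_deriv (by ring))
    (fun t ht => by
      have := ((hD' (-t) (hmem t ht)).comp t (hasDerivAt_neg t)).neg
      exact this.congr_deriv (by ring))
    (fun t ht => hc _ (hmem t ht)) (by simpa using h0) (by simpa using h0')
  intro t ht
  have := key (-t) ⟨by linarith [ht.2], by linarith [ht.1]⟩
  simp only [neg_neg] at this
  exact ⟨this.1, by linarith [this.2]⟩

end LinearODE

/-! ### The Volterra operator on `C([0,1])` -/

section Volterra

/-- Continuous functions on `[0, 1]`. -/
abbrev UnitFun : Type := C(Icc (0 : ℝ) 1, ℝ)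

/-- Extension of a function on `[0,1]` to the line by constants. -/
noncomputable def unitExt (f : UnitFun) : ℝ → ℝ := IccExtend zero_le_one f

theorem continuous_unitExt (f : UnitFun) : Continuous (unitExt f) := f.continuous.Icc_extend'

theorem unitExt_of_mem (f : UnitFun) {s : ℝ} (hs : s ∈ Icc (0 : ℝ) 1) : unitExt f s = f ⟨s, hs⟩ :=
  IccExtend_of_mem _ _ hs

theorem abs_unitExt_le (f : UnitFun) (s : ℝ) : |unitExt f s| ≤ ‖f‖ :=
  f.norm_coe_le_norm _

/-- The Volterra operator `f ↦ ∫₀ˢ f`. -/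
noncomputable def volterra : UnitFun →L[ℝ] UnitFun :=
  LinearMap.mkContinuous
    { toFun := fun f => ⟨fun s => ∫ r in (0 : ℝ)..s, unitExt f r,
        (intervalIntegral.continuous_primitive
          (fun a b => (continuous_unitExt f).intervalIntegrable a b) 0).comp continuous_subtype_val⟩
      map_add' := fun f g => by
        ext s
        exact intervalIntegral.integral_add ((continuous_unitExt f).intervalIntegrable _ _)
          ((continuous_unitExt g).intervalIntegrable _ _)
      map_smul' := fun c f => by
        ext s
        exact intervalIntegral.integral_const_mul c (unitExt f) } 1 (fun f => by
    rw [one_mul]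
    refine (ContinuousMap.norm_le _ (norm_nonneg f)).2 fun s => ?_
    have h := intervalIntegral.norm_integral_le_of_norm_le_const (a := (0 : ℝ)) (b := s)
      (f := unitExt f) (C := ‖f‖) (fun r _ => abs_unitExt_le f r)
    refine h.trans ?_
    rw [sub_zero, abs_of_nonneg s.2.1]
    exact mul_le_of_le_one_right (norm_nonneg f) s.2.2)

theorem volterra_apply (f : UnitFun) (s : Icc (0 : ℝ) 1) :
    volterra f s = ∫ r in (0 : ℝ)..s, unitExt f r := rfl

theorem abs_volterra_le {f : UnitFun} {g : ℝ → ℝ} (hg : Continuous g)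
    (h : ∀ r : Icc (0 : ℝ) 1, |f r| ≤ g r) (s : Icc (0 : ℝ) 1) :
    |volterra f s| ≤ ∫ r in (0 : ℝ)..s, g r := by
  rw [volterra_apply]
  have hgi : IntervalIntegrable g volume 0 s := hg.intervalIntegrable _ _
  refine intervalIntegral.norm_integral_le_of_norm_le (f := unitExt f) (g := g) s.2.1
    (ae_of_all _ fun r hr => ?_) hgi
  have hr' : r ∈ Icc (0 : ℝ) 1 := ⟨hr.1.le, hr.2.trans s.2.2⟩
  rw [unitExt_of_mem f hr']
  exact h ⟨r, hr'⟩

/-- Iterates of the second-order Volterra operator decay factorially. -/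
theorem abs_volterra_iterate_le (c : UnitFun) (n : ℕ) (f : UnitFun) (s : Icc (0 : ℝ) 1) :
    |((volterra ∘L volterra ∘L (ContinuousLinearMap.mul ℝ UnitFun c)) ^ n) f s| ≤
      ‖c‖ ^ n * (s : ℝ) ^ n / n.factorial * ‖f‖ := by
  induction n generalizing s with
  | zero => simpa using f.norm_coe_le_norm s
  | succ n ih =>
    rw [pow_succ']
    set g := ((volterra ∘L volterra ∘L (ContinuousLinearMap.mul ℝ UnitFun c)) ^ n) f with hg
    change |volterra (volterra (c * g)) s| ≤ _
    have hk : ∀ (k : ℕ) (r : ℝ), ∫ x in (0 : ℝ)..r, x ^ k = r ^ (k + 1) / (k + 1) := by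
      intro k r; rw [integral_pow]; simp
    set A : ℝ := ‖c‖ ^ (n + 1) / n.factorial * ‖f‖ with hA
    have hA0 : 0 ≤ A := by positivity
    have h1 : ∀ r : Icc (0 : ℝ) 1, |(c * g) r| ≤ A * (r : ℝ) ^ n := by
      intro r
      rw [ContinuousMap.mul_apply, abs_mul]
      refine (mul_le_mul (c.norm_coe_le_norm r) (ih r) (abs_nonneg _) (norm_nonneg _)).trans_eq ?_
      rw [hA]; ring
    have h2 : ∀ r : Icc (0 : ℝ) 1, |volterra (c * g) r| ≤ A * (r : ℝ) ^ n := by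
      intro r
      refine (abs_volterra_le (g := fun r => A * r ^ n) (by fun_prop) h1 r).trans ?_
      rw [intervalIntegral.integral_const_mul, hk]
      refine mul_le_mul_of_nonneg_left ?_ hA0
      have hr0 : (0 : ℝ) ≤ (r : ℝ) ^ n := pow_nonneg r.2.1 n
      rw [div_le_iff₀ (by positivity), pow_succ]
      have := r.2.2
      have hn : (0 : ℝ) ≤ n := n.cast_nonneg
      nlinarith [mul_nonneg hr0 hn]
    refine (abs_volterra_le (g := fun r => A * r ^ n) (by fun_prop) h2 s).trans_eq ?_
    rw [intervalIntegral.integral_const_mul, hk, hA, Nat.factorial_succ]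
    push_cast
    field_simp

/-- Factorial decay makes some power `K ^ n` a strict contraction, and `1 - K` is a commuting factor
of the invertible `1 - K ^ n`. No smallness of `c` is needed. -/
theorem isUnit_one_sub_volterra (c : UnitFun) :
    IsUnit (1 - volterra ∘L volterra ∘L (ContinuousLinearMap.mul ℝ UnitFun c)) := by
  set K := volterra ∘L volterra ∘L (ContinuousLinearMap.mul ℝ UnitFun c) with hK
  have hbound : ∀ n, ‖K ^ n‖ ≤ ‖c‖ ^ n / n.factorial := by
    intro n
    refine ContinuousLinearMap.opNorm_le_bound _ (by positivity) fun f => ?_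
    refine (ContinuousMap.norm_le _ (by positivity)).2 fun s => ?_
    refine (abs_volterra_iterate_le c n f s).trans ?_
    refine mul_le_mul_of_nonneg_right ?_ (norm_nonneg f)
    refine div_le_div_of_nonneg_right ?_ (by positivity)
    exact mul_le_of_le_one_right (by positivity) (pow_le_one₀ s.2.1 s.2.2)
  obtain ⟨n, hn⟩ : ∃ n : ℕ, ‖c‖ ^ n / n.factorial < 1 :=
    ((FloorSemiring.tendsto_pow_div_factorial_atTop ‖c‖).eventually_lt_const one_pos).exists
  have hlt := (hbound n).trans_lt hn
  have hu : IsUnit (1 - K ^ n) := isUnit_one_sub_of_norm_lt_one (R := UnitFun →L[ℝ] UnitFun) hlt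
  rw [← mul_neg_geom_sum] at hu
  have hcomm : Commute (1 - K) (∑ i ∈ Finset.range n, K ^ i) := by
    have : (1 - K) * (∑ i ∈ Finset.range n, K ^ i) = (∑ i ∈ Finset.range n, K ^ i) * (1 - K) := by
      rw [mul_neg_geom_sum, geom_sum_mul_neg]
    exact this
  exact (hcomm.isUnit_mul_iff.1 hu).1

end Volterra

/-! ### Smooth dependence of profiles on time and amplitude -/

section Smoothness

/-- The rescaled integral equation on `[0,1]` for the profile. -/
noncomputable def profEq (q : (ℝ × ℝ) × UnitFun) : UnitFun :=
  q.2 - q.1.2 • (1 : UnitFun) - q.1.1 ^ 2 • volterra (volterra (q.2 - (2 : ℝ) • q.2 ^ 3))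

theorem contDiff_profEq : ContDiff ℝ (⊤ : ℕ∞) profEq := by
  unfold profEq
  fun_prop

/-- The rescaled profile. -/
noncomputable def unitProf (t a : ℝ) : UnitFun :=
  ⟨fun s => prof (t * s) a, by
    have := continuous_prof_left a
    fun_prop⟩

/-- Rescaling `[0, t]` to `[0, 1]` makes the time a parameter on the same footing as the amplitude;
the equation is the twice integrated differential equation. -/
theorem profEq_unitProf (t a : ℝ) : profEq ((t, a), unitProf t a) = 0 := by
  have h1 : ∀ s, HasDerivAt (fun r => prof (t * r) a) (t * profD (t * s) a) s := fun s => by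
    have := (hasDerivAt_prof (t * s) a).comp s ((hasDerivAt_id s).const_mul t)
    exact this.congr_deriv (by ring)
  have h2 : ∀ s, HasDerivAt (fun r => profD (t * r) a)
      (t * (prof (t * s) a - 2 * prof (t * s) a ^ 3)) s := fun s => by
    have := (hasDerivAt_profD (t * s) a).comp s ((hasDerivAt_id s).const_mul t)
    exact this.congr_deriv (by ring)
  have c1 : Continuous fun s => prof (t * s) a := by
    have := continuous_prof_left a; fun_prop
  have c2 : Continuous fun s => profD (t * s) a := by
    have := continuous_profD_left a; fun_prop
  have i2 : ∀ s : Icc (0 : ℝ) 1,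
      t * volterra (unitProf t a - (2 : ℝ) • unitProf t a ^ 3) s = profD (t * s) a := by
    intro s
    have hI := intervalIntegral.integral_eq_sub_of_hasDerivAt (a := (0 : ℝ)) (b := s)
      (fun r _ => h2 r)
      (Continuous.intervalIntegrable (by fun_prop) _ _)
    rw [intervalIntegral.integral_const_mul] at hI
    simp only [mul_zero, profD_zero, sub_zero] at hI
    rw [← hI, volterra_apply]
    congr 1
    refine intervalIntegral.integral_congr fun r hr => ?_
    rw [uIcc_of_le s.2.1] at hr
    have hr' : r ∈ Icc (0 : ℝ) 1 := ⟨hr.1, hr.2.trans s.2.2⟩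
    simp only [unitExt_of_mem _ hr']
    rfl
  ext s
  have hI := intervalIntegral.integral_eq_sub_of_hasDerivAt (a := (0 : ℝ)) (b := s)
      (fun r _ => h1 r) (Continuous.intervalIntegrable (by fun_prop) _ _)
  simp only [mul_zero, prof_zero] at hI
  have hJ : t ^ 2 * volterra (volterra (unitProf t a - (2 : ℝ) • unitProf t a ^ 3)) s =
      ∫ r in (0 : ℝ)..s, t * profD (t * r) a := by
    rw [volterra_apply, ← intervalIntegral.integral_const_mul]
    refine intervalIntegral.integral_congr fun r hr => ?_
    rw [uIcc_of_le s.2.1] at hr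
    have hr' : r ∈ Icc (0 : ℝ) 1 := ⟨hr.1, hr.2.trans s.2.2⟩
    simp only [unitExt_of_mem _ hr']
    rw [← i2 ⟨r, hr'⟩]
    ring
  simp only [profEq, ContinuousMap.sub_apply, ContinuousMap.smul_apply, ContinuousMap.one_apply,
    ContinuousMap.zero_apply, smul_eq_mul, mul_one]
  rw [hJ, hI]
  simp [unitProf]

/-- The difference of two solutions is annihilated by `1 - volterra ∘ volterra ∘ c` for a suitable
`c`, which is invertible. Uniqueness is global in `w`, so the implicit function must be the profile.
-/
theorem eq_unitProf_of_profEq {t a : ℝ} {w : UnitFun} (hw : profEq ((t, a), w) = 0) :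
    w = unitProf t a := by
  have h0 := profEq_unitProf t a
  set v := unitProf t a
  set c : UnitFun := t ^ 2 • (1 - (2 : ℝ) • (w ^ 2 + w * v + v ^ 2)) with hc
  obtain ⟨e, he⟩ := isUnit_one_sub_volterra c
  have hker : (1 - volterra ∘L volterra ∘L (ContinuousLinearMap.mul ℝ UnitFun c)) (w - v) = 0 := by
    have hcv : c * (w - v) = t ^ 2 • ((w - (2 : ℝ) • w ^ 3) - (v - (2 : ℝ) • v ^ 3)) := by
      rw [hc, smul_mul_assoc]
      congr 1
      ext s
      simp
      ring
    have hval : (1 - volterra ∘L volterra ∘L (ContinuousLinearMap.mul ℝ UnitFun c)) (w - v)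
        = (w - v) - volterra (volterra (c * (w - v))) := rfl
    rw [hval, hcv, map_smul, map_smul, map_sub, map_sub, smul_sub]
    simp only [profEq] at hw h0
    rw [← sub_eq_zero.2 (hw.trans h0.symm)]
    abel
  have h1 : (e⁻¹ : (UnitFun →L[ℝ] UnitFun)ˣ).val ((e : UnitFun →L[ℝ] UnitFun) (w - v)) = 0 := by
    rw [he, hker, map_zero]
  have h2 : ((e⁻¹ : (UnitFun →L[ℝ] UnitFun)ˣ).val * (e : UnitFun →L[ℝ] UnitFun)) (w - v) = 0 := h1
  rw [Units.inv_mul] at h2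
  exact sub_eq_zero.1 h2

/-- The partial derivative in the unknown is again `1` minus a second-order Volterra operator, with
coefficient `t² (1 - 6u²)`. -/
theorem isInvertible_fderiv_profEq (t a : ℝ) (u : UnitFun) :
    (fderiv ℝ profEq ((t, a), u) ∘L .inr ℝ (ℝ × ℝ) UnitFun).IsInvertible := by
  have hd : HasFDerivAt profEq (fderiv ℝ profEq ((t, a), u)) ((t, a), u) :=
    (contDiff_profEq.differentiable (by simp)).differentiableAt.hasFDerivAt
  have h1 := hd.comp u (hasFDerivAt_prodMk_right (𝕜 := ℝ) (t, a) u)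
  set c : UnitFun := t ^ 2 • (1 - (6 : ℝ) • u ^ 2) with hc
  have h2 : HasFDerivAt (fun v : UnitFun => profEq ((t, a), v))
      (1 - volterra ∘L volterra ∘L (ContinuousLinearMap.mul ℝ UnitFun c)) u := by
    have hid := hasFDerivAt_id (𝕜 := ℝ) u
    have hp := (hid.pow 3).const_smul (2 : ℝ)
    have hv := (((volterra ∘L volterra).hasFDerivAt (x := u - (2 : ℝ) • u ^ 3)).comp u
      (hid.sub hp)).const_smul (t ^ 2)
    have := (hid.sub_const (a • (1 : UnitFun))).sub hv
    refine this.congr_fderiv ?_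
    ext1 g
    have hg : c * g = t ^ 2 • (g - (2 : ℝ) • (3 * u ^ 2 * g)) := by
      rw [hc, smul_mul_assoc]
      congr 1
      ext s
      have h3 : (3 : UnitFun) s = 3 := rfl
      simp [h3]
      ring
    have hval : (1 - volterra ∘L volterra ∘L (ContinuousLinearMap.mul ℝ UnitFun c)) g
        = g - volterra (volterra (c * g)) := rfl
    rw [hval, hg, map_smul, map_smul]
    simp
  have h3 := h1.unique h2
  have h4 : fderiv ℝ profEq ((t, a), u) ∘L .inr ℝ (ℝ × ℝ) UnitFun =
    1 - volterra ∘L volterra ∘L (ContinuousLinearMap.mul ℝ UnitFun c) := h3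
  rw [h4]
  obtain ⟨e, he⟩ := isUnit_one_sub_volterra c
  exact ⟨ContinuousLinearEquiv.ofUnit e, by rw [← he]; rfl⟩

theorem contDiff_unitProf : ContDiff ℝ (⊤ : ℕ∞) fun q : ℝ × ℝ => unitProf q.1 q.2 := by
  rw [contDiff_iff_contDiffAt]
  rintro ⟨t, a⟩
  have hc : ContDiffAt ℝ (⊤ : ℕ∞) profEq ((t, a), unitProf t a) := contDiff_profEq.contDiffAt
  have hinv := isInvertible_fderiv_profEq t a (unitProf t a)
  have hφ := hc.contDiffAt_implicitFunction (by simp) hinv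
  have hev := hc.eventually_apply_implicitFunction (by simp) hinv
  refine hφ.congr_of_eventuallyEq ?_
  filter_upwards [hev] with q hq
  rw [profEq_unitProf] at hq
  exact (eq_unitProf_of_profEq (t := q.1) (a := q.2) hq).symm

theorem unitProf_apply (t a : ℝ) (s : Icc (0 : ℝ) 1) : unitProf t a s = prof (t * s) a := rfl

/-- The right end point of `[0, 1]`. -/
def unitOne : Icc (0 : ℝ) 1 := ⟨1, zero_le_one, le_rfl⟩

theorem contDiff_prof : ContDiff ℝ (⊤ : ℕ∞) fun q : ℝ × ℝ => prof q.1 q.2 := by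
  have h : (fun q : ℝ × ℝ => prof q.1 q.2) =
      fun q => ContinuousMap.evalCLM ℝ unitOne (unitProf q.1 q.2) := by
    funext q
    simp [unitProf_apply, unitOne]
  rw [h]
  exact (ContinuousLinearMap.contDiff _).comp contDiff_unitProf

end Smoothness

/-! ### Partial derivatives and the variational equation -/

section PartialDerivatives

theorem hasDerivAt_fst_of_contDiff {f : ℝ → ℝ → ℝ}
    (hf : ContDiff ℝ (⊤ : ℕ∞) fun q : ℝ × ℝ => f q.1 q.2) (t a : ℝ) :
    HasDerivAt (fun s => f s a) (fderiv ℝ (fun q : ℝ × ℝ => f q.1 q.2) (t, a) (1, 0)) t := by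
  have h1 : HasFDerivAt (fun q : ℝ × ℝ => f q.1 q.2)
      (fderiv ℝ (fun q : ℝ × ℝ => f q.1 q.2) (t, a)) (t, a) :=
    (hf.differentiable (by simp)).differentiableAt.hasFDerivAt
  exact h1.comp_hasDerivAt t ((hasDerivAt_id t).prodMk (hasDerivAt_const t a))

theorem hasDerivAt_snd_of_contDiff {f : ℝ → ℝ → ℝ}
    (hf : ContDiff ℝ (⊤ : ℕ∞) fun q : ℝ × ℝ => f q.1 q.2) (t a : ℝ) :
    HasDerivAt (fun b => f t b) (fderiv ℝ (fun q : ℝ × ℝ => f q.1 q.2) (t, a) (0, 1)) a := by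
  have h1 : HasFDerivAt (fun q : ℝ × ℝ => f q.1 q.2)
      (fderiv ℝ (fun q : ℝ × ℝ => f q.1 q.2) (t, a)) (t, a) :=
    (hf.differentiable (by simp)).differentiableAt.hasFDerivAt
  exact h1.comp_hasDerivAt a ((hasDerivAt_const a t).prodMk (hasDerivAt_id a))

theorem contDiff_deriv_fst {f : ℝ → ℝ → ℝ}
    (hf : ContDiff ℝ (⊤ : ℕ∞) fun q : ℝ × ℝ => f q.1 q.2) :
    ContDiff ℝ (⊤ : ℕ∞) fun q : ℝ × ℝ => deriv (fun s => f s q.2) q.1 := by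
  have h : (fun q : ℝ × ℝ => deriv (fun s => f s q.2) q.1) =
      fun q => fderiv ℝ (fun q : ℝ × ℝ => f q.1 q.2) q (1, 0) := by
    funext q
    exact (hasDerivAt_fst_of_contDiff hf q.1 q.2).deriv
  rw [h]
  exact (hf.fderiv_right (m := (⊤ : ℕ∞)) (by simp)).clm_apply contDiff_const

theorem contDiff_deriv_snd {f : ℝ → ℝ → ℝ}
    (hf : ContDiff ℝ (⊤ : ℕ∞) fun q : ℝ × ℝ => f q.1 q.2) :
    ContDiff ℝ (⊤ : ℕ∞) fun q : ℝ × ℝ => deriv (fun b => f q.1 b) q.2 := by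
  have h : (fun q : ℝ × ℝ => deriv (fun b => f q.1 b) q.2) =
      fun q => fderiv ℝ (fun q : ℝ × ℝ => f q.1 q.2) q (0, 1) := by
    funext q
    exact (hasDerivAt_snd_of_contDiff hf q.1 q.2).deriv
  rw [h]
  exact (hf.fderiv_right (m := (⊤ : ℕ∞)) (by simp)).clm_apply contDiff_const

/-- Equality of mixed partial derivatives. -/
theorem hasDerivAt_deriv_snd {f : ℝ → ℝ → ℝ}
    (hf : ContDiff ℝ (⊤ : ℕ∞) fun q : ℝ × ℝ => f q.1 q.2) (t a : ℝ) :
    HasDerivAt (fun s => deriv (fun b => f s b) a)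
      (deriv (fun b => deriv (fun s => f s b) t) a) t := by
  set F : ℝ × ℝ → ℝ := fun q => f q.1 q.2 with hF
  have hd : HasFDerivAt (fderiv ℝ F) (fderiv ℝ (fderiv ℝ F) (t, a)) (t, a) :=
    ((hf.fderiv_right (m := (⊤ : ℕ∞)) (by simp)).differentiable (by simp)).differentiableAt.hasFDerivAt
  have hsymm : fderiv ℝ (fderiv ℝ F) (t, a) (1, 0) (0, 1) =
      fderiv ℝ (fderiv ℝ F) (t, a) (0, 1) (1, 0) :=
    (hf.contDiffAt.isSymmSndFDerivAt
      (by rw [minSmoothness_of_isRCLikeNormedField]; exact WithTop.coe_le_coe.2 (le_top : (2 : ℕ∞) ≤ ⊤))).eq _ _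
  have e1 : (fun s => deriv (fun b => f s b) a) = fun s => fderiv ℝ F (s, a) (0, 1) := by
    funext s; exact (hasDerivAt_snd_of_contDiff hf s a).deriv
  have e2 : (fun b => deriv (fun s => f s b) t) = fun b => fderiv ℝ F (t, b) (1, 0) := by
    funext b; exact (hasDerivAt_fst_of_contDiff hf t b).deriv
  have d1 : HasDerivAt (fun s => fderiv ℝ F (s, a) (0, 1))
      (fderiv ℝ (fderiv ℝ F) (t, a) (1, 0) (0, 1)) t := by
    have h := hd.comp_hasDerivAt t ((hasDerivAt_id t).prodMk (hasDerivAt_const t a))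
    have := h.clm_apply (hasDerivAt_const t ((0 : ℝ), (1 : ℝ)))
    simpa using this
  have d2 : HasDerivAt (fun b => fderiv ℝ F (t, b) (1, 0))
      (fderiv ℝ (fderiv ℝ F) (t, a) (0, 1) (1, 0)) a := by
    have h := hd.comp_hasDerivAt a ((hasDerivAt_const a t).prodMk (hasDerivAt_id a))
    have := h.clm_apply (hasDerivAt_const a ((1 : ℝ), (0 : ℝ)))
    simpa using this
  rw [e1, e2, d2.deriv, ← hsymm]
  exact d1

end PartialDerivatives

section ProfileDerivatives

/-- The derivative of `prof` in the amplitude. -/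
noncomputable def profA (t a : ℝ) : ℝ := deriv (fun b => prof t b) a

/-- The mixed second derivative of `prof`. -/
noncomputable def profDA (t a : ℝ) : ℝ := deriv (fun b => profD t b) a

theorem profD_eq_deriv (t a : ℝ) : profD t a = deriv (fun s => prof s a) t :=
  (hasDerivAt_prof t a).deriv.symm

theorem contDiff_profD : ContDiff ℝ (⊤ : ℕ∞) fun q : ℝ × ℝ => profD q.1 q.2 := by
  simp only [profD_eq_deriv]
  exact contDiff_deriv_fst contDiff_prof

theorem contDiff_profA : ContDiff ℝ (⊤ : ℕ∞) fun q : ℝ × ℝ => profA q.1 q.2 :=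
  contDiff_deriv_snd contDiff_prof

theorem contDiff_profDA : ContDiff ℝ (⊤ : ℕ∞) fun q : ℝ × ℝ => profDA q.1 q.2 :=
  contDiff_deriv_snd contDiff_profD

theorem hasDerivAt_prof_right (t a : ℝ) : HasDerivAt (fun b => prof t b) (profA t a) a :=
  (hasDerivAt_snd_of_contDiff contDiff_prof t a).differentiableAt.hasDerivAt

theorem hasDerivAt_profD_right (t a : ℝ) : HasDerivAt (fun b => profD t b) (profDA t a) a :=
  (hasDerivAt_snd_of_contDiff contDiff_profD t a).differentiableAt.hasDerivAt

theorem hasDerivAt_profA (t a : ℝ) : HasDerivAt (fun s => profA s a) (profDA t a) t := by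
  have h := hasDerivAt_deriv_snd contDiff_prof t a
  simp only [← profD_eq_deriv] at h
  exact h

theorem hasDerivAt_profDA (t a : ℝ) :
    HasDerivAt (fun s => profDA s a) ((1 - 6 * prof t a ^ 2) * profA t a) t := by
  have h := hasDerivAt_deriv_snd contDiff_profD t a
  have e : (fun b => deriv (fun s => profD s b) t) = fun b => prof t b - 2 * prof t b ^ 3 := by
    funext b; exact (hasDerivAt_profD t b).deriv
  rw [e] at h
  have h1 := (hasDerivAt_prof_right t a)
  have h2 := (h1.sub ((h1.pow 3).const_mul 2)).deriv
  have h3 : deriv (fun b => prof t b - 2 * prof t b ^ 3) a = (1 - 6 * prof t a ^ 2) * profA t a := by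
    refine Eq.trans h2 ?_
    push_cast
    ring
  rw [h3] at h
  exact h

@[simp] theorem profA_zero (a : ℝ) : profA 0 a = 1 := by simp [profA]
@[simp] theorem profDA_zero (a : ℝ) : profDA 0 a = 0 := by simp [profDA]

theorem continuous_prof : Continuous fun q : ℝ × ℝ => prof q.1 q.2 := contDiff_prof.continuous
theorem continuous_profD : Continuous fun q : ℝ × ℝ => profD q.1 q.2 := contDiff_profD.continuous
theorem continuous_profA : Continuous fun q : ℝ × ℝ => profA q.1 q.2 := contDiff_profA.continuous
theorem continuous_profDA : Continuous fun q : ℝ × ℝ => profDA q.1 q.2 := contDiff_profDA.continuous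

end ProfileDerivatives

/-! ### Uniqueness of profiles, parity, and explicit formulas at the soliton -/

section Uniqueness

/-- Uniqueness for `u'' = ω u - 2 u³` on a compact interval. -/
theorem nls_unique {u u' v v' : ℝ → ℝ} {ω s T : ℝ}
    (hu : ∀ t ∈ Icc s T, HasDerivWithinAt u (u' t) (Icc s T) t)
    (hu' : ∀ t ∈ Icc s T, HasDerivWithinAt u' (ω * u t - 2 * u t ^ 3) (Icc s T) t)
    (hv : ∀ t ∈ Icc s T, HasDerivWithinAt v (v' t) (Icc s T) t)
    (hv' : ∀ t ∈ Icc s T, HasDerivWithinAt v' (ω * v t - 2 * v t ^ 3) (Icc s T) t)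
    (h0 : u s = v s) (h0' : u' s = v' s) :
    ∀ t ∈ Icc s T, u t = v t ∧ u' t = v' t := by
  have cu : ContinuousOn u (Icc s T) := fun t ht => (hu t ht).continuousWithinAt
  have cv : ContinuousOn v (Icc s T) := fun t ht => (hv t ht).continuousWithinAt
  have cc : ContinuousOn (fun t => ω - 2 * (u t ^ 2 + u t * v t + v t ^ 2)) (Icc s T) := by
    fun_prop
  obtain ⟨C, hC⟩ := isCompact_Icc.exists_bound_of_continuousOn cc
  have key := eq_zero_of_linear_ode (f := fun t => u t - v t) (f' := fun t => u' t - v' t)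
    (c := fun t => ω - 2 * (u t ^ 2 + u t * v t + v t ^ 2)) (s := s) (T := T) (C := C)
    (fun t ht => (hu t ht).sub (hv t ht))
    (fun t ht => ((hu' t ht).sub (hv' t ht)).congr_deriv (by ring)) hC
    (by simp [h0]) (by simp [h0'])
  intro t ht
  exact ⟨sub_eq_zero.1 (key t ht).1, sub_eq_zero.1 (key t ht).2⟩

/-- Uniqueness of the profile among solutions on the half-line. -/
theorem eq_prof_of_hasDerivAt {u u' : ℝ → ℝ} (hu : ∀ t, HasDerivAt u (u' t) t)
    (hu' : ∀ t, HasDerivAt u' (u t - 2 * u t ^ 3) t) (h0 : u' 0 = 0) {t : ℝ} (ht : 0 ≤ t) :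
    u t = prof t (u 0) ∧ u' t = profD t (u 0) := by
  refine nls_unique (ω := 1) (s := 0) (T := t) (fun r _ => (hu r).hasDerivWithinAt)
    (fun r _ => ((hu' r).congr_deriv (by ring)).hasDerivWithinAt)
    (fun r _ => (hasDerivAt_prof r (u 0)).hasDerivWithinAt)
    (fun r _ => ((hasDerivAt_profD r (u 0)).congr_deriv (by ring)).hasDerivWithinAt)
    (by simp) (by simp [h0]) t ⟨ht, le_rfl⟩

theorem prof_neg_aux (a : ℝ) {t : ℝ} (ht : 0 ≤ t) :
    prof (-t) a = prof t a ∧ -profD (-t) a = profD t a := by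
  have h := eq_prof_of_hasDerivAt (u := fun t => prof (-t) a) (u' := fun t => -profD (-t) a)
    (fun t => ((hasDerivAt_prof (-t) a).comp t (hasDerivAt_neg t)).congr_deriv (by ring))
    (fun t => (((hasDerivAt_profD (-t) a).comp t (hasDerivAt_neg t)).neg).congr_deriv (by ring))
    (by simp) ht
  simpa using h

theorem prof_neg (t a : ℝ) : prof (-t) a = prof t a := by
  rcases le_total 0 t with h | h
  · exact (prof_neg_aux a h).1
  · have := (prof_neg_aux a (neg_nonneg.2 h)).1
    rw [neg_neg] at this
    exact this.symm

theorem profD_neg (t a : ℝ) : profD (-t) a = -profD t a := by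
  rcases le_total 0 t with h | h
  · linarith [(prof_neg_aux a h).2]
  · have := (prof_neg_aux a (neg_nonneg.2 h)).2
    rw [neg_neg] at this
    linarith

theorem profA_neg (t a : ℝ) : profA (-t) a = profA t a := by
  simp only [profA, prof_neg]

theorem profDA_neg (t a : ℝ) : profDA (-t) a = -profDA t a := by
  simp only [profDA, profD_neg]
  exact deriv.fun_neg

theorem prof_amp_zero {t : ℝ} (ht : 0 ≤ t) : prof t 0 = 0 := by
  have h := eq_prof_of_hasDerivAt (u := fun _ => 0) (u' := fun _ => 0)
    (fun t => hasDerivAt_const t 0)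
    (fun t => (hasDerivAt_const t 0).congr_deriv (by ring)) rfl ht
  exact h.1.symm

theorem hasDerivAt_sech (t : ℝ) :
    HasDerivAt (fun s => (Real.cosh s)⁻¹) (-Real.sinh t / Real.cosh t ^ 2) t :=
  (Real.hasDerivAt_cosh t).inv (Real.cosh_pos t).ne'

theorem hasDerivAt_sech_deriv (t : ℝ) :
    HasDerivAt (fun s => -Real.sinh s / Real.cosh s ^ 2)
      ((Real.cosh t)⁻¹ - 2 * (Real.cosh t)⁻¹ ^ 3) t := by
  have hc := (Real.cosh_pos t).ne'
  have h := ((Real.hasDerivAt_sinh t).neg).div ((Real.hasDerivAt_cosh t).pow 2) (pow_ne_zero 2 hc)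
  refine h.congr_deriv ?_
  have hs : Real.sinh t ^ 2 = Real.cosh t ^ 2 - 1 := by linarith [Real.cosh_sq t]
  simp only [Pi.pow_apply, Pi.neg_apply]
  field_simp
  push_cast
  linear_combination (2 * Real.cosh t) * hs

theorem prof_one {t : ℝ} (ht : 0 ≤ t) :
    prof t 1 = (Real.cosh t)⁻¹ ∧ profD t 1 = -Real.sinh t / Real.cosh t ^ 2 := by
  have h := eq_prof_of_hasDerivAt hasDerivAt_sech hasDerivAt_sech_deriv (by simp) ht
  simp only [Real.cosh_zero, inv_one] at h
  exact ⟨h.1.symm, h.2.symm⟩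

/-- The even solution of the linearisation at `sech`, multiplied by `cosh`. -/
theorem profA_one {t : ℝ} (ht : 0 ≤ t) :
    profA t 1 = (Real.cosh t)⁻¹ - 3 / 2 * t * Real.sinh t / Real.cosh t ^ 2
      - 1 / 2 * Real.sinh t ^ 2 / Real.cosh t ∧
    profDA t 1 = -(5 / 2) * Real.sinh t / Real.cosh t ^ 2
      - 3 / 2 * t * ((Real.cosh t)⁻¹ - 2 * Real.sinh t ^ 2 / Real.cosh t ^ 3)
      - 1 / 2 * Real.sinh t * (1 + (Real.cosh t)⁻¹ ^ 2) := by
  set f : ℝ → ℝ := fun t => (Real.cosh t)⁻¹ - 3 / 2 * t * Real.sinh t / Real.cosh t ^ 2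
      - 1 / 2 * Real.sinh t ^ 2 / Real.cosh t with hf
  set f' : ℝ → ℝ := fun t => -(5 / 2) * Real.sinh t / Real.cosh t ^ 2
      - 3 / 2 * t * ((Real.cosh t)⁻¹ - 2 * Real.sinh t ^ 2 / Real.cosh t ^ 3)
      - 1 / 2 * Real.sinh t * (1 + (Real.cosh t)⁻¹ ^ 2) with hf'
  have hs : ∀ t, Real.sinh t ^ 2 = Real.cosh t ^ 2 - 1 := fun t => by linarith [Real.cosh_sq t]
  have hd : ∀ t, HasDerivAt f (f' t) t := by
    intro t
    have hc := (Real.cosh_pos t).ne'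
    have h1 := (hasDerivAt_sech t).sub
      ((((hasDerivAt_id t).const_mul (3 / 2)).mul (Real.hasDerivAt_sinh t)).div
        ((Real.hasDerivAt_cosh t).pow 2) (pow_ne_zero 2 hc))
    have h2 := h1.sub ((((Real.hasDerivAt_sinh t).pow 2).const_mul (1 / 2)).div
      (Real.hasDerivAt_cosh t) hc)
    refine h2.congr_deriv ?_
    simp only [hf', Pi.pow_apply, Pi.mul_apply, id]
    field_simp
    push_cast
    have h4 : Real.sinh t ^ 3 = Real.sinh t * (Real.cosh t ^ 2 - 1) := by rw [← hs]; ring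
    ring_nf
    simp only [h4, hs]
    ring
  have hd' : ∀ t, HasDerivAt f' ((1 - 6 * (Real.cosh t)⁻¹ ^ 2) * f t) t := by
    intro t
    have hc := (Real.cosh_pos t).ne'
    have hi := hasDerivAt_sech t
    have h1 := (((Real.hasDerivAt_sinh t).const_mul (-(5 / 2))).div
      ((Real.hasDerivAt_cosh t).pow 2) (pow_ne_zero 2 hc)).sub
      (((hasDerivAt_id t).const_mul (3 / 2)).mul (hi.sub
        ((((Real.hasDerivAt_sinh t).pow 2).const_mul 2).div
          ((Real.hasDerivAt_cosh t).pow 3) (pow_ne_zero 3 hc))))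
    have h2 := h1.sub (((Real.hasDerivAt_sinh t).const_mul (1 / 2)).mul ((hi.pow 2).const_add 1))
    refine h2.congr_deriv ?_
    simp only [hf, Pi.pow_apply, Pi.sub_apply, Pi.div_apply, id, Nat.reduceSub, pow_one]
    field_simp
    push_cast
    have h3 : Real.sinh t ^ 3 = Real.sinh t * (Real.cosh t ^ 2 - 1) := by rw [← hs]; ring
    ring_nf
    simp only [h3, hs]
    ring
  obtain ⟨C, hC⟩ := isCompact_Icc.exists_bound_of_continuousOn (s := Icc 0 t)
    (f := fun r => 1 - 6 * prof r 1 ^ 2)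
    (by have := continuous_prof_left 1; fun_prop)
  -- `f` and `profA · 1` solve the same linearised equation with data `(1, 0)` at time `0`, so the
  -- closed form is justified by uniqueness alone.
  have key := eq_zero_of_linear_ode (f := fun r => profA r 1 - f r) (f' := fun r => profDA r 1 - f' r)
    (c := fun r => 1 - 6 * prof r 1 ^ 2) (s := 0) (T := t) (C := C)
    (fun r _ => ((hasDerivAt_profA r 1).sub (hd r)).hasDerivWithinAt)
    (fun r hr => by
      refine (((hasDerivAt_profDA r 1).sub (hd' r)).congr_deriv ?_).hasDerivWithinAt
      rw [(prof_one hr.1).1]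
      ring) hC (by simp [hf]) (by simp [hf'])
  have := key t ⟨ht, le_rfl⟩
  exact ⟨sub_eq_zero.1 this.1, sub_eq_zero.1 this.2⟩

end Uniqueness

attribute [irreducible] profA profDA

/-! ### Numerical facts at time `3` and uniform constants near amplitude `1` -/

section Constants

theorem ang_eq_integral (t a : ℝ) : ang t a = ∫ s in (0 : ℝ)..t, prof s a := by
  rw [intervalIntegral.integral_eq_sub_of_hasDerivAt (fun s _ => hasDerivAt_ang s a)
    ((continuous_prof_left a).intervalIntegrable _ _)]
  simp

theorem continuous_ang_left (a : ℝ) : Continuous fun t => ang t a :=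
  continuous_iff_continuousAt.2 fun t => (hasDerivAt_ang t a).continuousAt

theorem continuous_ang_right (t : ℝ) : Continuous fun a => ang t a := by
  simp only [ang_eq_integral]
  refine intervalIntegral.continuous_parametric_intervalIntegral_of_continuous' ?_ 0 t
  exact continuous_prof.comp continuous_swap

theorem continuous_prof_right (t : ℝ) : Continuous fun a => prof t a :=
  continuous_prof.comp (g := fun q : ℝ × ℝ => prof q.1 q.2) (Continuous.prodMk_right t)

theorem continuous_profD_right (t : ℝ) : Continuous fun a => profD t a :=
  continuous_profD.comp (g := fun q : ℝ × ℝ => profD q.1 q.2) (Continuous.prodMk_right t)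

theorem continuous_profA_right (t : ℝ) : Continuous fun a => profA t a :=
  continuous_profA.comp (g := fun q : ℝ × ℝ => profA q.1 q.2) (Continuous.prodMk_right t)

theorem continuous_profDA_right (t : ℝ) : Continuous fun a => profDA t a :=
  continuous_profDA.comp (g := fun q : ℝ × ℝ => profDA q.1 q.2) (Continuous.prodMk_right t)

theorem nine_le_sinh_three : 9 ≤ Real.sinh 3 ∧ 9 ≤ Real.cosh 3 := by
  have h1 := Real.exp_one_gt_d9
  have h2 : Real.exp 3 = Real.exp 1 ^ 3 := by rw [← Real.exp_nat_mul]; norm_num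
  have h3 : (19 : ℝ) < Real.exp 3 := by
    rw [h2]
    have : (2.7 : ℝ) ^ 3 ≤ Real.exp 1 ^ 3 := pow_le_pow_left₀ (by norm_num) (by linarith) 3
    norm_num at this
    linarith
  have h4 : Real.exp (-3) ≤ 1 := Real.exp_le_one_iff.2 (by norm_num)
  have h5 := Real.exp_pos (-3)
  rw [Real.sinh_eq, Real.cosh_eq]
  constructor <;> linarith

/-- By time `3` the exponentially growing part of the even variation, `-(1/2) sinh² / cosh`,
outweighs the decaying ones. From here on a larger amplitude means a smaller value and a smaller
slope. -/
theorem profA_three_one_neg : profA 3 1 < 0 ∧ profDA 3 1 < 0 := by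
  obtain ⟨hs, hc⟩ := nine_le_sinh_three
  have h := profA_one (t := 3) (by norm_num)
  set S := Real.sinh 3
  set C := Real.cosh 3
  have hsc : S < C := Real.sinh_lt_cosh 3
  have hC0 : 0 < C := by linarith
  rw [h.1, h.2]
  constructor
  · have : C⁻¹ - 3 / 2 * 3 * S / C ^ 2 - 1 / 2 * S ^ 2 / C =
        (C - 9 / 2 * S - 1 / 2 * S ^ 2 * C) / C ^ 2 := by
      field_simp
      ring
    rw [this]
    refine div_neg_of_neg_of_pos ?_ (by positivity)
    have h1 : 81 ≤ S ^ 2 := by nlinarith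
    nlinarith [mul_le_mul_of_nonneg_right h1 hC0.le]
  · have : -(5 / 2) * S / C ^ 2 - 3 / 2 * 3 * (C⁻¹ - 2 * S ^ 2 / C ^ 3)
        - 1 / 2 * S * (1 + C⁻¹ ^ 2) =
        (-(5 / 2) * S * C - 9 / 2 * (C ^ 2 - 2 * S ^ 2) - 1 / 2 * S * (C ^ 3 + C)) / C ^ 3 := by
      field_simp
      ring
    rw [this]
    refine div_neg_of_neg_of_pos ?_ (by positivity)
    have h1 : 81 ≤ C ^ 2 := by nlinarith
    have h2 : 81 * C ≤ C ^ 3 := by nlinarith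
    have h3 : S * (81 * C) ≤ S * C ^ 3 := mul_le_mul_of_nonneg_left h2 (by linarith)
    have h4 : S * S ≤ S * C := mul_le_mul_of_nonneg_left hsc.le (by linarith)
    have h5 : 0 < S * C := by nlinarith
    nlinarith

/-- At amplitude `1` the energy identity reads `prof² = 1 - sin² (ang)`, which would vanish at the
angle `π/2`, whereas `sech` has no zero. -/
theorem ang_three_one_lt : ang 3 1 < Real.pi / 2 := by
  by_contra hcon
  push Not at hcon
  obtain ⟨t, ht, hte⟩ : Real.pi / 2 ∈ (fun t => ang t 1) '' Icc 0 3 :=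
    intermediate_value_Icc (by norm_num) (continuous_ang_left 1).continuousOn
      ⟨by simpa using Real.pi_div_two_pos.le, hcon⟩
  have h1 := prof_sq t 1
  simp only at hte
  rw [hte, (prof_one ht.1).1, Real.sin_pi_div_two] at h1
  have := pow_pos (inv_pos.2 (Real.cosh_pos t)) 2
  linarith

theorem prof_three_one_lt : prof 3 1 < 3 / 20 := by
  rw [(prof_one (by norm_num)).1]
  have := nine_le_sinh_three.2
  rw [inv_lt_comm₀ (by linarith) (by norm_num)]
  linarith

/-- Uniform control, at times `t ≤ 3`, of the profiles with amplitude close to `1`. -/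
theorem exists_central_constants : ∃ ε c : ℝ, 0 < ε ∧ ε ≤ 1 / 10 ∧ 0 < c ∧
    ∀ a : ℝ, |a - 1| < ε → profA 3 a ≤ -c ∧ profDA 3 a ≤ -c ∧ (∀ t ∈ Icc (0 : ℝ) 3, 0 < prof t a) ∧
      prof 3 a < 3 / 20 ∧ ang 3 a < Real.pi / 2 := by
  obtain ⟨hA, hDA⟩ := profA_three_one_neg
  set c := min (-profA 3 1) (-profDA 3 1) / 2 with hc
  have hm : 0 < min (-profA 3 1) (-profDA 3 1) := lt_min (by linarith) (by linarith)
  have hc0 : 0 < c := by positivity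
  have e1 : ∀ᶠ a in 𝓝 (1 : ℝ), profA 3 a < -c := by
    refine (continuous_profA_right 3).continuousAt.eventually_lt_const ?_
    have := min_le_left (-profA 3 1) (-profDA 3 1)
    linarith
  have e2 : ∀ᶠ a in 𝓝 (1 : ℝ), profDA 3 a < -c := by
    refine (continuous_profDA_right 3).continuousAt.eventually_lt_const ?_
    have := min_le_right (-profA 3 1) (-profDA 3 1)
    linarith
  have e3 : ∀ᶠ a in 𝓝 (1 : ℝ), ∀ t ∈ Icc (0 : ℝ) 3, 0 < prof t a := by
    refine isCompact_Icc.eventually_forall_of_forall_eventually fun t ht => ?_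
    have hcont : Continuous fun z : ℝ × ℝ => prof z.2 z.1 := continuous_prof.comp continuous_swap
    refine hcont.continuousAt.eventually_const_lt ?_
    simp only [(prof_one ht.1).1]
    exact inv_pos.2 (Real.cosh_pos t)
  have e4 : ∀ᶠ a in 𝓝 (1 : ℝ), prof 3 a < 3 / 20 := by
    exact (continuous_prof_right 3).continuousAt.eventually_lt_const prof_three_one_lt
  have e5 : ∀ᶠ a in 𝓝 (1 : ℝ), ang 3 a < Real.pi / 2 :=
    (continuous_ang_right 3).continuousAt.eventually_lt_const ang_three_one_lt
  obtain ⟨ε, hε, h⟩ := Metric.eventually_nhds_iff.1 (e1.and (e2.and (e3.and (e4.and e5))))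
  refine ⟨min ε (1 / 10), c, by positivity, min_le_right _ _, hc0, fun a ha => ?_⟩
  have := h (y := a) (by rw [Real.dist_eq]; exact ha.trans_le (min_le_left _ _))
  exact ⟨this.1.le, this.2.1.le, this.2.2⟩

/-- Radius of the neighbourhood of `1` in which amplitudes are considered. -/
noncomputable def ampRadius : ℝ := exists_central_constants.choose

/-- Lower bound for the amplitude derivatives at time `3`. -/
noncomputable def ampSlope : ℝ := exists_central_constants.choose_spec.choose

theorem ampRadius_pos : 0 < ampRadius := exists_central_constants.choose_spec.choose_spec.1
theorem ampRadius_le : ampRadius ≤ 1 / 10 := exists_central_constants.choose_spec.choose_spec.2.1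
theorem ampSlope_pos : 0 < ampSlope := exists_central_constants.choose_spec.choose_spec.2.2.1
theorem central_spec {a : ℝ} (ha : |a - 1| < ampRadius) :
    profA 3 a ≤ -ampSlope ∧ profDA 3 a ≤ -ampSlope ∧ (∀ t ∈ Icc (0 : ℝ) 3, 0 < prof t a) ∧
      prof 3 a < 3 / 20 ∧ ang 3 a < Real.pi / 2 :=
  exists_central_constants.choose_spec.choose_spec.2.2.2 a ha

end Constants

/-! ### First crossing of a level in a one-parameter family -/

section Crossing

/-- First parameter at which a continuous family of functions on a compact interval reaches a
given level. -/
theorem exists_first_crossing {g : ℝ → ℝ → ℝ} (hg : Continuous fun q : ℝ × ℝ => g q.1 q.2)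
    {s T x c : ℝ} (h0 : ∀ t ∈ Icc s T, g t 0 < c) (hx : 0 ≤ x) (hxc : ∃ t ∈ Icc s T, c ≤ g t x) :
    ∃ z ∈ Ioc 0 x, (∀ t ∈ Icc s T, g t z ≤ c) ∧ (∃ t ∈ Icc s T, g t z = c) ∧
      ∀ w ∈ Ico 0 z, ∀ t ∈ Icc s T, g t w < c := by
  -- The parameters at which the level is reached form the projection of a compact set, so there is
  -- a least one.
  set Z : Set ℝ := Prod.snd '' ((Icc s T ×ˢ Icc 0 x) ∩ {q : ℝ × ℝ | c ≤ g q.1 q.2}) with hZ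
  have hZc : IsCompact Z :=
    ((isCompact_Icc.prod isCompact_Icc).inter_right (isClosed_le continuous_const hg)).image
      continuous_snd
  obtain ⟨t₁, ht₁, hg₁⟩ := hxc
  have hne : Z.Nonempty := ⟨x, (t₁, x), ⟨⟨ht₁, hx, le_rfl⟩, hg₁⟩, rfl⟩
  obtain ⟨z, hz⟩ := hZc.exists_isLeast hne
  obtain ⟨⟨t₂, z'⟩, ⟨⟨ht₂, hz'⟩, hg₂⟩, rfl⟩ := hz.1
  simp only [mem_ofPred_eq] at hg₂ ht₂ hz' hz ⊢
  have hlt : ∀ w ∈ Ico 0 z', ∀ t ∈ Icc s T, g t w < c := by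
    intro w hw t ht
    by_contra hcon
    push Not at hcon
    have := hz.2 ⟨(t, w), ⟨⟨ht, hw.1, hw.2.le.trans hz'.2⟩, hcon⟩, rfl⟩
    exact absurd hw.2 (not_lt.2 this)
  have hz0 : 0 < z' := by
    rcases hz'.1.lt_or_eq with h | h
    · exact h
    · rw [← h] at hg₂
      exact absurd (h0 t₂ ht₂) (not_lt.2 hg₂)
  have hle : ∀ t ∈ Icc s T, g t z' ≤ c := by
    intro t ht
    have hcont : Continuous fun w => g t w := hg.comp (Continuous.prodMk_right t)
    have hmem : z' ∈ closure (Ico 0 z') := by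
      rw [closure_Ico hz0.ne]; exact ⟨hz0.le, le_rfl⟩
    exact closure_minimal (fun w hw => (hlt w hw t ht).le)
      (isClosed_le hcont continuous_const) hmem
  exact ⟨z', ⟨hz0, hz'.2⟩, hle, ⟨t₂, ht₂, le_antisymm (hle t₂ ht₂) hg₂⟩, hlt⟩

end Crossing

/-! ### Coefficients in the convexity range `|u| < 2/5` -/

section Difference

/-- The difference of two profiles solves a linear equation. -/
theorem hasDerivAt_profD_sub (t a b : ℝ) :
    HasDerivAt (fun s => profD s a - profD s b)
      ((1 - 2 * (prof t a ^ 2 + prof t a * prof t b + prof t b ^ 2)) * (prof t a - prof t b)) t :=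
  ((hasDerivAt_profD t a).sub (hasDerivAt_profD t b)).congr_deriv (by ring)

/-- The threshold `2/5` is chosen because `6 (2/5)² = 24/25 < 1`: below it the linearised equation
and the equation for a difference of two profiles both have nonnegative coefficients, as the
comparison principle requires. -/
theorem difference_coeff_nonneg {u v : ℝ} (hu : |u| < 2 / 5) (hv : |v| < 2 / 5) :
    0 ≤ 1 - 2 * (u ^ 2 + u * v + v ^ 2) := by
  rw [abs_lt] at hu hv
  nlinarith [sq_nonneg (u - v), mul_pos (sub_pos.2 hu.1) (sub_pos.2 hu.2),
    mul_pos (sub_pos.2 hv.1) (sub_pos.2 hv.2)]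

theorem profile_coeff_pos {u : ℝ} (hu : |u| < 2 / 5) : 0 < 1 - 6 * u ^ 2 := by
  rw [abs_lt] at hu
  nlinarith [mul_pos (sub_pos.2 hu.1) (sub_pos.2 hu.2)]

theorem profile_coeff_half {u : ℝ} (hu : |u| < 2 / 5) : 1 / 2 ≤ 1 - 2 * u ^ 2 := by
  rw [abs_lt] at hu
  nlinarith [mul_pos (sub_pos.2 hu.1) (sub_pos.2 hu.2)]

theorem hasDerivAt_profD' (t a : ℝ) :
    HasDerivAt (fun s => profD s a) ((1 - 2 * prof t a ^ 2) * prof t a) t :=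
  (hasDerivAt_profD t a).congr_deriv (by ring)

end Difference

/-! ### Low profiles -/

section Low

/-- Profiles on `[0, T]` with positive amplitude that stay below `2 / 5`. -/
def IsLow (T b : ℝ) : Prop := 0 < T ∧ 0 < b ∧ ∀ t ∈ Icc 0 T, |prof t b| < 2 / 5

/-- The interval `[0, T]` moves with the parameter; writing times as `r * T` with `r ∈ [0, 1]`
reduces openness to a tube argument over a fixed compact interval. -/
theorem isOpen_isLow : IsOpen {q : ℝ × ℝ | IsLow q.1 q.2} := by
  rw [isOpen_iff_eventually]
  rintro ⟨T, b⟩ ⟨hT, hb, h⟩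
  have h1 : ∀ᶠ q : ℝ × ℝ in 𝓝 (T, b), 0 < q.1 := continuous_fst.continuousAt.eventually_const_lt hT
  have h2 : ∀ᶠ q : ℝ × ℝ in 𝓝 (T, b), 0 < q.2 := continuous_snd.continuousAt.eventually_const_lt hb
  have h3 : ∀ᶠ q : ℝ × ℝ in 𝓝 (T, b), ∀ r ∈ Icc (0 : ℝ) 1, |prof (r * q.1) q.2| < 2 / 5 := by
    refine isCompact_Icc.eventually_forall_of_forall_eventually fun r hr => ?_
    have hc : Continuous fun z : (ℝ × ℝ) × ℝ => |prof (z.2 * z.1.1) z.1.2| :=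
      (continuous_prof.comp (by fun_prop : Continuous fun z : (ℝ × ℝ) × ℝ =>
        (z.2 * z.1.1, z.1.2))).abs
    refine hc.continuousAt.eventually_lt_const ?_
    exact h _ ⟨mul_nonneg hr.1 hT.le, mul_le_of_le_one_left hT.le hr.2⟩
  filter_upwards [h1, h2, h3] with q q1 q2 q3
  refine ⟨q1, q2, fun t ht => ?_⟩
  have := q3 (t / q.1) ⟨div_nonneg ht.1 q1.le, (div_le_one q1).2 ht.2⟩
  rwa [div_mul_cancel₀ _ q1.ne'] at this

theorem IsLow.prof_ge {T b : ℝ} (h : IsLow T b) {t : ℝ} (ht : t ∈ Icc 0 T) :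
    b ≤ prof t b ∧ 0 ≤ profD t b := by
  have := linear_ode_growth (s := 0) (T := T) (fun t _ => hasDerivAt_prof t b)
    (fun t _ => hasDerivAt_profD' t b)
    (fun t ht => by linarith [profile_coeff_half (h.2.2 t ht)]) (by simpa using h.2.1)
    (by simp) t ht
  simpa using this

theorem IsLow.prof_pos {T b : ℝ} (h : IsLow T b) {t : ℝ} (ht : t ∈ Icc 0 T) : 0 < prof t b :=
  h.2.1.trans_le (h.prof_ge ht).1

theorem IsLow.mem_right {T b : ℝ} (h : IsLow T b) : T ∈ Icc 0 T := ⟨h.1.le, le_rfl⟩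

theorem IsLow.amp_lt {T b : ℝ} (h : IsLow T b) : b < 2 / 5 := by
  have := h.2.2 0 ⟨le_rfl, h.1.le⟩
  rw [prof_zero] at this
  exact (le_abs_self b).trans_lt this

theorem IsLow.profD_pos {T b : ℝ} (h : IsLow T b) {t : ℝ} (ht : t ∈ Ioc 0 T) :
    0 < profD t b := by
  have hmono : StrictMonoOn (fun s => profD s b) (Icc 0 T) := by
    refine strictMonoOn_of_deriv_pos (convex_Icc 0 T) (continuous_profD_left b).continuousOn
      fun s hs => ?_
    rw [(hasDerivAt_profD' s b).deriv]
    have hs' := interior_subset hs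
    exact mul_pos (by linarith [profile_coeff_half (h.2.2 s hs')]) (h.prof_pos hs')
  have := hmono ⟨le_rfl, h.1.le⟩ ⟨ht.1.le, ht.2⟩ ht.1
  simpa using this

theorem IsLow.strictMonoOn {T b : ℝ} (h : IsLow T b) :
    StrictMonoOn (fun t => prof t b) (Icc 0 T) := by
  refine strictMonoOn_of_deriv_pos (convex_Icc 0 T) (continuous_prof_left b).continuousOn
    fun s hs => ?_
  rw [interior_Icc] at hs
  rw [(hasDerivAt_prof s b).deriv]
  exact h.profD_pos ⟨hs.1, hs.2.le⟩

theorem IsLow.profA_ge {T b : ℝ} (h : IsLow T b) {t : ℝ} (ht : t ∈ Icc 0 T) :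
    1 ≤ profA t b ∧ 0 ≤ profDA t b := by
  have := linear_ode_growth (s := 0) (T := T) (fun t _ => hasDerivAt_profA t b)
    (fun t _ => hasDerivAt_profDA t b)
    (fun t ht => (profile_coeff_pos (h.2.2 t ht)).le) (by simp) (by simp) t ht
  simpa using this

theorem IsLow.profA_le {T b : ℝ} (h : IsLow T b) {t : ℝ} (ht : t ∈ Icc 0 T) :
    profA t b ≤ profA T b := by
  have := linear_ode_growth (s := t) (T := T) (fun t _ => hasDerivAt_profA t b)
    (fun t _ => hasDerivAt_profDA t b)
    (fun r hr => (profile_coeff_pos (h.2.2 r ⟨ht.1.trans hr.1, hr.2⟩)).le)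
    (zero_lt_one.trans_le (h.profA_ge ht).1) (h.profA_ge ht).2 T ⟨ht.2, le_rfl⟩
  exact this.1

theorem IsLow.profDA_pos {T b : ℝ} (h : IsLow T b) : 0 < profDA T b := by
  have hmono : StrictMonoOn (fun s => profDA s b) (Icc 0 T) := by
    refine strictMonoOn_of_deriv_pos (convex_Icc 0 T)
      (fun s _ => (hasDerivAt_profDA s b).continuousAt.continuousWithinAt) fun s hs => ?_
    rw [(hasDerivAt_profDA s b).deriv]
    have hs' := interior_subset hs
    exact mul_pos (profile_coeff_pos (h.2.2 s hs')) (zero_lt_one.trans_le (h.profA_ge hs').1)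
  have := hmono ⟨le_rfl, h.1.le⟩ h.mem_right h.1
  simpa using this

/-- The difference starts at `b - a > 0` with slope zero, and the comparison principle lets neither
it nor its slope decrease. So the vertex value determines a low profile, and the vertex slope
increases with the vertex value. -/
theorem IsLow.sub_le {T a b : ℝ} (ha : IsLow T a) (hb : IsLow T b) (hab : a < b) :
    b - a ≤ prof T b - prof T a ∧ profD T a ≤ profD T b := by
  have := linear_ode_growth (s := 0) (T := T)
    (fun t _ => (hasDerivAt_prof t b).sub (hasDerivAt_prof t a))
    (fun t _ => hasDerivAt_profD_sub t b a)
    (fun t ht => difference_coeff_nonneg (hb.2.2 t ht) (ha.2.2 t ht)) (by simpa using hab)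
    (by simp) T hb.mem_right
  simp at this
  exact ⟨by linarith [this.1], this.2⟩

theorem IsLow.prof_inj {T a b : ℝ} (ha : IsLow T a) (hb : IsLow T b)
    (h : prof T a = prof T b) : a = b := by
  rcases lt_trichotomy a b with hab | hab | hab
  · linarith [(ha.sub_le hb hab).1]
  · exact hab
  · linarith [(hb.sub_le ha hab).1]

theorem IsLow.amp_lt_of_prof_lt {T a b : ℝ} (ha : IsLow T a) (hb : IsLow T b)
    (h : prof T a < prof T b) : a < b := by
  rcases lt_trichotomy a b with hab | hab | hab
  · exact hab
  · rw [hab] at h; exact absurd h (lt_irrefl _)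
  · linarith [(hb.sub_le ha hab).1]

theorem IsLow.amp_sub_le {T a b : ℝ} (ha : IsLow T a) (hb : IsLow T b) :
    |a - b| ≤ |prof T a - prof T b| := by
  rcases lt_trichotomy a b with hab | hab | hab
  · have := (ha.sub_le hb hab).1
    rw [abs_sub_comm a, abs_sub_comm (prof T a), abs_of_pos (by linarith), abs_of_pos (by linarith)]
    exact this
  · simp [hab]
  · have := (hb.sub_le ha hab).1
    rw [abs_of_pos (by linarith), abs_of_pos (by linarith)]
    exact this

/-- In the energy identity the constant `b⁴ - b²` is nonpositive, leaving `profD² ≤ prof²`. -/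
theorem IsLow.profD_le {T b : ℝ} (h : IsLow T b) : profD T b ≤ prof T b := by
  have h1 := prof_energy T b
  have hp := h.prof_pos h.mem_right
  have hb := h.2.1
  have hb2 := h.amp_lt
  have hb1 : b ^ 2 ≤ 1 := by nlinarith
  have : b ^ 4 ≤ b ^ 2 := by nlinarith [mul_nonneg (sq_nonneg b) (sub_nonneg.2 hb1)]
  have h4 : 0 ≤ prof T b ^ 4 := by positivity
  exact abs_le_of_sq_le_sq' (by linarith) hp.le |>.2

/-- Raise the amplitude from `0` until the maximum of `|prof|` on `[0, T]` first equals `p`. That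
profile is low, hence increasing, so the maximum is attained at `T`. -/
theorem exists_isLow {T p : ℝ} (hT : 0 < T) (hp : 0 < p) (hp' : p < 2 / 5) :
    ∃ b, IsLow T b ∧ prof T b = p := by
  obtain ⟨b, hb, hle, ⟨t, ht, hte⟩, -⟩ := exists_first_crossing (g := fun t b => |prof t b|)
    continuous_prof.abs (s := 0) (T := T) (x := p) (c := p)
    (fun t ht => by rw [prof_amp_zero ht.1]; simpa using hp) hp.le
    ⟨0, ⟨le_rfl, hT.le⟩, by rw [prof_zero]; exact le_abs_self p⟩
  have hlow : IsLow T b := ⟨hT, hb.1, fun t ht => (hle t ht).trans_lt hp'⟩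
  refine ⟨b, hlow, le_antisymm ((le_abs_self _).trans (hle T hlow.mem_right)) ?_⟩
  rw [← hte, abs_of_pos (hlow.prof_pos ht)]
  exact hlow.strictMonoOn.monotoneOn ht hlow.mem_right ht.2

end Low

/-! ### Peak profiles -/

section Peak

/-- Profiles on `[0, T]` with amplitude close to `1` that stay small on `[3, T]`. -/
def IsPeak (T a : ℝ) : Prop :=
  3 < T ∧ |a - 1| < ampRadius ∧ ∀ t ∈ Icc 3 T, |prof t a| < 2 / 5

theorem isOpen_isPeak : IsOpen {q : ℝ × ℝ | IsPeak q.1 q.2} := by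
  rw [isOpen_iff_eventually]
  rintro ⟨T, b⟩ ⟨hT, hb, h⟩
  have h1 : ∀ᶠ q : ℝ × ℝ in 𝓝 (T, b), 3 < q.1 := continuous_fst.continuousAt.eventually_const_lt hT
  have h2 : ∀ᶠ q : ℝ × ℝ in 𝓝 (T, b), |q.2 - 1| < ampRadius :=
    ((continuous_snd.sub continuous_const).abs).continuousAt.eventually_lt_const hb
  have h3 : ∀ᶠ q : ℝ × ℝ in 𝓝 (T, b), ∀ r ∈ Icc (0 : ℝ) 1,
      |prof (3 + r * (q.1 - 3)) q.2| < 2 / 5 := by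
    refine isCompact_Icc.eventually_forall_of_forall_eventually fun r hr => ?_
    have hc : Continuous fun z : (ℝ × ℝ) × ℝ => |prof (3 + z.2 * (z.1.1 - 3)) z.1.2| :=
      (continuous_prof.comp (by fun_prop : Continuous fun z : (ℝ × ℝ) × ℝ =>
        (3 + z.2 * (z.1.1 - 3), z.1.2))).abs
    refine hc.continuousAt.eventually_lt_const ?_
    have hT' : 0 < T - 3 := sub_pos.2 hT
    exact h _ ⟨by nlinarith [mul_nonneg hr.1 hT'.le], by nlinarith [hr.2]⟩
  filter_upwards [h1, h2, h3] with q q1 q2 q3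
  refine ⟨q1, q2, fun t ht => ?_⟩
  have q1' : 0 < q.1 - 3 := sub_pos.2 q1
  have := q3 ((t - 3) / (q.1 - 3)) ⟨div_nonneg (by linarith [ht.1]) q1'.le,
    (div_le_one q1').2 (by linarith [ht.2])⟩
  rwa [div_mul_cancel₀ _ q1'.ne', add_sub_cancel] at this

theorem IsPeak.mem_right {T a : ℝ} (h : IsPeak T a) : T ∈ Icc 3 T := ⟨h.1.le, le_rfl⟩

/-- The comparison principle for `-profA`, started at time `3` from the bounds in `central_spec`. -/
theorem IsPeak.profA_le {T a : ℝ} (h : IsPeak T a) {t : ℝ} (ht : t ∈ Icc 3 T) :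
    profA t a ≤ -ampSlope ∧ profDA t a ≤ -ampSlope := by
  have hc := central_spec h.2.1
  have h0 := ampSlope_pos
  have := linear_ode_growth (s := 3) (T := T) (fun t _ => (hasDerivAt_profA t a).neg)
    (D' := fun t => -profDA t a) (c := fun t => 1 - 6 * prof t a ^ 2)
    (fun t _ => ((hasDerivAt_profDA t a).neg).congr_deriv (by simp))
    (fun t ht => (profile_coeff_pos (h.2.2 t ht)).le) (by simp; linarith) (by simp; linarith) t ht
  simp at this
  constructor <;> linarith

theorem IsPeak.profA_ge {T a : ℝ} (h : IsPeak T a) {t : ℝ} (ht : t ∈ Icc 3 T) :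
    profA T a ≤ profA t a := by
  have hc := h.profA_le ht
  have h0 := ampSlope_pos
  have := linear_ode_growth (s := t) (T := T) (fun t _ => (hasDerivAt_profA t a).neg)
    (D' := fun t => -profDA t a) (c := fun t => 1 - 6 * prof t a ^ 2)
    (fun t _ => ((hasDerivAt_profDA t a).neg).congr_deriv (by simp))
    (fun r hr => (profile_coeff_pos (h.2.2 r ⟨ht.1.trans hr.1, hr.2⟩)).le)
    (by simp; linarith) (by linarith) T ⟨ht.2, le_rfl⟩
  simp at this
  exact this.1

theorem prof_three_sub_le {a b : ℝ} (ha : |a - 1| < ampRadius) (hb : |b - 1| < ampRadius)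
    (hab : a ≤ b) : ampSlope * (b - a) ≤ prof 3 a - prof 3 b ∧
      ampSlope * (b - a) ≤ profD 3 a - profD 3 b := by
  have hI : ∀ r ∈ Icc a b, |r - 1| < ampRadius := fun r hr => by
    rw [abs_lt] at *
    constructor <;> linarith [hr.1, hr.2]
  have hsub : ∀ r ∈ interior (Icc a b), |r - 1| < ampRadius := fun r hr => hI r (interior_subset hr)
  have h1 := (convex_Icc a b).image_sub_le_mul_sub_of_deriv_le
    (continuous_prof_right 3).continuousOn
    (fun r _ => (hasDerivAt_prof_right 3 r).differentiableAt.differentiableWithinAt)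
    (C := -ampSlope)
    (fun r hr => by rw [(hasDerivAt_prof_right 3 r).deriv]; exact (central_spec (hsub r hr)).1)
    a ⟨le_rfl, hab⟩ b ⟨hab, le_rfl⟩ hab
  have h2 := (convex_Icc a b).image_sub_le_mul_sub_of_deriv_le
    (continuous_profD_right 3).continuousOn
    (fun r _ => (hasDerivAt_profD_right 3 r).differentiableAt.differentiableWithinAt)
    (C := -ampSlope)
    (fun r hr => by rw [(hasDerivAt_profD_right 3 r).deriv]; exact (central_spec (hsub r hr)).2.1)
    a ⟨le_rfl, hab⟩ b ⟨hab, le_rfl⟩ hab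
  constructor <;> linarith

/-- The difference of two peak profiles, and its derivative, are nondecreasing in time. -/
theorem IsPeak.sub_mono {T a b : ℝ} (ha : IsPeak T a) (hb : IsPeak T b) (hab : a < b) {s t : ℝ}
    (hs : s ∈ Icc 3 T) (ht : t ∈ Icc s T) :
    prof s a - prof s b ≤ prof t a - prof t b ∧ profD s a - profD s b ≤ profD t a - profD t b := by
  have h3 := prof_three_sub_le ha.2.1 hb.2.1 hab.le
  have hpos : 0 < ampSlope * (b - a) := mul_pos ampSlope_pos (sub_pos.2 hab)
  have key : ∀ s ∈ Icc 3 T, 0 < prof s a - prof s b ∧ 0 ≤ profD s a - profD s b := by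
    intro s hs
    have := linear_ode_growth (s := 3) (T := T)
      (fun t _ => (hasDerivAt_prof t a).sub (hasDerivAt_prof t b))
      (fun t _ => hasDerivAt_profD_sub t a b)
      (fun t ht => difference_coeff_nonneg (ha.2.2 t ht) (hb.2.2 t ht))
      (by simp only [Pi.sub_apply]; linarith) (by linarith) s hs
    simp only [Pi.sub_apply] at this
    constructor <;> linarith
  have hk := key s hs
  have := linear_ode_growth (s := s) (T := T)
    (fun t _ => (hasDerivAt_prof t a).sub (hasDerivAt_prof t b))
    (fun t _ => hasDerivAt_profD_sub t a b)
    (fun t ht => difference_coeff_nonneg (ha.2.2 t ⟨hs.1.trans ht.1, ht.2⟩)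
      (hb.2.2 t ⟨hs.1.trans ht.1, ht.2⟩))
    hk.1 hk.2 t ht
  simpa only [Pi.sub_apply] using this

theorem IsPeak.lt_of_lt {T a b : ℝ} (ha : IsPeak T a) (hb : IsPeak T b) (hab : a < b) :
    prof T b < prof T a ∧ profD T b < profD T a := by
  have h3 := prof_three_sub_le ha.2.1 hb.2.1 hab.le
  have hpos : 0 < ampSlope * (b - a) := mul_pos ampSlope_pos (sub_pos.2 hab)
  have := ha.sub_mono hb hab ⟨le_rfl, ha.1.le⟩ ha.mem_right
  constructor <;> linarith

theorem IsPeak.prof_inj {T a b : ℝ} (ha : IsPeak T a) (hb : IsPeak T b)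
    (h : prof T a = prof T b) : a = b := by
  rcases lt_trichotomy a b with hab | hab | hab
  · linarith [(ha.lt_of_lt hb hab).1]
  · exact hab
  · linarith [(hb.lt_of_lt ha hab).1]

/-- The slope of the difference is already `ampSlope * (b - a)` at time `3` and never decreases. On
a long interval two fixed amplitudes must therefore separate. -/
theorem IsPeak.sub_ge {T a b : ℝ} (ha : IsPeak T a) (hb : IsPeak T b) (hab : a < b) :
    ampSlope * (b - a) * (T - 3) ≤ prof T a - prof T b := by
  have h3 := prof_three_sub_le ha.2.1 hb.2.1 hab.le
  have hpos : 0 < ampSlope * (b - a) := mul_pos ampSlope_pos (sub_pos.2 hab)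
  have h1 := (convex_Icc 3 T).mul_sub_le_image_sub_of_le_deriv (f := fun t => prof t a - prof t b)
    ((continuous_prof_left a).sub (continuous_prof_left b)).continuousOn
    (fun r _ => ((hasDerivAt_prof r a).sub
      (hasDerivAt_prof r b)).differentiableAt.differentiableWithinAt)
    (C := ampSlope * (b - a))
    (fun r hr => by
      have hr' := interior_subset hr
      have e : deriv (fun t => prof t a - prof t b) r = profD r a - profD r b :=
        ((hasDerivAt_prof r a).sub (hasDerivAt_prof r b)).deriv
      rw [e]
      exact h3.2.trans (ha.sub_mono hb hab ⟨le_rfl, ha.1.le⟩ hr').2)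
    3 ⟨le_rfl, ha.1.le⟩ T ha.mem_right ha.1.le
  linarith

/-- Convexity of the difference of two peak profiles. -/
theorem IsPeak.sub_le {T a b : ℝ} (ha : IsPeak T a) (hb : IsPeak T b) (hab : a < b) :
    (prof T a - prof T b) - (prof 3 a - prof 3 b) ≤ (profD T a - profD T b) * (T - 3) := by
  have h1 := (convex_Icc 3 T).image_sub_le_mul_sub_of_deriv_le (f := fun t => prof t a - prof t b)
    ((continuous_prof_left a).sub (continuous_prof_left b)).continuousOn
    (fun r _ => ((hasDerivAt_prof r a).sub
      (hasDerivAt_prof r b)).differentiableAt.differentiableWithinAt)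
    (C := profD T a - profD T b)
    (fun r hr => by
      have hr' := interior_subset hr
      have e : deriv (fun t => prof t a - prof t b) r = profD r a - profD r b :=
        ((hasDerivAt_prof r a).sub (hasDerivAt_prof r b)).deriv
      rw [e]
      exact (ha.sub_mono hb hab hr' ⟨hr'.2, le_rfl⟩).2)
    3 ⟨le_rfl, ha.1.le⟩ T ha.mem_right ha.1.le
  exact h1

theorem isPeak_one {T : ℝ} (hT : 3 < T) : IsPeak T 1 := by
  refine ⟨hT, by simpa using ampRadius_pos, fun t ht => ?_⟩
  have ht0 : 0 ≤ t := by linarith [ht.1]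
  rw [(prof_one ht0).1, abs_of_pos (inv_pos.2 (Real.cosh_pos t)),
    inv_lt_comm₀ (Real.cosh_pos t) (by norm_num)]
  have h1 : Real.cosh 3 ≤ Real.cosh t :=
    Real.cosh_le_cosh.2 (by rw [abs_of_nonneg ht0, abs_of_pos (by norm_num : (0:ℝ) < 3)]; exact ht.1)
  have := nine_le_sinh_three.2
  linarith

/-- After time `3` the soliton is at most `1/9`, and `1/9 + 1/5 < 2/5`. This turns a first crossing
of the level `1/5` into a peak. -/
theorem isPeak_of_close {T a : ℝ} (hT : 3 < T) (ha : |a - 1| < ampRadius)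
    (h : ∀ t ∈ Icc 3 T, |prof t a - prof t 1| ≤ 1 / 5) : IsPeak T a := by
  refine ⟨hT, ha, fun t ht => ?_⟩
  have ht0 : 0 ≤ t := by linarith [ht.1]
  have h9 : |prof t 1| ≤ 1 / 9 := by
    rw [(prof_one ht0).1, abs_of_pos (inv_pos.2 (Real.cosh_pos t)),
      inv_le_comm₀ (Real.cosh_pos t) (by norm_num)]
    have h1 : Real.cosh 3 ≤ Real.cosh t :=
      Real.cosh_le_cosh.2 (by rw [abs_of_nonneg ht0, abs_of_pos (by norm_num : (0:ℝ) < 3)]; exact ht.1)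
    have := nine_le_sinh_three.2
    linarith
  have := abs_sub_abs_le_abs_sub (prof t a) (prof t 1)
  linarith [h t ht]

end Peak

/-! ### The half-soliton at the vertex -/

section VertexSlope

/-- Minus the slope at the vertex of the half-soliton with vertex value `p`. -/
noncomputable def vertexSlope (p : ℝ) : ℝ := p * √(1 - p ^ 2)

theorem hasDerivAt_vertexSlope {p : ℝ} (hp : |p| < 1) :
    HasDerivAt vertexSlope (√(1 - p ^ 2) - p ^ 2 / √(1 - p ^ 2)) p := by
  have h1 : 0 < 1 - p ^ 2 := by
    rw [abs_lt] at hp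
    nlinarith
  have h2 := (((hasDerivAt_id p).pow 2).const_sub 1).sqrt (by simpa using h1.ne')
  have h3 := (hasDerivAt_id p).mul h2
  refine h3.congr_deriv ?_
  simp only [id, Pi.pow_apply]
  have := Real.sqrt_pos.2 h1
  field_simp
  push_cast
  ring

theorem deriv_vertexSlope_bounds {p : ℝ} (hp : |p| < 2 / 5) :
    1 / 2 ≤ √(1 - p ^ 2) - p ^ 2 / √(1 - p ^ 2) := by
  have hp2 : p ^ 2 < 4 / 25 := by
    rw [abs_lt] at hp
    nlinarith
  have h1 : (9 / 10 : ℝ) ≤ √(1 - p ^ 2) := Real.le_sqrt_of_sq_le (by linarith)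
  have h2 : p ^ 2 / √(1 - p ^ 2) ≤ 4 / 10 := by
    rw [div_le_iff₀ (by linarith)]
    linarith
  linarith

theorem vertexSlope_strictMonoOn : StrictMonoOn vertexSlope (Icc 0 (2 / 5)) := by
  refine strictMonoOn_of_deriv_pos (convex_Icc _ _)
    (fun p hp => ContinuousAt.continuousWithinAt ?_) fun p hp => ?_
  · exact (hasDerivAt_vertexSlope (by rw [abs_of_nonneg hp.1]; linarith [hp.2])).continuousAt
  · rw [interior_Icc] at hp
    rw [(hasDerivAt_vertexSlope (by rw [abs_of_pos hp.1]; linarith [hp.2])).deriv]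
    have := deriv_vertexSlope_bounds (by rw [abs_of_pos hp.1]; exact hp.2)
    linarith

theorem vertexSlope_pos {p : ℝ} (hp : 0 < p) (hp' : p < 1) : 0 < vertexSlope p :=
  mul_pos hp (Real.sqrt_pos.2 (by nlinarith))

theorem vertexSlope_nonneg {p : ℝ} (hp : 0 ≤ p) : 0 ≤ vertexSlope p :=
  mul_nonneg hp (Real.sqrt_nonneg _)

theorem vertexSlope_le {p : ℝ} (hp : 0 ≤ p) : vertexSlope p ≤ p :=
  mul_le_of_le_one_right hp (Real.sqrt_le_one.2 (by nlinarith [sq_nonneg p]))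

end VertexSlope

/-! ### Existence and uniqueness of amplitude pairs -/

section Existence

/-- Moving the amplitude away from `1`, stop when the profile first differs from the soliton by
`1/5` somewhere on `[3, T]`; for long intervals this occurs within half the allowed radius. The
difference is monotone in time, so it is at least `1/5` at `T` as well. Above `1` this pushes the
vertex value below zero. Below `1` convexity gives the difference a slope of at least `(1/20) / (T -
3)` at `T`, which beats the exponentially small slope of the soliton. -/
theorem exists_peak_range : ∃ T₀ : ℝ, 3 < T₀ ∧ ∀ T, T₀ ≤ T → ∃ a₁ a₂ : ℝ, a₁ < 1 ∧ 1 < a₂ ∧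
    (∀ a ∈ Icc a₁ a₂, IsPeak T a) ∧ 0 < profD T a₁ ∧ prof T a₂ < 0 := by
  set x : ℝ := ampRadius / 2 with hx
  have hr := ampRadius_pos
  have hx0 : 0 < x := by positivity
  have hxr : x < ampRadius := by linarith
  have hcx : 0 < ampSlope * x := mul_pos ampSlope_pos hx0
  -- The bound `83` makes `cosh T` exceed `20 (T - 3)` through the quadratic lower bound for `exp`;
  -- the second entry makes the linear separation `ampSlope * x * (T - 3)` exceed `1/5`.
  refine ⟨max 83 (4 + 1 / (5 * (ampSlope * x))), lt_max_of_lt_left (by norm_num), fun T hT => ?_⟩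
  have hT40 : 83 ≤ T := (le_max_left _ _).trans hT
  have hT3 : 3 < T := by linarith
  have hTc : 1 / 5 < ampSlope * x * (T - 3) := by
    have h1 : 4 + 1 / (5 * (ampSlope * x)) ≤ T := (le_max_right _ _).trans hT
    have h2 : 1 / (5 * (ampSlope * x)) < T - 3 := by linarith
    rw [div_lt_iff₀ (by positivity)] at h2
    linarith
  have h1peak := isPeak_one hT3
  have hsech : prof T 1 = (Real.cosh T)⁻¹ := (prof_one (by linarith)).1
  have hcoshT : 0 < Real.cosh T := Real.cosh_pos T
  have hbig : 20 * (T - 3) < Real.cosh T := by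
    have h1 : 1 + T + T ^ 2 / 2 ≤ Real.exp T := Real.quadratic_le_exp_of_nonneg (by linarith)
    have h2 := Real.exp_pos (-T)
    rw [Real.cosh_eq]
    nlinarith
  have hsech20 : prof T 1 < 1 / 800 := by
    rw [hsech, inv_lt_comm₀ hcoshT (by norm_num)]
    norm_num
    linarith
  have reach : ∀ σ : ℝ, σ = 1 ∨ σ = -1 → ∃ t ∈ Icc 3 T, 1 / 5 ≤ |prof t (1 + σ * x) - prof t 1| := by
    intro σ hσ
    by_contra hcon
    push Not at hcon
    have hclose : |1 + σ * x - 1| < ampRadius := by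
      rcases hσ with rfl | rfl <;> rw [abs_lt] <;> constructor <;> linarith
    have hpk : IsPeak T (1 + σ * x) := isPeak_of_close hT3 hclose fun t ht => (hcon t ht).le
    have hlast := hcon T h1peak.mem_right
    rw [abs_lt] at hlast
    rcases hσ with rfl | rfl
    · have := h1peak.sub_ge hpk (by linarith)
      ring_nf at this hTc hlast
      linarith
    · have := hpk.sub_ge h1peak (by linarith)
      ring_nf at this hTc hlast
      linarith
  have crossing : ∀ σ : ℝ, σ = 1 ∨ σ = -1 → ∃ z ∈ Ioc 0 x,
      (∃ t ∈ Icc 3 T, |prof t (1 + σ * z) - prof t 1| = 1 / 5) ∧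
      ∀ w ∈ Icc 0 z, IsPeak T (1 + σ * w) := by
    intro σ hσ
    have hcont : Continuous fun q : ℝ × ℝ => |prof q.1 (1 + σ * q.2) - prof q.1 1| :=
      ((continuous_prof.comp (by fun_prop : Continuous fun q : ℝ × ℝ => (q.1, 1 + σ * q.2))).sub
        (continuous_prof.comp (by fun_prop : Continuous fun q : ℝ × ℝ => (q.1, (1 : ℝ))))).abs
    obtain ⟨z, hz, hle, hatt, hlt⟩ := exists_first_crossing
      (g := fun t d => |prof t (1 + σ * d) - prof t 1|) hcont (s := 3) (T := T) (x := x)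
      (c := 1 / 5) (fun t _ => by simp) hx0.le (reach σ hσ)
    refine ⟨z, hz, hatt, fun w hw => isPeak_of_close hT3 ?_ fun t ht => ?_⟩
    · have hwx : w < ampRadius := (hw.2.trans hz.2).trans_lt hxr
      rcases hσ with rfl | rfl <;> rw [abs_lt] <;> constructor <;> linarith [hw.1]
    · rcases hw.2.eq_or_lt with h | h
      · rw [h]; exact hle t ht
      · exact (hlt w ⟨hw.1, h⟩ t ht).le
  obtain ⟨z₂, hz₂, ⟨t₂, ht₂, he₂⟩, hp₂⟩ := crossing 1 (Or.inl rfl)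
  obtain ⟨z₁, hz₁, ⟨t₁, ht₁, he₁⟩, hp₁⟩ := crossing (-1) (Or.inr rfl)
  have hpk₁ := hp₁ z₁ ⟨hz₁.1.le, le_rfl⟩
  have hpk₂ := hp₂ z₂ ⟨hz₂.1.le, le_rfl⟩
  have hlt₁ : 1 + -1 * z₁ < 1 := by linarith [hz₁.1]
  have hlt₂ : 1 < 1 + 1 * z₂ := by linarith [hz₂.1]
  refine ⟨1 + -1 * z₁, 1 + 1 * z₂, hlt₁, hlt₂, fun a ha => ?_, ?_, ?_⟩
  · rcases le_total a 1 with h | h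
    · have := hp₁ (1 - a) ⟨by linarith, by linarith [ha.1]⟩
      rwa [show 1 + -1 * (1 - a) = a by ring] at this
    · have := hp₂ (a - 1) ⟨by linarith, by linarith [ha.2]⟩
      rwa [show 1 + 1 * (a - 1) = a by ring] at this
  · have hge : 1 / 5 ≤ prof T (1 + -1 * z₁) - prof T 1 := by
      have h3 := prof_three_sub_le hpk₁.2.1 h1peak.2.1 hlt₁.le
      have hpos : 0 ≤ ampSlope * (1 - (1 + -1 * z₁)) :=
        mul_nonneg ampSlope_pos.le (by linarith [hz₁.1])
      have h4 := (hpk₁.sub_mono h1peak hlt₁ ⟨le_rfl, hT3.le⟩ ht₁).1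
      rw [abs_of_nonneg (by linarith)] at he₁
      rw [← he₁]
      exact (hpk₁.sub_mono h1peak hlt₁ ht₁ ⟨ht₁.2, le_rfl⟩).1
    have hcv := hpk₁.sub_le h1peak hlt₁
    have h3a := (central_spec hpk₁.2.1).2.2.2.1
    have h3b := (central_spec h1peak.2.1).2.2.1 3 ⟨by norm_num, le_rfl⟩
    have hD1 : -(1 / Real.cosh T) ≤ profD T 1 := by
      rw [(prof_one (by linarith)).2, neg_div, neg_le_neg_iff]
      have := (Real.sinh_lt_cosh T).le
      rw [div_le_div_iff₀ (by positivity) hcoshT]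
      nlinarith
    have hTpos : 0 < T - 3 := by linarith
    -- The difference is at least `1/5` at `T` and below `3/20` at time `3`, so it rises by at least
    -- `1/20` on `[3, T]`.
    have h5 : 1 / 20 ≤ (profD T (1 + -1 * z₁) - profD T 1) * (T - 3) := by linarith
    have h6 : 1 / Real.cosh T * (T - 3) < 1 / 20 := by
      rw [div_mul_eq_mul_div, one_mul, div_lt_div_iff₀ hcoshT (by norm_num)]
      linarith
    by_contra hneg
    push Not at hneg
    have : (profD T (1 + -1 * z₁) - profD T 1) * (T - 3) ≤ 1 / Real.cosh T * (T - 3) :=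
      mul_le_mul_of_nonneg_right (by linarith) hTpos.le
    linarith
  · have hge : 1 / 5 ≤ prof T 1 - prof T (1 + 1 * z₂) := by
      have h3 := prof_three_sub_le h1peak.2.1 hpk₂.2.1 hlt₂.le
      have hpos : 0 ≤ ampSlope * (1 + 1 * z₂ - 1) :=
        mul_nonneg ampSlope_pos.le (by linarith [hz₂.1])
      have h4 := (h1peak.sub_mono hpk₂ hlt₂ ⟨le_rfl, hT3.le⟩ ht₂).1
      rw [abs_sub_comm, abs_of_nonneg (by linarith)] at he₂
      rw [← he₂]
      exact (h1peak.sub_mono hpk₂ hlt₂ ht₂ ⟨ht₂.2, le_rfl⟩).1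
    linarith

/-- The vertex condition for `K` loops with a peak profile and `N - K` loops with a low one. -/
noncomputable def vertexBalance (N K : ℕ) (T a b : ℝ) : ℝ :=
  2 * K * profD T a + 2 * (N - K : ℝ) * profD T b + vertexSlope (prof T a)

/-- Pairs of amplitudes that give a state with `K` peaks for loops of half-length `T`. -/
def IsAmpPair (N K : ℕ) (T a b : ℝ) : Prop :=
  IsPeak T a ∧ IsLow T b ∧ prof T a = prof T b ∧ vertexBalance N K T a b = 0

/-- The intermediate value theorem in the peak amplitude `a`, the low amplitude being slaved to the
vertex value `prof T a`. At the left end all slopes point upwards; at the right end the vertex value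
is too small for the other terms to offset the peak's downward slope. -/
theorem exists_isAmpPair : ∃ T₀ : ℝ, 3 < T₀ ∧ ∀ N K : ℕ, 1 ≤ K → K ≤ N → ∀ T, T₀ ≤ T →
    ∃ a b, IsAmpPair N K T a b := by
  obtain ⟨T₀, hT₀, hrange⟩ := exists_peak_range
  refine ⟨T₀, hT₀, fun N K hK hKN T hT => ?_⟩
  obtain ⟨a₁, a₂, ha₁, ha₂, hpk, hD₁, hneg⟩ := hrange T hT
  have hT3 : 3 < T := hT₀.trans_le hT
  have hTpos : 0 < T := by linarith
  have hKr : (1 : ℝ) ≤ K := by exact_mod_cast hK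
  have hNK : (K : ℝ) ≤ N := by exact_mod_cast hKN
  -- `β p` is the low amplitude with vertex value `p`. It is `1`-Lipschitz by `IsLow.amp_sub_le`,
  -- hence continuous although merely chosen.
  choose! β hβ using fun p (hp : p ∈ Ioo (0 : ℝ) (2 / 5)) => exists_isLow hTpos hp.1 hp.2
  have hβc : ContinuousOn β (Ioo 0 (2 / 5)) := by
    have : LipschitzOnWith 1 β (Ioo 0 (2 / 5)) := by
      refine LipschitzOnWith.of_dist_le_mul fun p hp q hq => ?_
      have := (hβ p hp).1.amp_sub_le (hβ q hq).1
      rw [(hβ p hp).2, (hβ q hq).2] at this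
      simpa [Real.dist_eq] using this
    exact this.continuousOn
  have hcosh := Real.cosh_pos T
  set σ := -profD T 1 with hσ
  have hσ0 : 0 < σ := by
    rw [hσ, (prof_one hTpos.le).2, neg_div, neg_neg]
    exact div_pos (Real.sinh_pos_iff.2 hTpos) (by positivity)
  have hp1 : 0 < prof T 1 := by
    rw [(prof_one hTpos.le).1]
    exact inv_pos.2 hcosh
  -- With vertex value `η`, the low loops and the half-line contribute at most `(2N + 2) η ≤ σ`,
  -- while the peaks contribute at most `-2σ`.
  set η := min (prof T 1 / 2) (σ / (2 * N + 2)) with hη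
  have hη0 : 0 < η := lt_min (by positivity) (by positivity)
  have hη1 : η < prof T 1 := (min_le_left _ _).trans_lt (by linarith)
  have hη2 : (2 * N + 2) * η ≤ σ := by
    have := min_le_right (prof T 1 / 2) (σ / (2 * N + 2))
    rw [← hη, le_div_iff₀ (by positivity)] at this
    linarith
  obtain ⟨a₃, ha₃, hηa⟩ : η ∈ (fun a => prof T a) '' Icc 1 a₂ :=
    intermediate_value_Icc' ha₂.le (continuous_prof_right T).continuousOn
      ⟨by linarith, hη1.le⟩
  simp only at hηa
  have ha31 : 1 < a₃ := by
    rcases ha₃.1.lt_or_eq with h | h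
    · exact h
    · rw [← h] at hηa; linarith
  have hpk3 : IsPeak T a₃ := hpk a₃ ⟨by linarith, ha₃.2⟩
  have hmem : ∀ a ∈ Icc a₁ a₃, prof T a ∈ Ioo (0 : ℝ) (2 / 5) := by
    intro a ha
    have hpa := hpk a ⟨ha.1, ha.2.trans ha₃.2⟩
    have h2 := (abs_lt.1 (hpa.2.2 T hpa.mem_right)).2
    refine ⟨?_, h2⟩
    rcases ha.2.lt_or_eq with h | h
    · have := (hpa.lt_of_lt hpk3 h).1
      linarith
    · rw [h]; linarith
  have hF : ContinuousOn (fun a => vertexBalance N K T a (β (prof T a))) (Icc a₁ a₃) := by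
    have c1 : ContinuousOn (fun a => β (prof T a)) (Icc a₁ a₃) :=
      hβc.comp (continuous_prof_right T).continuousOn hmem
    have c2 : ContinuousOn (fun a => profD T (β (prof T a))) (Icc a₁ a₃) :=
      (continuous_profD_right T).comp_continuousOn c1
    have c3 : Continuous fun a => profD T a := continuous_profD_right T
    have c4 : Continuous fun a => vertexSlope (prof T a) := by
      have := continuous_prof_right T
      unfold vertexSlope
      fun_prop
    exact (((continuous_const.mul c3).continuousOn).add (continuousOn_const.mul c2)).add
      c4.continuousOn
  have hF1 : 0 ≤ vertexBalance N K T a₁ (β (prof T a₁)) := by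
    have hm := hmem a₁ ⟨le_rfl, by linarith⟩
    have hl := (hβ _ hm).1
    have h1 := hl.profD_pos (t := T) ⟨hTpos, le_rfl⟩
    have h2 := vertexSlope_nonneg hm.1.le
    have h3 : 0 ≤ 2 * (K : ℝ) * profD T a₁ := by positivity
    have h4 : 0 ≤ 2 * (N - K : ℝ) * profD T (β (prof T a₁)) :=
      mul_nonneg (by linarith) h1.le
    unfold vertexBalance
    linarith
  have hF3 : vertexBalance N K T a₃ (β (prof T a₃)) ≤ 0 := by
    have hm := hmem a₃ ⟨by linarith, le_rfl⟩
    have hl := (hβ _ hm).1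
    have h1 := hl.profD_le
    rw [(hβ _ hm).2, hηa] at h1
    have h2 := vertexSlope_le hm.1.le
    have h5 := ((isPeak_one hT3).lt_of_lt hpk3 ha31).2
    unfold vertexBalance
    rw [hηa] at h2 ⊢
    have h3 : 2 * (K : ℝ) * profD T a₃ ≤ -(2 * σ) := by nlinarith
    have h4 : 2 * (N - K : ℝ) * profD T (β η) ≤ 2 * (N - K : ℝ) * η :=
      mul_le_mul_of_nonneg_left h1 (by linarith)
    nlinarith
  obtain ⟨a, ha, hFa⟩ : (0 : ℝ) ∈ (fun a => vertexBalance N K T a (β (prof T a))) '' Icc a₁ a₃ :=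
    intermediate_value_Icc' (by linarith) hF ⟨hF3, hF1⟩
  have hm := hmem a ha
  exact ⟨a, β (prof T a), hpk a ⟨ha.1, ha.2.trans ha₃.2⟩, (hβ _ hm).1, (hβ _ hm).2.symm, hFa⟩

theorem IsAmpPair.prof_pos {N K : ℕ} {T a b : ℝ} (h : IsAmpPair N K T a b) : 0 < prof T a := by
  rw [h.2.2.1]
  exact h.2.1.prof_pos h.2.1.mem_right

theorem IsAmpPair.prof_lt {N K : ℕ} {T a b : ℝ} (h : IsAmpPair N K T a b) : prof T a < 2 / 5 :=
  (abs_lt.1 (h.1.2.2 T h.1.mem_right)).2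

/-- A larger peak amplitude means a smaller vertex value, and then each of the three terms of the
balance decreases, the half-line term strictly. Two pairs with different peak amplitudes cannot both
have balance zero. -/
theorem IsAmpPair.amp_le {N K : ℕ} (hK : 1 ≤ K) (hKN : K ≤ N) {T a b a' b' : ℝ}
    (h : IsAmpPair N K T a b) (h' : IsAmpPair N K T a' b') : a' ≤ a := by
  by_contra hcon
  push Not at hcon
  have hKr : (1 : ℝ) ≤ K := by exact_mod_cast hK
  have hNK : (K : ℝ) ≤ N := by exact_mod_cast hKN
  obtain ⟨h1, h2⟩ := h.1.lt_of_lt h'.1 hcon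
  have h3 : prof T b' < prof T b := by rw [← h.2.2.1, ← h'.2.2.1]; exact h1
  have h4 := (h'.2.1.sub_le h.2.1 (h'.2.1.amp_lt_of_prof_lt h.2.1 h3)).2
  have h5 := vertexSlope_strictMonoOn ⟨h'.prof_pos.le, h'.prof_lt.le⟩
    ⟨h.prof_pos.le, h.prof_lt.le⟩ h1
  have e := h.2.2.2
  have e' := h'.2.2.2
  unfold vertexBalance at e e'
  have h6 : 2 * (K : ℝ) * profD T a' ≤ 2 * K * profD T a :=
    mul_le_mul_of_nonneg_left h2.le (by linarith)
  have h7 : 2 * (N - K : ℝ) * profD T b' ≤ 2 * (N - K : ℝ) * profD T b :=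
    mul_le_mul_of_nonneg_left h4 (by linarith)
  linarith

theorem IsAmpPair.unique {N K : ℕ} (hK : 1 ≤ K) (hKN : K ≤ N) {T a b a' b' : ℝ}
    (h : IsAmpPair N K T a b) (h' : IsAmpPair N K T a' b') : a = a' ∧ b = b' := by
  have ha : a = a' := le_antisymm (h'.amp_le hK hKN h) (h.amp_le hK hKN h')
  subst ha
  exact ⟨rfl, h.2.1.prof_inj h'.2.1 (h.2.2.1.symm.trans h'.2.2.1)⟩

theorem IsAmpPair.profD_neg {N K : ℕ} (hK : 1 ≤ K) (hKN : K ≤ N) {T a b : ℝ}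
    (h : IsAmpPair N K T a b) : profD T a < 0 := by
  have hKr : (1 : ℝ) ≤ K := by exact_mod_cast hK
  have hNK : (K : ℝ) ≤ N := by exact_mod_cast hKN
  have h1 := vertexSlope_pos h.prof_pos (by linarith [h.prof_lt])
  have h2 : 0 ≤ 2 * (N - K : ℝ) * profD T b :=
    mul_nonneg (by linarith) (h.2.1.profD_pos ⟨h.2.1.1, le_rfl⟩).le
  have e := h.2.2.2
  unfold vertexBalance at e
  by_contra hcon
  push Not at hcon
  have : 0 ≤ 2 * (K : ℝ) * profD T a := by positivity
  linarith

/-- A peak profile with positive value and nonpositive slope at `T` is positive and decreasing. -/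
theorem IsPeak.late {T a : ℝ} (h : IsPeak T a) (h0 : 0 < prof T a) (h0' : profD T a ≤ 0) {t : ℝ}
    (ht : t ∈ Icc 3 T) : prof T a ≤ prof t a ∧ profD t a ≤ profD T a :=
  linear_ode_growth_left (s := 3) (T := T) (fun t _ => hasDerivAt_prof t a)
    (fun t _ => hasDerivAt_profD' t a)
    (fun t ht => by linarith [profile_coeff_half (h.2.2 t ht)]) h0 h0' t ht

theorem IsPeak.pos {T a : ℝ} (h : IsPeak T a) (h0 : 0 < prof T a) (h0' : profD T a ≤ 0) {t : ℝ}
    (ht : t ∈ Icc 0 T) : 0 < prof t a := by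
  rcases le_total t 3 with h3 | h3
  · exact (central_spec h.2.1).2.2.1 t ⟨ht.1, h3⟩
  · exact h0.trans_le (h.late h0 h0' ⟨h3, ht.2⟩).1

/-- Up to time `3` the angle lies in `(0, π/2)`, so `sin (2 ang) > 0`. After time `3` the profile is
convex and its slope is bounded above by the negative slope at `T`. -/
theorem IsPeak.profD_neg {T a : ℝ} (h : IsPeak T a) (h0 : 0 < prof T a) (h0' : profD T a < 0)
    {t : ℝ} (ht : t ∈ Ioc 0 T) : profD t a < 0 := by
  rcases le_total t 3 with h3 | h3
  · have hc := central_spec h.2.1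
    have hmono : StrictMonoOn (fun s => ang s a) (Icc 0 3) := by
      refine strictMonoOn_of_deriv_pos (convex_Icc _ _) (continuous_ang_left a).continuousOn
        fun s hs => ?_
      rw [(hasDerivAt_ang s a).deriv]
      exact hc.2.2.1 s (interior_subset hs)
    have h1 : 0 < ang t a := by
      have := hmono ⟨le_rfl, by norm_num⟩ ⟨ht.1.le, h3⟩ ht.1
      simpa using this
    have h2 : ang t a < Real.pi / 2 :=
      (hmono.monotoneOn ⟨ht.1.le, h3⟩ ⟨by norm_num, le_rfl⟩ h3).trans_lt hc.2.2.2.2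
    rw [profD_eq]
    have hs : 0 < Real.sin (2 * ang t a) := Real.sin_pos_of_pos_of_lt_pi (by linarith) (by linarith)
    have ha := (abs_lt.1 h.2.1).1
    have hr := ampRadius_le
    have : 0 < 2 * a ^ 2 - 1 := by nlinarith
    nlinarith [mul_pos this hs]
  · exact (h.late h0 h0'.le ⟨h3, ht.2⟩).2.trans_lt h0'

theorem IsPeak.strictAntiOn {T a : ℝ} (h : IsPeak T a) (h0 : 0 < prof T a) (h0' : profD T a < 0) :
    StrictAntiOn (fun t => prof t a) (Icc 0 T) := by
  refine strictAntiOn_of_deriv_neg (convex_Icc 0 T) (continuous_prof_left a).continuousOn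
    fun s hs => ?_
  rw [interior_Icc] at hs
  rw [(hasDerivAt_prof s a).deriv]
  exact h.profD_neg h0 h0' ⟨hs.1, hs.2.le⟩

end Existence

/-! ### Mass of half a loop as a smooth function -/

section SquareMass

/-- The mass `∫₀ᵀ prof²` of half a loop. -/
noncomputable def sqMass (T a : ℝ) : ℝ := ∫ t in (0 : ℝ)..T, prof t a ^ 2

/-- Writes the mass as a bounded linear map applied to the square of the smooth curve `unitProf`;
joint smoothness and differentiation under the integral then come for free. -/
theorem sqMass_eq_volterra (T a : ℝ) : sqMass T a = T * volterra (unitProf T a ^ 2) unitOne := by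
  rw [volterra_apply, sqMass]
  have h : ∫ r in (0 : ℝ)..1, unitExt (unitProf T a ^ 2) r = ∫ r in (0 : ℝ)..1, prof (T * r) a ^ 2 := by
    refine intervalIntegral.integral_congr fun r hr => ?_
    rw [uIcc_of_le zero_le_one] at hr
    simp only [unitExt_of_mem _ hr]
    rfl
  change _ = T * ∫ r in (0 : ℝ)..1, unitExt (unitProf T a ^ 2) r
  rw [h, intervalIntegral.mul_integral_comp_mul_left (f := fun t => prof t a ^ 2)]
  simp

theorem contDiff_sqMass : ContDiff ℝ (⊤ : ℕ∞) fun q : ℝ × ℝ => sqMass q.1 q.2 := by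
  have h : (fun q : ℝ × ℝ => sqMass q.1 q.2) = fun q =>
      q.1 * ContinuousMap.evalCLM ℝ unitOne (volterra (unitProf q.1 q.2 ^ 2)) := by
    funext q
    exact sqMass_eq_volterra q.1 q.2
  rw [h]
  exact contDiff_fst.mul ((ContinuousLinearMap.contDiff _).comp
    ((ContinuousLinearMap.contDiff _).comp (contDiff_unitProf.pow 2)))

theorem hasDerivAt_sqMass (T a : ℝ) : HasDerivAt (fun t => sqMass t a) (prof T a ^ 2) T := by
  have hc : Continuous fun t => prof t a ^ 2 := (continuous_prof_left a).pow 2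
  exact intervalIntegral.integral_hasDerivAt_right (hc.intervalIntegrable _ _)
    (hc.stronglyMeasurableAtFilter _ _) hc.continuousAt

theorem continuous_profA_left (a : ℝ) : Continuous fun t => profA t a :=
  continuous_iff_continuousAt.2 fun t => (hasDerivAt_profA t a).continuousAt

theorem hasDerivAt_sqMass_right (T a : ℝ) :
    HasDerivAt (fun b => sqMass T b) (∫ t in (0 : ℝ)..T, 2 * prof t a * profA t a) a := by
  have hd : DifferentiableAt ℝ (fun b => unitProf T b) a :=
    ((contDiff_unitProf.comp (contDiff_const.prodMk contDiff_id :
      ContDiff ℝ (⊤ : ℕ∞) fun b : ℝ => (T, b))).differentiable (by simp)).differentiableAt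
  set G : UnitFun := deriv (fun b => unitProf T b) a with hG
  have hdG : HasDerivAt (fun b => unitProf T b) G a := hd.hasDerivAt
  have hGs : ∀ s : Icc (0 : ℝ) 1, G s = profA (T * s) a := by
    intro s
    have h1 := (ContinuousMap.evalCLM ℝ s).hasFDerivAt.comp_hasDerivAt a hdG
    exact h1.unique (hasDerivAt_prof_right (T * s) a)
  have h2 := ((ContinuousMap.evalCLM ℝ unitOne).hasFDerivAt.comp_hasDerivAt a
    (volterra.hasFDerivAt.comp_hasDerivAt a (hdG.pow 2))).const_mul T
  have h3 : (fun b => sqMass T b) = fun b =>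
      T * ContinuousMap.evalCLM ℝ unitOne (volterra (unitProf T b ^ 2)) := by
    funext b
    exact sqMass_eq_volterra T b
  rw [h3]
  refine h2.congr_deriv ?_
  change T * ∫ r in (0 : ℝ)..1, unitExt _ r = _
  have h : ∫ r in (0 : ℝ)..1, unitExt (((2 : ℕ) : UnitFun) * unitProf T a ^ (2 - 1) * G) r =
      ∫ r in (0 : ℝ)..1, 2 * prof (T * r) a * profA (T * r) a := by
    refine intervalIntegral.integral_congr fun r hr => ?_
    rw [uIcc_of_le zero_le_one] at hr
    simp only [unitExt_of_mem _ hr, ContinuousMap.mul_apply, hGs]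
    have : ((2 : ℕ) : UnitFun) ⟨r, hr⟩ = 2 := rfl
    rw [this]
    simp [unitProf_apply]
  rw [h, intervalIntegral.mul_integral_comp_mul_left (f := fun t => 2 * prof t a * profA t a)]
  simp

theorem hasDerivAt_along {f : ℝ → ℝ → ℝ}
    (hf : ContDiff ℝ (⊤ : ℕ∞) fun q : ℝ × ℝ => f q.1 q.2) {a : ℝ → ℝ} {a' d₁ d₂ T : ℝ}
    (ha : HasDerivAt a a' T) (h₁ : HasDerivAt (fun s => f s (a T)) d₁ T)
    (h₂ : HasDerivAt (fun b => f T b) d₂ (a T)) :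
    HasDerivAt (fun s => f s (a s)) (d₁ + d₂ * a') T := by
  have h0 : HasFDerivAt (fun q : ℝ × ℝ => f q.1 q.2)
      (fderiv ℝ (fun q : ℝ × ℝ => f q.1 q.2) (T, a T)) (T, a T) :=
    (hf.differentiable (by simp)).differentiableAt.hasFDerivAt
  have h := h0.comp_hasDerivAt T ((hasDerivAt_id T).prodMk ha)
  refine h.congr_deriv ?_
  have e1 := h₁.unique (hasDerivAt_fst_of_contDiff hf T (a T))
  have e2 := h₂.unique (hasDerivAt_snd_of_contDiff hf T (a T))
  have : ((1 : ℝ), a') = (1, 0) + a' • ((0 : ℝ), (1 : ℝ)) := by simp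
  rw [this, map_add, map_smul, ← e1, ← e2, smul_eq_mul]
  ring

end SquareMass

/-! ### Differentiability of the amplitude pair in the length -/

section Implicit

/-- A function determined by an equation, uniquely within an open set, inherits the smoothness
of the equation. -/
theorem contDiffAt_of_implicit {E F G : Type*} [NormedAddCommGroup E] [NormedSpace ℝ E]
    [CompleteSpace E] [NormedAddCommGroup F] [NormedSpace ℝ F] [CompleteSpace F]
    [NormedAddCommGroup G] [NormedSpace ℝ G] [CompleteSpace G] {f : E × F → G} {y : E → F} {x₀ : E}
    {P : E × F → Prop} (hf : ContDiffAt ℝ 1 f (x₀, y x₀))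
    (hinv : (fderiv ℝ f (x₀, y x₀) ∘L .inr ℝ E F).IsInvertible)
    (hP : ∀ᶠ q in 𝓝 (x₀, y x₀), P q)
    (huniq : ∀ᶠ x in 𝓝 x₀, ∀ v, P (x, v) → f (x, v) = f (x₀, y x₀) → v = y x) :
    ContDiffAt ℝ 1 y x₀ := by
  have hφ := hf.contDiffAt_implicitFunction (by simp) hinv
  have hev := hf.eventually_apply_implicitFunction (by simp) hinv
  have h0 := hf.implicitFunction_apply_self (by simp) hinv
  simp only at hφ hev h0
  have hc : Tendsto (fun x => (x, hf.implicitFunction (by simp) hinv x)) (𝓝 x₀)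
      (𝓝 (x₀, y x₀)) := by
    have := continuousAt_id.prodMk hφ.continuousAt
    have h := this.tendsto
    simp only [id, h0] at h
    exact h
  refine hφ.congr_of_eventuallyEq ?_
  filter_upwards [hev, huniq, hc.eventually hP] with x h1 h2 h3
  exact (h2 _ h3 h1).symm

theorem isInvertible_of_injective {f : ℝ × ℝ →L[ℝ] ℝ × ℝ} (h : ∀ v, f v = 0 → v = 0) :
    f.IsInvertible := by
  have hinj : Function.Injective f.toLinearMap := by
    rw [← LinearMap.ker_eq_bot]
    exact LinearMap.ker_eq_bot'.2 h
  refine ⟨(LinearEquiv.ofInjectiveEndo f.toLinearMap hinj).toContinuousLinearEquiv, ?_⟩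
  exact ContinuousLinearMap.ext fun v => rfl

/-- The length threshold above which amplitude pairs exist. -/
noncomputable def lengthBound : ℝ := exists_isAmpPair.choose

theorem three_lt_lengthBound : 3 < lengthBound := exists_isAmpPair.choose_spec.1

/-- The amplitudes of the state with `K` peaks. -/
noncomputable def ampPair (N K : ℕ) (T : ℝ) : ℝ × ℝ :=
  Classical.epsilon fun q : ℝ × ℝ => IsAmpPair N K T q.1 q.2

theorem isAmpPair_ampPair {N K : ℕ} (hK : 1 ≤ K) (hKN : K ≤ N) {T : ℝ} (hT : lengthBound ≤ T) :
    IsAmpPair N K T (ampPair N K T).1 (ampPair N K T).2 := by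
  obtain ⟨a, b, h⟩ := exists_isAmpPair.choose_spec.2 N K hK hKN T hT
  exact Classical.epsilon_spec (p := fun q : ℝ × ℝ => IsAmpPair N K T q.1 q.2) ⟨(a, b), h⟩

/-- The system of equations for amplitude pairs. -/
noncomputable def ampEq (N K : ℕ) (q : ℝ × ℝ × ℝ) : ℝ × ℝ :=
  (prof q.1 q.2.1 - prof q.1 q.2.2, vertexBalance N K q.1 q.2.1 q.2.2)

theorem contDiffAt_vertexSlope {p : ℝ} (hp : |p| < 1) : ContDiffAt ℝ (⊤ : ℕ∞) vertexSlope p := by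
  have h1 : 0 < 1 - p ^ 2 := by
    rw [abs_lt] at hp
    nlinarith
  unfold vertexSlope
  exact contDiffAt_id.mul ((contDiffAt_const.sub (contDiffAt_id.pow 2)).sqrt h1.ne')

theorem contDiffAt_ampEq {N K : ℕ} {T a b : ℝ} (h : |prof T a| < 1) :
    ContDiffAt ℝ 1 (ampEq N K) (T, a, b) := by
  have c1 : ContDiff ℝ (⊤ : ℕ∞) fun q : ℝ × ℝ × ℝ => (q.1, q.2.1) := by fun_prop
  have c2 : ContDiff ℝ (⊤ : ℕ∞) fun q : ℝ × ℝ × ℝ => (q.1, q.2.2) := by fun_prop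
  have p1 : ContDiff ℝ (⊤ : ℕ∞) fun q : ℝ × ℝ × ℝ => prof q.1 q.2.1 := contDiff_prof.comp c1
  have p2 : ContDiff ℝ (⊤ : ℕ∞) fun q : ℝ × ℝ × ℝ => prof q.1 q.2.2 := contDiff_prof.comp c2
  have d1 : ContDiff ℝ (⊤ : ℕ∞) fun q : ℝ × ℝ × ℝ => profD q.1 q.2.1 := contDiff_profD.comp c1
  have d2 : ContDiff ℝ (⊤ : ℕ∞) fun q : ℝ × ℝ × ℝ => profD q.1 q.2.2 := contDiff_profD.comp c2
  have hv : ContDiffAt ℝ (⊤ : ℕ∞) (fun q : ℝ × ℝ × ℝ => vertexSlope (prof q.1 q.2.1)) (T, a, b) :=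
    ContDiffAt.comp (T, a, b) (g := vertexSlope) (f := fun q : ℝ × ℝ × ℝ => prof q.1 q.2.1)
      (contDiffAt_vertexSlope h) p1.contDiffAt
  have : ContDiffAt ℝ (⊤ : ℕ∞) (ampEq N K) (T, a, b) :=
    (p1.sub p2).contDiffAt.prodMk
      ((((contDiff_const.mul d1).add (contDiff_const.mul d2)).contDiffAt).add hv)
  exact this.of_le (by exact_mod_cast le_top)

theorem IsAmpPair.abs_prof_lt {N K : ℕ} {T a b : ℝ} (h : IsAmpPair N K T a b) :
    |prof T a| < 2 / 5 := h.1.2.2 T h.1.mem_right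

/-- A kernel vector `(α, β)` satisfies `β = (A / B) α`, and the linearised balance then multiplies
`α` by a sum of nonpositive terms with a negative one: `A`, `A'` are negative at a peak, `B`, `B'`
positive at a low profile, `H` positive. -/
theorem IsAmpPair.isInvertible {N K : ℕ} (hK : 1 ≤ K) (hKN : K ≤ N) {T a b : ℝ}
    (h : IsAmpPair N K T a b) :
    (fderiv ℝ (ampEq N K) (T, a, b) ∘L .inr ℝ ℝ (ℝ × ℝ)).IsInvertible := by
  have hKr : (1 : ℝ) ≤ K := by exact_mod_cast hK
  have hNK : (K : ℝ) ≤ N := by exact_mod_cast hKN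
  have hp := h.abs_prof_lt
  have hd : HasFDerivAt (ampEq N K) (fderiv ℝ (ampEq N K) (T, a, b)) (T, a, b) :=
    ((contDiffAt_ampEq (by linarith)).differentiableAt (by simp)).hasFDerivAt
  refine isInvertible_of_injective ?_
  rintro ⟨α, β⟩ hv
  -- Differentiating along a line through the pair expresses the action of the derivative on `(α,
  -- β)` by ordinary one-variable derivatives.
  have hline : HasDerivAt (fun s : ℝ => (T, a + s * α, b + s * β)) ((0 : ℝ), α, β) 0 := by
    have h1 : HasDerivAt (fun s : ℝ => a + s * α) α 0 := by
      simpa using ((hasDerivAt_id (0 : ℝ)).mul_const α).const_add a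
    have h2 : HasDerivAt (fun s : ℝ => b + s * β) β 0 := by
      simpa using ((hasDerivAt_id (0 : ℝ)).mul_const β).const_add b
    exact (hasDerivAt_const 0 T).prodMk (h1.prodMk h2)
  have hcomp : HasDerivAt (fun s : ℝ => ampEq N K (T, a + s * α, b + s * β)) 0 0 := by
    have hd' : HasFDerivAt (ampEq N K) (fderiv ℝ (ampEq N K) (T, a, b))
      ((fun s : ℝ => (T, a + s * α, b + s * β)) 0) := by simpa using hd
    have := hd'.comp_hasDerivAt (0 : ℝ) hline
    refine this.congr_deriv ?_
    exact hv
  have hα : HasDerivAt (fun s : ℝ => a + s * α) α 0 := by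
    simpa using ((hasDerivAt_id (0 : ℝ)).mul_const α).const_add a
  have hβ : HasDerivAt (fun s : ℝ => b + s * β) β 0 := by
    simpa using ((hasDerivAt_id (0 : ℝ)).mul_const β).const_add b
  have ea : a + 0 * α = a := by ring
  have eb : b + 0 * β = b := by ring
  have pa := HasDerivAt.comp (0 : ℝ) (by simpa only [ea] using hasDerivAt_prof_right T a) hα
  have pb := HasDerivAt.comp (0 : ℝ) (by simpa only [eb] using hasDerivAt_prof_right T b) hβ
  have da := HasDerivAt.comp (0 : ℝ) (by simpa only [ea] using hasDerivAt_profD_right T a) hα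
  have db := HasDerivAt.comp (0 : ℝ) (by simpa only [eb] using hasDerivAt_profD_right T b) hβ
  have hv' := HasDerivAt.comp (0 : ℝ)
    (by simpa only [Function.comp, ea] using hasDerivAt_vertexSlope (p := prof T a) (by linarith)) pa
  have e1 : profA T a * α - profA T b * β = 0 := by
    have := hcomp.fst
    exact (pa.sub pb).unique this
  have e2 : 2 * K * (profDA T a * α) + 2 * (N - K : ℝ) * (profDA T b * β) +
      (√(1 - prof T a ^ 2) - prof T a ^ 2 / √(1 - prof T a ^ 2)) * (profA T a * α) = 0 := by
    have := hcomp.snd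
    exact (((da.const_mul (2 * (K : ℝ))).add (db.const_mul (2 * (N - K : ℝ)))).add hv').unique this
  have hW := h.1.profA_le h.1.mem_right
  have hs := ampSlope_pos
  have hB := (h.2.1.profA_ge h.2.1.mem_right).1
  have hB' := h.2.1.profDA_pos
  have hh := deriv_vertexSlope_bounds hp
  set A := profA T a
  set A' := profDA T a
  set B := profA T b
  set B' := profDA T b
  set H := √(1 - prof T a ^ 2) - prof T a ^ 2 / √(1 - prof T a ^ 2)
  have hβα : β = A / B * α := by
    field_simp
    linarith
  have hfac : α * (2 * K * A' + 2 * (N - K : ℝ) * (B' * (A / B)) + H * A) = 0 := by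
    rw [hβα] at e2
    linear_combination e2
  have hneg : 2 * K * A' + 2 * (N - K : ℝ) * (B' * (A / B)) + H * A < 0 := by
    have h1 : 2 * K * A' < 0 := by nlinarith
    have h2 : H * A < 0 := mul_neg_of_pos_of_neg (by linarith) (by linarith)
    have h3 : A / B < 0 := div_neg_of_neg_of_pos (by linarith) (by linarith)
    have h4 : 2 * (N - K : ℝ) * (B' * (A / B)) ≤ 0 :=
      mul_nonpos_of_nonneg_of_nonpos (by linarith) (mul_neg_of_pos_of_neg hB' h3).le
    linarith
  have hα0 : α = 0 := by
    rcases mul_eq_zero.1 hfac with h0 | h0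
    · exact h0
    · exact absurd h0 hneg.ne
  rw [hβα, hα0]
  simp

/-- Being a peak and being low are open conditions, and within them the pair is unique. The chosen
pair therefore coincides nearby with the implicit function. -/
theorem contDiffAt_ampPair {N K : ℕ} (hK : 1 ≤ K) (hKN : K ≤ N) {T : ℝ} (hT : lengthBound < T) :
    ContDiffAt ℝ 1 (ampPair N K) T := by
  have h := isAmpPair_ampPair hK hKN hT.le
  have h0 : ampEq N K (T, ampPair N K T) = 0 := by
    refine Prod.ext ?_ h.2.2.2
    exact sub_eq_zero.2 h.2.2.1
  refine contDiffAt_of_implicit (f := ampEq N K)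
    (P := fun q => IsPeak q.1 q.2.1 ∧ IsLow q.1 q.2.2)
    (contDiffAt_ampEq (h.abs_prof_lt.trans (by norm_num))) (h.isInvertible hK hKN) ?_ ?_
  · have c1 : Continuous fun q : ℝ × ℝ × ℝ => (q.1, q.2.1) := by fun_prop
    have c2 : Continuous fun q : ℝ × ℝ × ℝ => (q.1, q.2.2) := by fun_prop
    exact ((c1.continuousAt (x := (T, ampPair N K T))).eventually
      (isOpen_isPeak.mem_nhds h.1)).and ((c2.continuousAt (x := (T, ampPair N K T))).eventually
      (isOpen_isLow.mem_nhds h.2.1))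
  · filter_upwards [lt_mem_nhds hT] with x hx v hv hvx
    rw [h0] at hvx
    have hpair : IsAmpPair N K x v.1 v.2 :=
      ⟨hv.1, hv.2, sub_eq_zero.1 (congrArg Prod.fst hvx), congrArg Prod.snd hvx⟩
    have := hpair.unique hK hKN (isAmpPair_ampPair hK hKN (le_of_lt hx))
    exact Prod.ext this.1 this.2

end Implicit

/-! ### Quantitative estimates for peaks -/

section PeakEstimates

/-- On `[3, T]` one has `u'' ≥ u / 2 ≥ p / 2`, and `u' (T) ≤ 0`. Integrating twice backwards gives
`u (3) ≥ p + p (T - 3)² / 4`, while `u (3) < 3/20`. This is the source of `p = O(T⁻²)`. -/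
theorem IsPeak.vertex_value_le {T a : ℝ} (h : IsPeak T a) (h0 : 0 < prof T a)
    (h0' : profD T a ≤ 0) : prof T a * (1 + (T - 3) ^ 2 / 4) ≤ 3 / 20 := by
  set p := prof T a with hp
  have d1 : ∀ t, HasDerivAt (fun t => profD t a + p / 2 * (T - t))
      ((1 - 2 * prof t a ^ 2) * prof t a - p / 2) t := fun t => by
    have h1 := (((hasDerivAt_id t).const_sub T).const_mul (p / 2))
    exact ((hasDerivAt_profD' t a).add h1).congr_deriv (by ring)
  have m1 : MonotoneOn (fun t => profD t a + p / 2 * (T - t)) (Icc 3 T) := by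
    refine monotoneOn_of_deriv_nonneg (convex_Icc _ _)
      (fun t _ => (d1 t).continuousAt.continuousWithinAt)
      (fun t _ => (d1 t).differentiableAt.differentiableWithinAt) fun t ht => ?_
    have ht' := interior_subset ht
    rw [(d1 t).deriv]
    have h1 := profile_coeff_half (h.2.2 t ht')
    have h2 := (h.late h0 h0' ht').1
    nlinarith
  have d2 : ∀ t, HasDerivAt (fun t => prof t a - p / 4 * (T - t) ^ 2)
      (profD t a + p / 2 * (T - t)) t := fun t => by
    have h1 := ((((hasDerivAt_id t).const_sub T).pow 2).const_mul (p / 4))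
    exact ((hasDerivAt_prof t a).sub h1).congr_deriv (by simp; ring)
  have m2 : AntitoneOn (fun t => prof t a - p / 4 * (T - t) ^ 2) (Icc 3 T) := by
    refine antitoneOn_of_deriv_nonpos (convex_Icc _ _)
      (fun t _ => (d2 t).continuousAt.continuousWithinAt)
      (fun t _ => (d2 t).differentiableAt.differentiableWithinAt) fun t ht => ?_
    have ht' := interior_subset ht
    rw [(d2 t).deriv]
    have := m1 ht' h.mem_right ht'.2
    simp only [sub_self, mul_zero, add_zero] at this
    linarith
  have h3 := m2 ⟨le_rfl, h.1.le⟩ h.mem_right h.1.le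
  have h4 := (central_spec h.2.1).2.2.2.1
  simp only [sub_self] at h3
  nlinarith

/-- `(2 u u')' ≥ u²` in the convexity range, and `u u'` is nonpositive at `T`. The bound does not
involve `T`. -/
theorem IsPeak.sqMass_tail {T a : ℝ} (h : IsPeak T a) (h0 : 0 < prof T a) (h0' : profD T a ≤ 0)
    {t : ℝ} (ht : t ∈ Icc 3 T) : sqMass T a - sqMass t a ≤ -2 * prof t a * profD t a := by
  have d1 : ∀ t, HasDerivAt (fun t => 2 * (prof t a * profD t a) - sqMass t a)
      (2 * profD t a ^ 2 + (2 * (1 - 2 * prof t a ^ 2) - 1) * prof t a ^ 2) t := fun t => by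
    have h1 := ((hasDerivAt_prof t a).mul (hasDerivAt_profD' t a)).const_mul 2
    exact (h1.sub (hasDerivAt_sqMass t a)).congr_deriv (by ring)
  have m1 : MonotoneOn (fun t => 2 * (prof t a * profD t a) - sqMass t a) (Icc 3 T) := by
    refine monotoneOn_of_deriv_nonneg (convex_Icc _ _)
      (fun t _ => (d1 t).continuousAt.continuousWithinAt)
      (fun t _ => (d1 t).differentiableAt.differentiableWithinAt) fun t ht => ?_
    rw [(d1 t).deriv]
    have h1 := profile_coeff_half (h.2.2 t (interior_subset ht))
    have h2 : 0 ≤ (2 * (1 - 2 * prof t a ^ 2) - 1) * prof t a ^ 2 :=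
      mul_nonneg (by linarith) (sq_nonneg _)
    positivity
  have h1 := m1 ht h.mem_right ht.2
  simp only at h1
  nlinarith

theorem IsPeak.ang_tail {T a : ℝ} (h : IsPeak T a) (h0 : 0 < prof T a) (h0' : profD T a ≤ 0)
    {t : ℝ} (ht : t ∈ Icc 3 T) : ang T a - ang t a ≤ -2 * profD t a := by
  have d1 : ∀ t, HasDerivAt (fun t => 2 * profD t a - ang t a)
      (2 * ((1 - 2 * prof t a ^ 2) * prof t a) - prof t a) t := fun t =>
    ((hasDerivAt_profD' t a).const_mul 2).sub (hasDerivAt_ang t a)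
  have m1 : MonotoneOn (fun t => 2 * profD t a - ang t a) (Icc 3 T) := by
    refine monotoneOn_of_deriv_nonneg (convex_Icc _ _)
      (fun t _ => (d1 t).continuousAt.continuousWithinAt)
      (fun t _ => (d1 t).differentiableAt.differentiableWithinAt) fun t ht => ?_
    have ht' := interior_subset ht
    rw [(d1 t).deriv]
    have h1 := profile_coeff_half (h.2.2 t ht')
    have h2 := (h.late h0 h0' ht').1
    nlinarith
  have h1 := m1 ht h.mem_right ht.2
  simp only at h1
  linarith

theorem sqMass_one {T : ℝ} (hT : 0 ≤ T) : sqMass T 1 = Real.tanh T := by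
  have hd : ∀ t ∈ uIcc 0 T, HasDerivAt Real.tanh (prof t 1 ^ 2) t := by
    intro t ht
    rw [uIcc_of_le hT] at ht
    have hc := (Real.cosh_pos t).ne'
    have h1 := (Real.hasDerivAt_sinh t).div (Real.hasDerivAt_cosh t) hc
    have h2 : Real.tanh = Real.sinh / Real.cosh := by
      funext x
      exact Real.tanh_eq_sinh_div_cosh x
    rw [h2]
    refine h1.congr_deriv ?_
    rw [(prof_one ht.1).1]
    have := Real.cosh_sq t
    field_simp
    linarith
  have := intervalIntegral.integral_eq_sub_of_hasDerivAt hd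
    (((continuous_prof_left 1).pow 2).intervalIntegrable _ _)
  rw [sqMass, this]
  simp

theorem one_sub_tanh_le {L : ℝ} (hL : 0 ≤ L) :
    0 ≤ 1 - Real.tanh L ∧ 1 - Real.tanh L ≤ 1 / Real.cosh L ^ 2 := by
  have hc := Real.cosh_pos L
  have hs := Real.sinh_nonneg_iff.2 hL
  have h1 := Real.sinh_lt_cosh L
  have h2 := Real.cosh_sq L
  rw [Real.tanh_eq_sinh_div_cosh]
  have e : 1 - Real.sinh L / Real.cosh L = (Real.cosh L - Real.sinh L) / Real.cosh L := by
    field_simp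
  rw [e]
  refine ⟨div_nonneg (by linarith) hc.le, ?_⟩
  rw [div_le_div_iff₀ hc (by positivity)]
  have h3 : (Real.cosh L - Real.sinh L) * (Real.cosh L + Real.sinh L) = 1 := by linarith
  have h4 : (Real.cosh L - Real.sinh L) * Real.cosh L ≤ 1 := by nlinarith
  nlinarith

/-- The mass of a peak is close to the mass of half a soliton. -/
theorem exists_sqMass_close {ε : ℝ} (hε : 0 < ε) : ∃ δ > 0, ∃ L : ℝ, ∀ T a, L ≤ T → IsPeak T a →
    0 < prof T a → profD T a ≤ 0 → |a - 1| < δ → |sqMass T a - 1| ≤ ε := by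
  -- Order of choices: `L` makes the soliton tail beyond `L` small, then `δ` comes from continuity
  -- in the amplitude at the fixed time `L`. The stretch `[L, T]` is controlled by `sqMass_tail`,
  -- uniformly in `T`.
  obtain ⟨L, hL3, hL⟩ : ∃ L : ℝ, 3 ≤ L ∧ 8 / ε < L := ⟨max 3 (8 / ε + 1), le_max_left _ _,
    (lt_add_one _).trans_le (le_max_right _ _)⟩
  have hL0 : 0 ≤ L := by linarith
  have hcosh : L ≤ Real.cosh L := (Real.self_le_sinh_iff.2 hL0).trans (Real.sinh_lt_cosh L).le
  have hsm : 1 / Real.cosh L ≤ ε / 8 := by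
    rw [div_le_iff₀ (Real.cosh_pos L)]
    rw [div_lt_iff₀ hε] at hL
    nlinarith
  have hc1 : 1 ≤ Real.cosh L := Real.one_le_cosh L
  have hsm2 : 1 / Real.cosh L ^ 2 ≤ ε / 8 := by
    refine le_trans ?_ hsm
    rw [div_le_div_iff₀ (by positivity) (by positivity)]
    nlinarith
  have hS : Continuous fun a => sqMass L a :=
    contDiff_sqMass.continuous.comp (Continuous.prodMk_right L)
  have hT : Continuous fun a => -2 * prof L a * profD L a :=
    (continuous_const.mul (continuous_prof_right L)).mul (continuous_profD_right L)
  have e1 : |sqMass L 1 - 1| < ε / 4 := by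
    rw [sqMass_one hL0, abs_sub_comm, abs_of_nonneg (one_sub_tanh_le hL0).1]
    linarith [(one_sub_tanh_le hL0).2]
  have e2 : -2 * prof L 1 * profD L 1 < ε / 2 := by
    rw [(prof_one hL0).1, (prof_one hL0).2]
    have hs := Real.sinh_lt_cosh L
    have hs0 := Real.sinh_nonneg_iff.2 hL0
    have h1 : -2 * (Real.cosh L)⁻¹ * (-Real.sinh L / Real.cosh L ^ 2) =
        2 * (Real.sinh L / Real.cosh L) * (1 / Real.cosh L ^ 2) := by
      field_simp
    have h2 : Real.sinh L / Real.cosh L ≤ 1 := (div_le_one (Real.cosh_pos L)).2 hs.le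
    have h3 : 0 ≤ 1 / Real.cosh L ^ 2 := by positivity
    rw [h1]
    nlinarith
  have hev : ∀ᶠ a in 𝓝 (1 : ℝ), |sqMass L a - 1| < ε / 4 ∧ -2 * prof L a * profD L a < ε / 2 :=
    (((hS.sub continuous_const).abs).continuousAt.eventually_lt_const e1).and
      (hT.continuousAt.eventually_lt_const e2)
  obtain ⟨δ, hδ, hball⟩ := Metric.eventually_nhds_iff.1 hev
  refine ⟨δ, hδ, L, fun T a hLT h h0 h0' ha => ?_⟩
  obtain ⟨b1, b2⟩ := hball (by rwa [Real.dist_eq])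
  have b3 := h.sqMass_tail h0 h0' ⟨hL3, hLT⟩
  have b4 : sqMass L a ≤ sqMass T a := by
    have hm : MonotoneOn (fun t => sqMass t a) (Icc L T) := by
      refine monotoneOn_of_deriv_nonneg (convex_Icc _ _)
        (fun t _ => (hasDerivAt_sqMass t a).continuousAt.continuousWithinAt)
        (fun t _ => (hasDerivAt_sqMass t a).differentiableAt.differentiableWithinAt)
        fun t ht => ?_
      rw [(hasDerivAt_sqMass t a).deriv]
      positivity
    exact hm ⟨le_rfl, hLT⟩ ⟨hLT, le_rfl⟩ hLT
  rw [abs_lt] at b1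
  rw [abs_le]
  constructor <;> linarith

/-- A bound for the variation of the mass on the central part of a peak. -/
theorem exists_central_variation_bound : ∃ M : ℝ, 0 < M ∧ ∀ t ∈ Icc (0 : ℝ) 3, ∀ a ∈ Icc (0 : ℝ) 2,
    |2 * prof t a * profA t a| ≤ M := by
  have hc : Continuous fun q : ℝ × ℝ => 2 * prof q.1 q.2 * profA q.1 q.2 :=
    (continuous_const.mul continuous_prof).mul continuous_profA
  obtain ⟨M, hM⟩ := (isCompact_Icc.prod isCompact_Icc : IsCompact
    (Icc (0 : ℝ) 3 ×ˢ Icc (0 : ℝ) 2)).exists_bound_of_continuousOn hc.continuousOn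
  exact ⟨max M 1, lt_max_of_lt_right one_pos, fun t ht a ha =>
    (hM (t, a) ⟨ht, ha⟩).trans (le_max_left _ _)⟩

theorem IsPeak.amp_bounds {T a : ℝ} (h : IsPeak T a) : 9 / 10 ≤ a ∧ a ≤ 11 / 10 := by
  have h1 := h.2.1
  have h2 := ampRadius_le
  rw [abs_lt] at h1
  constructor <;> linarith

/-- On `[0, 3]` compactness suffices. On `[3, T]` one has `|profA t a| ≤ |profA T a|`, and `∫ prof`
is at most `-2 profD 3 a ≤ 4`. The factor `c` stands for the derivative of the amplitude in `T`:
only its product with `profA T a` will be controlled. -/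
theorem exists_peak_variation_bound : ∃ M : ℝ, 0 < M ∧ ∀ T a, IsPeak T a → 0 < prof T a →
    profD T a ≤ 0 → ∀ c : ℝ, |(∫ t in (0 : ℝ)..T, 2 * prof t a * profA t a) * c| ≤
      M * |profA T a * c| := by
  obtain ⟨M, hM0, hM⟩ := exists_central_variation_bound
  have hs := ampSlope_pos
  refine ⟨3 * M / ampSlope + 8, by positivity, fun T a h h0 h0' c => ?_⟩
  have hint : ∀ x y : ℝ, IntervalIntegrable (fun t => 2 * prof t a * profA t a) volume x y :=
    fun x y => ((continuous_const.mul (continuous_prof_left a)).mul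
      (continuous_profA_left a)).intervalIntegrable x y
  have hW := (h.profA_le h.mem_right).1
  have hWabs : ampSlope ≤ |profA T a| := by
    rw [abs_of_neg (by linarith)]
    linarith
  have i1 : |∫ t in (0 : ℝ)..3, 2 * prof t a * profA t a| ≤ M * 3 := by
    have := intervalIntegral.norm_integral_le_of_norm_le_const (a := (0 : ℝ)) (b := 3) (C := M)
      (f := fun t => 2 * prof t a * profA t a) fun t ht => by
        rw [uIoc_of_le (by norm_num)] at ht
        exact hM t ⟨ht.1.le, ht.2⟩ a ⟨by linarith [h.amp_bounds.1], by linarith [h.amp_bounds.2]⟩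
    simpa using this
  have hD3 : -2 * profD 3 a ≤ 4 := by
    have e := prof_energy 3 a
    have u3 := (central_spec h.2.1).2.2.2.1
    have u0 := (central_spec h.2.1).2.2.1 3 ⟨by norm_num, le_rfl⟩
    have hab := h.amp_bounds
    have ha2 : a ^ 2 ≤ 3 / 2 := by nlinarith
    have ha4 : a ^ 4 ≤ 9 / 4 := by nlinarith [sq_nonneg a]
    have : profD 3 a ^ 2 ≤ 4 := by nlinarith [sq_nonneg (prof 3 a ^ 2), sq_nonneg a]
    nlinarith
  have i2 : |∫ t in (3 : ℝ)..T, 2 * prof t a * profA t a| ≤ 8 * |profA T a| := by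
    have h1 := intervalIntegral.norm_integral_le_of_norm_le (a := (3 : ℝ)) (b := T) (μ := volume)
      (f := fun t => 2 * prof t a * profA t a) (g := fun t => 2 * |profA T a| * prof t a) h.1.le
      (Eventually.of_forall fun t ht => by
        have ht' : t ∈ Icc 3 T := ⟨ht.1.le, ht.2⟩
        have b1 := h.profA_ge ht'
        have b2 := (h.profA_le ht').1
        have b3 := h.pos h0 h0' ⟨by linarith [ht.1], ht.2⟩
        rw [Real.norm_eq_abs, abs_mul, abs_mul, abs_two, abs_of_pos b3,
          abs_of_neg (show profA t a < 0 by linarith),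
          abs_of_neg (show profA T a < 0 by linarith)]
        nlinarith)
      ((continuous_const.mul (continuous_prof_left a)).intervalIntegrable _ _)
    rw [intervalIntegral.integral_const_mul] at h1
    have h2 : ∫ t in (3 : ℝ)..T, prof t a = ang T a - ang 3 a :=
      intervalIntegral.integral_eq_sub_of_hasDerivAt (fun s _ => hasDerivAt_ang s a)
        ((continuous_prof_left a).intervalIntegrable _ _)
    rw [h2, Real.norm_eq_abs] at h1
    have h3 := h.ang_tail h0 h0' ⟨le_rfl, h.1.le⟩
    have h4 := abs_nonneg (profA T a)
    nlinarith
  rw [abs_mul, abs_mul, ← intervalIntegral.integral_add_adjacent_intervals (hint 0 3) (hint 3 T)]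
  have h5 : |(∫ t in (0 : ℝ)..3, 2 * prof t a * profA t a) +
      ∫ t in (3 : ℝ)..T, 2 * prof t a * profA t a| ≤ (3 * M / ampSlope + 8) * |profA T a| := by
    refine (abs_add_le _ _).trans ?_
    have : M * 3 ≤ 3 * M / ampSlope * |profA T a| := by
      rw [div_mul_eq_mul_div, le_div_iff₀ hs]
      nlinarith
    linarith
  calc _ ≤ (3 * M / ampSlope + 8) * |profA T a| * |c| :=
        mul_le_mul_of_nonneg_right h5 (abs_nonneg _)
    _ = _ := by ring

end PeakEstimates

/-! ### Quantitative estimates for low profiles -/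

section LowEstimates

theorem IsLow.sqMass_nonneg {T b : ℝ} (h : IsLow T b) : 0 ≤ sqMass T b :=
  intervalIntegral.integral_nonneg h.1.le fun _ _ => sq_nonneg _

theorem IsLow.prof_le {T b : ℝ} (h : IsLow T b) {t : ℝ} (ht : t ∈ Icc 0 T) :
    prof t b ≤ prof T b := h.strictMonoOn.monotoneOn ht h.mem_right ht.2

theorem IsLow.sqMass_le {T b : ℝ} (h : IsLow T b) : sqMass T b ≤ T * prof T b ^ 2 := by
  have h1 := intervalIntegral.norm_integral_le_of_norm_le_const (a := (0 : ℝ)) (b := T)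
    (C := prof T b ^ 2) (f := fun t => prof t b ^ 2) fun t ht => by
      rw [uIoc_of_le h.1.le] at ht
      have ht' : t ∈ Icc 0 T := ⟨ht.1.le, ht.2⟩
      have b1 := h.prof_le ht'
      have b2 := h.prof_pos ht'
      rw [Real.norm_eq_abs, abs_of_nonneg (sq_nonneg _)]
      nlinarith
  rw [sub_zero, abs_of_pos h.1] at h1
  exact ((le_abs_self _).trans h1).trans (by linarith)

theorem IsLow.variation_bound {T b : ℝ} (h : IsLow T b) (c : ℝ) :
    |(∫ t in (0 : ℝ)..T, 2 * prof t b * profA t b) * c| ≤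
      2 * T * prof T b * |profA T b * c| := by
  have h1 := intervalIntegral.norm_integral_le_of_norm_le_const (a := (0 : ℝ)) (b := T)
    (C := 2 * prof T b * |profA T b|) (f := fun t => 2 * prof t b * profA t b) fun t ht => by
      rw [uIoc_of_le h.1.le] at ht
      have ht' : t ∈ Icc 0 T := ⟨ht.1.le, ht.2⟩
      have b1 := h.prof_le ht'
      have b2 := h.prof_pos ht'
      have b3 := (h.profA_ge ht').1
      have b4 := h.profA_le ht'
      rw [Real.norm_eq_abs, abs_mul, abs_mul, abs_two, abs_of_pos b2,
        abs_of_pos (show 0 < profA t b by linarith), abs_of_pos (show 0 < profA T b by linarith)]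
      have : prof t b * profA t b ≤ prof T b * profA T b :=
        mul_le_mul b1 b4 (by linarith) (by linarith)
      linarith
  rw [sub_zero, abs_of_pos h.1] at h1
  rw [abs_mul, abs_mul]
  calc _ ≤ (2 * prof T b * |profA T b| * T) * |c| :=
        mul_le_mul_of_nonneg_right h1 (abs_nonneg _)
    _ = _ := by ring

end LowEstimates

/-! ### Estimates for amplitude pairs and their derivatives -/

section PairEstimates

variable {N K : ℕ} {T a b : ℝ}

theorem IsAmpPair.neg_profD_le (hK : 1 ≤ K) (hKN : K ≤ N) (h : IsAmpPair N K T a b) :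
    -profD T a ≤ N * prof T a := by
  have hKr : (1 : ℝ) ≤ K := by exact_mod_cast hK
  have hNK : (K : ℝ) ≤ N := by exact_mod_cast hKN
  have h1 := vertexSlope_le h.prof_pos.le
  have h2 := h.2.1.profD_le
  have h3 := h.profD_neg hK hKN
  have h4 := h.prof_pos
  rw [← h.2.2.1] at h2
  have e := h.2.2.2
  unfold vertexBalance at e
  have h5 : 2 * (N - K : ℝ) * profD T b ≤ 2 * (N - K : ℝ) * prof T a :=
    mul_le_mul_of_nonneg_left h2 (by linarith)
  nlinarith

/-- For `T ≥ 6` one has `(T - 3)² ≥ T² / 4`, so the peak estimate costs a factor `16`: `16 · 3/20 =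
12/5`. -/
theorem IsAmpPair.vertex_value_le (hK : 1 ≤ K) (hKN : K ≤ N) (h : IsAmpPair N K T a b)
    (hT : 6 ≤ T) : prof T a * T ^ 2 ≤ 12 / 5 := by
  have h1 := h.1.vertex_value_le h.prof_pos (h.profD_neg hK hKN).le
  have h2 := h.prof_pos
  have h3 : T ^ 2 ≤ 16 * ((T - 3) ^ 2 / 4) := by nlinarith
  nlinarith

/-- By the energy identity `a⁴ - a² = profD² - p² + p⁴` at the vertex, and all terms on the right
are of order `p²`. -/
theorem IsAmpPair.amp_close (hK : 1 ≤ K) (hKN : K ≤ N) (h : IsAmpPair N K T a b) :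
    |a - 1| ≤ (N ^ 2 + 2) * prof T a ^ 2 := by
  have h1 := h.neg_profD_le hK hKN
  have h2 := h.profD_neg hK hKN
  have h3 := h.prof_pos
  have h4 := h.prof_lt
  have h5 := prof_energy T a
  have hq : profD T a ^ 2 ≤ N ^ 2 * prof T a ^ 2 := by
    rw [← mul_pow, ← neg_sq]
    exact pow_le_pow_left₀ (by linarith) h1 2
  have hp4 : prof T a ^ 4 ≤ prof T a ^ 2 := by
    have : prof T a ^ 2 ≤ 1 := by nlinarith
    nlinarith [sq_nonneg (prof T a)]
  have e : a ^ 4 - a ^ 2 = a ^ 2 * (a + 1) * (a - 1) := by ring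
  have hab := h.1.amp_bounds
  have h6 : |a ^ 4 - a ^ 2| ≤ (N ^ 2 + 2) * prof T a ^ 2 := by
    have := sq_nonneg (profD T a)
    have := sq_nonneg (prof T a ^ 2)
    have := sq_nonneg (prof T a)
    rw [abs_le]
    constructor <;> nlinarith
  refine le_trans ?_ h6
  rw [e, abs_mul]
  have h7 : 1 ≤ |a ^ 2 * (a + 1)| := by
    rw [abs_of_nonneg (by nlinarith [sq_nonneg a])]
    nlinarith
  nlinarith [abs_nonneg (a - 1)]

/-- An a priori bound by signs. If `d > p`, no term is negative and the first is positive. If `d <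
-4np`, the middle terms are nonpositive and `H d ≤ d / 2 < -2np` outweighs `2nr`. No upper bound on
the rates `ρ` and `σ` is needed. -/
theorem balance_bounds {n k p r q q' ρ σ H d : ℝ} (hk : 1 ≤ k) (hkn : k ≤ n) (hr : 0 < r)
    (hrp : r ≤ p) (hρ : 0 ≤ ρ) (hσ : 0 ≤ σ) (hq : q ≤ 0) (hq0 : 0 ≤ q') (hq' : q' ≤ p)
    (hqn : -q ≤ n * p) (hH : 1 / 2 ≤ H)
    (e : 2 * n * r + 2 * k * (ρ * (d - q)) + 2 * (n - k) * (σ * (d - q')) + H * d = 0) :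
    -(4 * n * p) ≤ d ∧ d ≤ p := by
  have hp : 0 < p := hr.trans_le hrp
  have hnr : 0 < n * r := mul_pos (by linarith) hr
  have hnrp : n * r ≤ n * p := mul_le_mul_of_nonneg_left hrp (by linarith)
  constructor
  · by_contra hcon
    push Not at hcon
    have t1 : 2 * k * (ρ * (d - q)) ≤ 0 :=
      mul_nonpos_of_nonneg_of_nonpos (by linarith)
        (mul_nonpos_of_nonneg_of_nonpos hρ (by linarith))
    have t2 : 2 * (n - k) * (σ * (d - q')) ≤ 0 :=
      mul_nonpos_of_nonneg_of_nonpos (by linarith)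
        (mul_nonpos_of_nonneg_of_nonpos hσ (by linarith))
    have t3 : H * d ≤ 1 / 2 * d := mul_le_mul_of_nonpos_right hH (by linarith)
    linarith
  · by_contra hcon
    push Not at hcon
    have t1 : 0 ≤ 2 * k * (ρ * (d - q)) :=
      mul_nonneg (by linarith) (mul_nonneg hρ (by linarith))
    have t2 : 0 ≤ 2 * (n - k) * (σ * (d - q')) :=
      mul_nonneg (by linarith) (mul_nonneg hσ (by linarith))
    have t3 : 0 ≤ H * d := mul_nonneg (by linarith) (by linarith)
    linarith

/-- `balance_bounds` is applied to the balance differentiated in `T`. The unknown `d` is the total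
derivative of the vertex value, the rates are `profDA / profA` at the two amplitudes, and `r = p -
2p³` is the second derivative of either profile at `T`. -/
theorem deriv_ampPair_bounds (hK : 1 ≤ K) (hKN : K ≤ N) {A B : ℝ → ℝ} {a' b' : ℝ}
    (hA : HasDerivAt A a' T) (hB : HasDerivAt B b' T)
    (h : ∀ᶠ s in 𝓝 T, IsAmpPair N K s (A s) (B s)) :
    |profD T (A T) + profA T (A T) * a'| ≤ 4 * N * prof T (A T) ∧
      |profA T (A T) * a'| ≤ 5 * N * prof T (A T) ∧
      |profA T (B T) * b'| ≤ 5 * N * prof T (A T) := by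
  have hKr : (1 : ℝ) ≤ K := by exact_mod_cast hK
  have hNK : (K : ℝ) ≤ N := by exact_mod_cast hKN
  have h0 := h.self_of_nhds
  have da := hasDerivAt_along contDiff_prof hA (hasDerivAt_prof T (A T))
    (hasDerivAt_prof_right T (A T))
  have db := hasDerivAt_along contDiff_prof hB (hasDerivAt_prof T (B T))
    (hasDerivAt_prof_right T (B T))
  have da2 := hasDerivAt_along contDiff_profD hA (hasDerivAt_profD T (A T))
    (hasDerivAt_profD_right T (A T))
  have db2 := hasDerivAt_along contDiff_profD hB (hasDerivAt_profD T (B T))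
    (hasDerivAt_profD_right T (B T))
  have hplt := h0.abs_prof_lt
  have hv := HasDerivAt.comp T (hasDerivAt_vertexSlope (p := prof T (A T)) (by linarith)) da
  have e1 : profD T (A T) + profA T (A T) * a' = profD T (B T) + profA T (B T) * b' :=
    da.unique (db.congr_of_eventuallyEq (h.mono fun s hs => hs.2.2.1))
  have e2 := (((da2.const_mul (2 * (K : ℝ))).add (db2.const_mul (2 * (N - K : ℝ)))).add hv).unique
    ((hasDerivAt_const T (0 : ℝ)).congr_of_eventuallyEq (h.mono fun s hs => hs.2.2.2))
  have hp := h0.prof_pos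
  have hpl := h0.prof_lt
  have q1 := h0.neg_profD_le hK hKN
  have q2 := h0.profD_neg hK hKN
  have q3 := h0.2.1.profD_le
  have q4 := h0.2.1.profD_pos ⟨h0.2.1.1, le_rfl⟩
  have hH := deriv_vertexSlope_bounds hplt
  have hW := h0.1.profA_le h0.1.mem_right
  have hs := ampSlope_pos
  have hB1 := (h0.2.1.profA_ge h0.2.1.mem_right).1
  have hB2 := h0.2.1.profDA_pos
  rw [← h0.2.2.1] at q3 e2
  set p := prof T (A T) with hpdef
  set H := √(1 - p ^ 2) - p ^ 2 / √(1 - p ^ 2)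
  set W := profA T (A T)
  set W' := profDA T (A T)
  set Z := profA T (B T)
  set Z' := profDA T (B T)
  set d := profD T (A T) + W * a' with hd
  set r := p - 2 * p ^ 3 with hr
  have hr0 : 0 < r := by
    have : p ^ 3 = p * p ^ 2 := by ring
    have : p ^ 2 < 1 / 4 := by nlinarith
    nlinarith
  have hrp : r ≤ p := by
    have : 0 < p ^ 3 := by positivity
    linarith
  have hx : W' * a' = (W' / W) * (d - profD T (A T)) := by
    have : W ≠ 0 := by linarith
    rw [hd]
    field_simp
    ring
  have hy : Z' * b' = (Z' / Z) * (d - profD T (B T)) := by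
    have : Z ≠ 0 := by linarith
    rw [e1]
    field_simp
    ring
  have hρ : 0 < W' / W := div_pos_of_neg_of_neg (by linarith) (by linarith)
  have hσ : 0 < Z' / Z := div_pos hB2 (by linarith)
  have e3 : 2 * N * r + 2 * K * (W' / W * (d - profD T (A T))) +
      2 * (N - K : ℝ) * (Z' / Z * (d - profD T (B T))) + H * d = 0 := by
    rw [← hx, ← hy]
    linarith
  have hN1 : (1 : ℝ) ≤ N := by linarith
  have hNp : p ≤ N * p := by nlinarith
  obtain ⟨hdn, hup⟩ := balance_bounds hKr hNK hr0 hrp hρ.le hσ.le q2.le q4.le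
    q3 q1 hH e3
  have hd0 : |d| ≤ 4 * N * p := abs_le.2 ⟨by linarith, by linarith⟩
  refine ⟨hd0, ?_, ?_⟩
  · rw [abs_le]
    constructor <;> linarith
  · rw [abs_le]
    constructor <;> linarith

end PairEstimates

/-! ### The rescaled mass and its derivative -/

section ScaledMass

/-- The mass of the rescaled state with `K` peaks on a flower graph with loops of length `2T`. -/
noncomputable def scaledMass (N K : ℕ) (T : ℝ) : ℝ :=
  2 * K * sqMass T (ampPair N K T).1 + 2 * (N - K : ℝ) * sqMass T (ampPair N K T).2 +
    (1 - √(1 - prof T (ampPair N K T).1 ^ 2))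

/-- Every term of the derivative is at most a constant times `p`, and `p T² ≤ 12/5`. -/
theorem exists_deriv_scaledMass_bound (N : ℕ) : ∃ C : ℝ, 0 < C ∧ ∀ K : ℕ, 1 ≤ K → K ≤ N →
    ∀ T, lengthBound < T → 6 ≤ T → ∃ m' : ℝ, HasDerivAt (scaledMass N K) m' T ∧
      T * |m'| ≤ C / T := by
  obtain ⟨M, hM0, hM⟩ := exists_peak_variation_bound
  refine ⟨12 / 5 * (2 * N + 10 * M * N ^ 2 + 20 * N ^ 2 + 10 * N) + 1, by positivity,
    fun K hK hKN T hT hT6 => ?_⟩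
  have hKr : (1 : ℝ) ≤ K := by exact_mod_cast hK
  have hNK : (K : ℝ) ≤ N := by exact_mod_cast hKN
  have h := isAmpPair_ampPair hK hKN hT.le
  have hev : ∀ᶠ s in 𝓝 T, IsAmpPair N K s (ampPair N K s).1 (ampPair N K s).2 :=
    (lt_mem_nhds hT).mono fun s hs => isAmpPair_ampPair hK hKN (le_of_lt hs)
  have hd := ((contDiffAt_ampPair hK hKN hT).differentiableAt (by simp)).hasDerivAt
  have hA : HasDerivAt (fun s => (ampPair N K s).1) (deriv (ampPair N K) T).1 T := hd.fst
  have hB : HasDerivAt (fun s => (ampPair N K s).2) (deriv (ampPair N K) T).2 T := hd.snd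
  obtain ⟨b1, b2, b3⟩ := deriv_ampPair_bounds hK hKN hA hB hev
  have mA := hasDerivAt_along contDiff_sqMass hA (hasDerivAt_sqMass T _)
    (hasDerivAt_sqMass_right T _)
  have mB := hasDerivAt_along contDiff_sqMass hB (hasDerivAt_sqMass T _)
    (hasDerivAt_sqMass_right T _)
  have dp := hasDerivAt_along contDiff_prof hA (hasDerivAt_prof T _) (hasDerivAt_prof_right T _)
  have hp := h.prof_pos
  have hpl := h.prof_lt
  have hpT := h.vertex_value_le hK hKN hT6
  have vA := hM T _ h.1 hp (h.profD_neg hK hKN).le (deriv (ampPair N K) T).1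
  have vB := h.2.1.variation_bound (deriv (ampPair N K) T).2
  rw [← h.2.2.1] at vB
  rw [← h.2.2.1] at mB
  set p := prof T (ampPair N K T).1 with hpd
  set d := profD T (ampPair N K T).1 + profA T (ampPair N K T).1 * (deriv (ampPair N K) T).1
  have hp2 : p ^ 2 < 4 / 25 := by nlinarith
  have h1p : 0 < 1 - p ^ 2 := by linarith
  have hsq : HasDerivAt (fun s => 1 - √(1 - prof s (ampPair N K s).1 ^ 2))
      (p * d / √(1 - p ^ 2)) T := by
    have := (((dp.pow 2).const_sub 1).sqrt (by simpa using h1p.ne')).const_sub 1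
    refine this.congr_deriv ?_
    simp only [Pi.pow_apply, ← hpd]
    field_simp
    push_cast
    ring
  have key := ((mA.const_mul (2 * (K : ℝ))).add (mB.const_mul (2 * (N - K : ℝ)))).add hsq
  refine ⟨_, key, ?_⟩
  set IA := (∫ t in (0 : ℝ)..T, 2 * prof t (ampPair N K T).1 * profA t (ampPair N K T).1) *
    (deriv (ampPair N K) T).1
  -- For the low loops the variation bound carries an extra factor `T p`, which is harmless since `p
  -- T² ≤ 12/5` and `T ≥ 6` give `T p ≤ 1`.
  set IB := (∫ t in (0 : ℝ)..T, 2 * prof t (ampPair N K T).2 * profA t (ampPair N K T).2) *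
    (deriv (ampPair N K) T).2
  have hN1 : (1 : ℝ) ≤ N := by linarith
  have hT0 : 0 < T := by linarith
  have wA : |IA| ≤ 5 * M * N * p := vA.trans (by nlinarith)
  have wB : |IB| ≤ 10 * N * p * (T * p) := by
    refine vB.trans ?_
    have : 0 ≤ 2 * T * p := by positivity
    nlinarith
  have hTp : T * p ≤ 1 := by
    have : 0 < T * p := by positivity
    nlinarith
  have wB' : |IB| ≤ 10 * N * p := wB.trans (by
    have : 0 ≤ 10 * N * p := by positivity
    nlinarith)
  have wC : |p * d / √(1 - p ^ 2)| ≤ 8 * N * p := by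
    have h9 : (9 / 10 : ℝ) ≤ √(1 - p ^ 2) := Real.le_sqrt_of_sq_le (by linarith)
    rw [abs_div, abs_of_pos (show 0 < √(1 - p ^ 2) by linarith), div_le_iff₀ (by linarith),
      abs_mul, abs_of_pos hp]
    have g1 : p * |d| ≤ p * (4 * N * p) := mul_le_mul_of_nonneg_left b1 hp.le
    have g2 : 0 < N * p := by positivity
    nlinarith
  have hpp : p ^ 2 ≤ p := by nlinarith
  have hm : |2 * (K : ℝ) * (p ^ 2 + IA) + 2 * (N - K : ℝ) * (p ^ 2 + IB) +
      p * d / √(1 - p ^ 2)| ≤ (2 * N + 10 * M * N ^ 2 + 20 * N ^ 2 + 10 * N) * p := by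
    have g1 : |2 * (K : ℝ) * (p ^ 2 + IA)| ≤ 2 * K * (p + 5 * M * N * p) := by
      rw [abs_mul, abs_of_pos (show (0 : ℝ) < 2 * K by linarith)]
      refine mul_le_mul_of_nonneg_left ((abs_add_le _ _).trans ?_) (by linarith)
      rw [abs_of_nonneg (sq_nonneg p)]
      linarith
    have g2 : |2 * (N - K : ℝ) * (p ^ 2 + IB)| ≤ 2 * (N - K : ℝ) * (p + 10 * N * p) := by
      rw [abs_mul, abs_of_nonneg (show (0 : ℝ) ≤ 2 * (N - K : ℝ) by linarith)]
      refine mul_le_mul_of_nonneg_left ((abs_add_le _ _).trans ?_) (by linarith)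
      rw [abs_of_nonneg (sq_nonneg p)]
      linarith
    refine ((abs_add_le _ _).trans (add_le_add_left (abs_add_le _ _) _)).trans ?_
    have g3 : 2 * (K : ℝ) * (5 * M * N * p) ≤ 2 * N * (5 * M * N * p) :=
      mul_le_mul_of_nonneg_right (by linarith) (by positivity)
    have g4 : 2 * (N - K : ℝ) * (10 * N * p) ≤ 2 * N * (10 * N * p) :=
      mul_le_mul_of_nonneg_right (by linarith) (by positivity)
    have g5 : 0 ≤ N * p := by positivity
    nlinarith
  rw [le_div_iff₀ hT0]
  have hC : 0 ≤ 2 * N + 10 * M * N ^ 2 + 20 * N ^ 2 + 10 * (N : ℝ) := by positivity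
  calc _ ≤ T * ((2 * N + 10 * M * N ^ 2 + 20 * N ^ 2 + 10 * N) * p) * T := by
        gcongr
    _ = (2 * N + 10 * M * N ^ 2 + 20 * N ^ 2 + 10 * N) * (p * T ^ 2) := by ring
    _ ≤ (2 * N + 10 * M * N ^ 2 + 20 * N ^ 2 + 10 * N) * (12 / 5) :=
        mul_le_mul_of_nonneg_left hpT hC
    _ ≤ _ := by linarith

/-- Peaks: the amplitude is within `O(p²)` of `1`, so each half-loop has mass close to `1`. A low
half-loop has mass at most `T p²`, and the half-line has at most `p²`. -/
theorem exists_scaledMass_close (N : ℕ) : ∃ T₁ : ℝ, ∀ K : ℕ, 1 ≤ K → K ≤ N → ∀ T, T₁ ≤ T →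
    |scaledMass N K T - 2 * K| ≤ 1 / 2 := by
  obtain ⟨δ, hδ, L, hL⟩ := exists_sqMass_close (ε := 1 / (8 * (N + 1))) (by positivity)
  set X : ℝ := 12 / 5 * (N ^ 2 + 2) / δ + 48 * (N + 1) + 6 with hX
  have hX0 : 0 ≤ 12 / 5 * (N ^ 2 + 2) / δ := by positivity
  have hN0 : (0 : ℝ) ≤ N := by positivity
  refine ⟨max (max L lengthBound) X, fun K hK hKN T hT => ?_⟩
  have hKr : (1 : ℝ) ≤ K := by exact_mod_cast hK
  have hNK : (K : ℝ) ≤ N := by exact_mod_cast hKN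
  have hTL : L ≤ T := (le_max_left _ _).trans ((le_max_left _ _).trans hT)
  have hTB : lengthBound ≤ T := (le_max_right _ _).trans ((le_max_left _ _).trans hT)
  have hTX : X ≤ T := (le_max_right _ _).trans hT
  have hT6 : 6 ≤ T := by linarith
  have h := isAmpPair_ampPair hK hKN hTB
  have hp := h.prof_pos
  have hpl := h.prof_lt
  have hpT := h.vertex_value_le hK hKN hT6
  have hac := h.amp_close hK hKN
  have hb0 := h.2.1.sqMass_nonneg
  have hb1 := h.2.1.sqMass_le
  rw [← h.2.2.1] at hb1
  have hs := hL T _ hTL h.1 hp (h.profD_neg hK hKN).le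
  unfold scaledMass
  set p := prof T (ampPair N K T).1 with hpd
  set a := (ampPair N K T).1
  set b := (ampPair N K T).2
  have hT0 : 0 < T := by linarith
  have hpT1 : p * T ≤ 12 / 5 / T := by
    rw [le_div_iff₀ hT0]
    linarith
  have hsmall : 12 / 5 / T ≤ 1 / (20 * (N + 1)) := by
    rw [div_le_div_iff₀ hT0 (by positivity)]
    linarith
  have hone : 1 / (20 * ((N : ℝ) + 1)) ≤ 1 := by
    rw [div_le_one (by positivity)]
    linarith
  have hpT2 : T * p ^ 2 ≤ 1 / (20 * (N + 1)) := by
    have : T * p ^ 2 = p * T * p := by ring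
    nlinarith [mul_pos hp hT0]
  have hp2 : p ^ 2 ≤ 1 / 20 := by
    have h1 : 1 / (20 * ((N : ℝ) + 1)) ≤ 1 / 20 := by
      apply one_div_le_one_div_of_le <;> linarith
    have h2 : p ^ 2 ≤ T * p ^ 2 := by nlinarith [sq_nonneg p]
    linarith
  have hclose : |a - 1| < δ := by
    refine lt_of_le_of_lt hac ?_
    have h1 : (N ^ 2 + 2 : ℝ) * p ^ 2 ≤ (N ^ 2 + 2) * p := by
      have : (0 : ℝ) ≤ N ^ 2 + 2 := by positivity
      exact mul_le_mul_of_nonneg_left (by nlinarith) this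
    have h2 : p * X ≤ 12 / 5 := by nlinarith
    have h3 : (12 / 5 * (N ^ 2 + 2) / δ) * p < 12 / 5 := by nlinarith
    have h4 : 12 / 5 * (N ^ 2 + 2) * p < 12 / 5 * δ := by
      have : (12 / 5 * (N ^ 2 + 2) / δ) * p = 12 / 5 * (N ^ 2 + 2) * p / δ := by ring
      rw [this, div_lt_iff₀ hδ] at h3
      exact h3
    linarith
  have hs' := hs hclose
  have hroot : 1 - p ^ 2 ≤ √(1 - p ^ 2) := by
    refine Real.le_sqrt_of_sq_le ?_
    nlinarith [sq_nonneg p]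
  have hroot1 : √(1 - p ^ 2) ≤ 1 := Real.sqrt_le_one.2 (by nlinarith [sq_nonneg p])
  have e1 : |2 * (K : ℝ) * (sqMass T a - 1)| ≤ 1 / 4 := by
    rw [abs_mul, abs_of_pos (show (0 : ℝ) < 2 * K by linarith)]
    calc 2 * (K : ℝ) * |sqMass T a - 1| ≤ 2 * (N + 1) * (1 / (8 * (N + 1))) :=
          mul_le_mul (by linarith) hs' (abs_nonneg _) (by positivity)
      _ = 1 / 4 := by field_simp; norm_num
  have e2 : 2 * (N - K : ℝ) * sqMass T b ≤ 1 / 10 := by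
    calc 2 * (N - K : ℝ) * sqMass T b ≤ 2 * (N + 1) * (1 / (20 * (N + 1))) :=
          mul_le_mul (by linarith) (hb1.trans hpT2) hb0 (by positivity)
      _ = 1 / 10 := by field_simp; norm_num
  have e3 : 0 ≤ 2 * (N - K : ℝ) * sqMass T b := mul_nonneg (by linarith) hb0
  rw [abs_le] at e1 ⊢
  constructor <;> linarith

end ScaledMass

/-! ### `C¹` curves in `L²` -/

section SquareIntegrable

variable {s : Set ℝ}

theorem toL2_of_memLp {f : ℝ → ℝ} (h : MemLp f 2 (volume.restrict s)) : toL2 s f = h.toLp f :=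
  dif_pos h

theorem toL2_congr (hs : MeasurableSet s) {f g : ℝ → ℝ} (h : EqOn f g s) :
    toL2 s f = toL2 s g := by
  have hae : f =ᵐ[volume.restrict s] g := (ae_restrict_iff' hs).2 (Eventually.of_forall h)
  by_cases hf : MemLp f 2 (volume.restrict s)
  · have hg := hf.ae_eq hae
    rw [toL2_of_memLp hf, toL2_of_memLp hg]
    exact MemLp.toLp_congr hf hg hae
  · have hg : ¬ MemLp g 2 (volume.restrict s) := fun hg => hf (hg.ae_eq hae.symm)
    rw [toL2, toL2, dif_neg hf, dif_neg hg]

theorem memLp_of_abs_le (hs : MeasurableSet s) {f B : ℝ → ℝ} (hB : MemLp B 2 (volume.restrict s))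
    (hf : AEStronglyMeasurable f (volume.restrict s)) (h : ∀ x ∈ s, |f x| ≤ B x) :
    MemLp f 2 (volume.restrict s) :=
  hB.mono' hf ((ae_restrict_iff' hs).2 (Eventually.of_forall h))

/-- Dominated convergence for the squared difference, with majorant `(2B)²`. -/
theorem tendsto_toL2 {ι : Type*} {l : Filter ι} [l.IsCountablyGenerated] [l.NeBot]
    (hs : MeasurableSet s) {F : ι → ℝ → ℝ} {G B : ℝ → ℝ}
    (hF : ∀ᶠ i in l, AEStronglyMeasurable (F i) (volume.restrict s))
    (hG : AEStronglyMeasurable G (volume.restrict s)) (hB : MemLp B 2 (volume.restrict s))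
    (hb : ∀ᶠ i in l, ∀ x ∈ s, |F i x| ≤ B x)
    (hlim : ∀ x ∈ s, Tendsto (fun i => F i x) l (𝓝 (G x))) :
    Tendsto (fun i => toL2 s (F i)) l (𝓝 (toL2 s G)) := by
  have hGb : ∀ x ∈ s, |G x| ≤ B x := fun x hx =>
    le_of_tendsto (hlim x hx).abs (hb.mono fun i hi => hi x hx)
  have hGm : MemLp G 2 (volume.restrict s) := memLp_of_abs_le hs hB hG hGb
  have key : Tendsto (fun i => eLpNorm (F i - G) 2 (volume.restrict s)) l (𝓝 0) := by
    simp_rw [eLpNorm_eq_lintegral_rpow_enorm_toReal two_ne_zero ENNReal.ofNat_ne_top]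
    have h1 : Tendsto (fun i => ∫⁻ x in s, ‖(F i - G) x‖ₑ ^ (2 : ENNReal).toReal) l
        (𝓝 (∫⁻ _ in s, 0)) := by
      refine tendsto_lintegral_filter_of_dominated_convergence'
        (fun x => ‖2 * B x‖ₑ ^ (2 : ENNReal).toReal)
        (hF.mono fun i hi => (hi.sub hG).enorm.pow_const _) ?_ ?_ ?_
      · filter_upwards [hb] with i hi
        refine (ae_restrict_iff' hs).2 (Eventually.of_forall fun x hx => ?_)
        refine ENNReal.rpow_le_rpow ?_ (by simp)
        rw [Real.enorm_eq_ofReal_abs, Real.enorm_eq_ofReal_abs]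
        refine ENNReal.ofReal_le_ofReal ?_
        refine le_trans ((abs_sub (F i x) (G x)).trans ?_) (le_abs_self _)
        linarith [hi x hx, hGb x hx]
      · exact (lintegral_rpow_enorm_lt_top_of_eLpNorm_lt_top two_ne_zero ENNReal.ofNat_ne_top
          (hB.const_mul 2).2).ne
      · refine (ae_restrict_iff' hs).2 (Eventually.of_forall fun x hx => ?_)
        have h2 : Tendsto (fun i => (F i - G) x) l (𝓝 0) := by
          simpa using (hlim x hx).sub_const (G x)
        have h3 := ((ENNReal.continuous_rpow_const (y := (2 : ENNReal).toReal)).tendsto _).comp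
          h2.enorm
        simpa [Function.comp_def] using h3
    have h4 := ((ENNReal.continuous_rpow_const (y := 1 / (2 : ENNReal).toReal)).tendsto _).comp h1
    simpa [Function.comp_def] using h4
  rw [Lp.tendsto_Lp_iff_tendsto_eLpNorm']
  refine key.congr' ?_
  filter_upwards [hb, hF] with i hi hFi
  have hFm : MemLp (F i) 2 (volume.restrict s) := memLp_of_abs_le hs hB hFi hi
  rw [toL2_of_memLp hFm, toL2_of_memLp hGm]
  exact eLpNorm_congr_ae (hFm.coeFn_toLp.sub hGm.coeFn_toLp).symm

theorem toL2_slope {f₁ f₀ : ℝ → ℝ} (h₁ : MemLp f₁ 2 (volume.restrict s))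
    (h₀ : MemLp f₀ 2 (volume.restrict s)) (c : ℝ) :
    toL2 s (fun x => c * (f₁ x - f₀ x)) = c • (toL2 s f₁ - toL2 s f₀) := by
  have h : MemLp (fun x => c * (f₁ x - f₀ x)) 2 (volume.restrict s) := (h₁.sub h₀).const_mul c
  rw [toL2_of_memLp h, toL2_of_memLp h₁, toL2_of_memLp h₀, ← MemLp.toLp_sub,
    ← MemLp.toLp_const_smul]
  rfl

/-- A family of functions that is `C¹` in the parameter, with locally dominated derivative, is a
`C¹` curve in `L²`. -/
theorem contDiffOn_toL2 {U : Set ℝ} (hU : IsOpen U) (hs : MeasurableSet s) {F : ℝ × ℝ → ℝ}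
    (hF : ContDiffOn ℝ 1 F (U ×ˢ univ))
    (hdom : ∀ w₀ ∈ U, ∃ B : ℝ → ℝ, MemLp B 2 (volume.restrict s) ∧ ∀ᶠ w in 𝓝 w₀, ∀ x ∈ s,
      |F (w, x)| ≤ B x ∧ |deriv (fun v => F (v, x)) w| ≤ B x) :
    ContDiffOn ℝ 1 (fun w => toL2 s fun x => F (w, x)) U := by
  have hUo : IsOpen (U ×ˢ (univ : Set ℝ)) := hU.prod isOpen_univ
  have hFd : ∀ w ∈ U, ∀ x, HasFDerivAt F (fderiv ℝ F (w, x)) (w, x) := fun w hw x =>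
    ((hF.differentiableOn (by simp)).differentiableAt
      (hUo.mem_nhds ⟨hw, mem_univ x⟩)).hasFDerivAt
  have hline : ∀ w x : ℝ, HasDerivAt (fun v : ℝ => (v, x)) ((1 : ℝ), (0 : ℝ)) w := fun w x =>
    (hasDerivAt_id w).prodMk (hasDerivAt_const w x)
  have hd : ∀ w ∈ U, ∀ x, HasDerivAt (fun v => F (v, x)) (fderiv ℝ F (w, x) (1, 0)) w :=
    fun w hw x => (hFd w hw x).comp_hasDerivAt w (hline w x)
  have hgc : ContinuousOn (fun q : ℝ × ℝ => fderiv ℝ F q (1, 0)) (U ×ˢ univ) :=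
    (hF.continuousOn_fderiv_of_isOpen hUo (by simp)).clm_apply continuousOn_const
  have hmeas : ∀ {f : ℝ × ℝ → ℝ}, ContinuousOn f (U ×ˢ univ) → ∀ w ∈ U,
      AEStronglyMeasurable (fun x => f (w, x)) (volume.restrict s) := by
    intro f hf w hw
    have : Continuous fun x => f (w, x) := by
      rw [← continuousOn_univ]
      exact hf.comp (Continuous.prodMk_right w).continuousOn fun x _ => ⟨hw, mem_univ x⟩
    exact this.aestronglyMeasurable
  set g : ℝ → ℝ → ℝ := fun w x => fderiv ℝ F (w, x) (1, 0) with hg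
  have hnhds : ∀ w ∈ U, ∀ᶠ v in 𝓝 w, v ∈ U := fun w hw => hU.mem_nhds hw
  have hmem : ∀ w ∈ U, MemLp (fun x => F (w, x)) 2 (volume.restrict s) := fun w hw => by
    obtain ⟨B, hB, hb⟩ := hdom w hw
    exact memLp_of_abs_le hs hB (hmeas hF.continuousOn w hw) fun x hx =>
      (hb.self_of_nhds x hx).1
  have hderiv : ∀ w ∈ U, HasDerivAt (fun v => toL2 s fun x => F (v, x)) (toL2 s (g w)) w := by
    intro w hw
    obtain ⟨B, hB, hb⟩ := hdom w hw
    obtain ⟨ε, hε, hball⟩ := Metric.eventually_nhds_iff_ball.1 (hb.and (hnhds w hw))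
    rw [hasDerivAt_iff_tendsto_slope]
    set S : ℝ → ℝ → ℝ := fun v x => (v - w)⁻¹ * (F (v, x) - F (w, x)) with hS
    have h1 : Tendsto (fun v => toL2 s (S v)) (𝓝[≠] w) (𝓝 (toL2 s (g w))) := by
      refine tendsto_toL2 hs ?_ (hmeas hgc w hw) hB ?_ ?_
      · filter_upwards [nhdsWithin_le_nhds (hnhds w hw)] with v hv
        exact ((hmeas hF.continuousOn v hv).sub (hmeas hF.continuousOn w hw)).const_mul _
      · filter_upwards [nhdsWithin_le_nhds (Metric.ball_mem_nhds w hε), self_mem_nhdsWithin]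
          with v hv hvw x hx
        have hvU := (hball v hv).2
        -- By the mean value inequality in the parameter, the difference quotient at `x` inherits
        -- the bound `B x` of the derivative.
        have hmv := (convex_ball w ε).norm_image_sub_le_of_norm_hasDerivWithin_le (C := B x)
          (f := fun u => F (u, x)) (f' := fun u => fderiv ℝ F (u, x) (1, 0))
          (fun u hu => (hd u (hball u hu).2 x).hasDerivWithinAt)
          (fun u hu => by
            have := ((hball u hu).1 x hx).2
            rwa [(hd u (hball u hu).2 x).deriv] at this)
          (Metric.mem_ball_self hε) hv
        have hne : 0 < |v - w| := abs_pos.2 (sub_ne_zero.2 hvw)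
        rw [abs_mul, abs_inv, inv_mul_le_iff₀ hne, mul_comm]
        exact hmv
      · intro x _
        exact hasDerivAt_iff_tendsto_slope.1 (hd w hw x)
    refine h1.congr' ?_
    filter_upwards [nhdsWithin_le_nhds (hnhds w hw)] with v hv
    rw [hS, toL2_slope (hmem v hv) (hmem w hw)]
    rfl
  have hcont : ∀ w ∈ U, ContinuousAt (fun v => toL2 s (g v)) w := by
    intro w hw
    obtain ⟨B, hB, hb⟩ := hdom w hw
    refine tendsto_toL2 hs ((hnhds w hw).mono fun v hv => hmeas hgc v hv) (hmeas hgc w hw) hB ?_ ?_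
    · filter_upwards [hb, hnhds w hw] with v hv hvU x hx
      have := (hv x hx).2
      rwa [(hd v hvU x).deriv] at this
    · intro x _
      exact ContinuousAt.comp (g := fun q : ℝ × ℝ => fderiv ℝ F q (1, 0)) (f := fun v => (v, x))
        (hgc.continuousAt (hUo.mem_nhds ⟨hw, mem_univ x⟩)) (hline w x).continuousAt
  rw [show (1 : WithTop ℕ∞) = 0 + 1 by simp, contDiffOn_succ_iff_deriv_of_isOpen hU]
  refine ⟨fun w hw => (hderiv w hw).differentiableAt.differentiableWithinAt, by simp, ?_⟩
  rw [contDiffOn_zero]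
  exact ContinuousOn.congr (fun w hw => (hcont w hw).continuousWithinAt)
    fun w hw => (hderiv w hw).deriv

theorem memLp_const_loopEdge (c : ℝ) : MemLp (fun _ : ℝ => c) 2 (volume.restrict loopEdge) :=
  memLp_const c

theorem contDiffOn_toL2_loopEdge {U : Set ℝ} (hU : IsOpen U) {F : ℝ × ℝ → ℝ}
    (hF : ContDiffOn ℝ 1 F (U ×ˢ univ)) :
    ContDiffOn ℝ 1 (fun w => toL2 loopEdge fun x => F (w, x)) U := by
  refine contDiffOn_toL2 hU measurableSet_Icc hF fun w₀ hw₀ => ?_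
  have hUo : IsOpen (U ×ˢ (univ : Set ℝ)) := hU.prod isOpen_univ
  obtain ⟨ε, hε, hball⟩ := Metric.nhds_basis_closedBall.mem_iff.1 (hU.mem_nhds hw₀)
  have hK : IsCompact (Metric.closedBall w₀ ε ×ˢ loopEdge) :=
    (isCompact_closedBall w₀ ε).prod isCompact_Icc
  have hsub : Metric.closedBall w₀ ε ×ˢ loopEdge ⊆ U ×ˢ univ := prod_mono hball (subset_univ _)
  have hgc : ContinuousOn (fun q : ℝ × ℝ => fderiv ℝ F q (1, 0)) (U ×ˢ univ) :=
    (hF.continuousOn_fderiv_of_isOpen hUo (by simp)).clm_apply continuousOn_const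
  obtain ⟨M₁, hM₁⟩ := hK.exists_bound_of_continuousOn (hF.continuousOn.mono hsub)
  obtain ⟨M₂, hM₂⟩ := hK.exists_bound_of_continuousOn (hgc.mono hsub)
  refine ⟨fun _ => max M₁ M₂, memLp_const_loopEdge _, ?_⟩
  filter_upwards [Metric.closedBall_mem_nhds w₀ hε] with w hw x hx
  refine ⟨(hM₁ (w, x) ⟨hw, hx⟩).trans (le_max_left _ _), ?_⟩
  have hd : HasDerivAt (fun v => F (v, x)) (fderiv ℝ F (w, x) (1, 0)) w :=
    ((hF.differentiableOn (by simp)).differentiableAt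
      (hUo.mem_nhds ⟨hball hw, mem_univ x⟩)).hasFDerivAt.comp_hasDerivAt w
      ((hasDerivAt_id w).prodMk (hasDerivAt_const w x))
  rw [hd.deriv]
  exact (hM₂ (w, x) ⟨hw, hx⟩).trans (le_max_right _ _)

theorem memLp_exp_rayEdge {δ : ℝ} (hδ : 0 < δ) (M : ℝ) :
    MemLp (fun x => M * Real.exp (-δ * x)) 2 (volume.restrict rayEdge) := by
  refine MemLp.const_mul ?_ M
  have hc : Continuous fun x : ℝ => Real.exp (-δ * x) := by fun_prop
  rw [memLp_two_iff_integrable_sq hc.aestronglyMeasurable]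
  have h : (fun x : ℝ => Real.exp (-δ * x) ^ 2) = fun x => Real.exp (-(2 * δ) * x) := by
    funext x
    rw [← Real.exp_nat_mul]
    congr 1
    push_cast
    ring
  rw [h]
  exact (integrableOn_Ici_iff_integrableOn_Ioi (by simp)).2 (exp_neg_integrableOn_Ioi 0 (by linarith))

end SquareIntegrable

/-! ### Sobolev regularity and jets of smooth functions on an edge -/

section Edges

variable {s : Set ℝ}

theorem uniqueDiffOn_loopEdge : UniqueDiffOn ℝ loopEdge :=
  uniqueDiffOn_Icc (by linarith [Real.pi_pos])

theorem uniqueDiffOn_rayEdge : UniqueDiffOn ℝ rayEdge := uniqueDiffOn_Ici 0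

theorem d1_eqOn (hs : UniqueDiffOn ℝ s) {f f' : ℝ → ℝ} (h : ∀ x, HasDerivAt f (f' x) x) :
    EqOn (d1 s f) f' s := fun x hx => (h x).hasDerivWithinAt.derivWithin (hs x hx)

theorem d2_eqOn (hs : UniqueDiffOn ℝ s) {f f' f'' : ℝ → ℝ} (h : ∀ x, HasDerivAt f (f' x) x)
    (h' : ∀ x, HasDerivAt f' (f'' x) x) : EqOn (d2 s f) f'' s := fun x hx => by
  change derivWithin (d1 s f) s x = _
  rw [derivWithin_congr (d1_eqOn hs h) (d1_eqOn hs h hx)]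
  exact (h' x).hasDerivWithinAt.derivWithin (hs x hx)

theorem memLp_congr_on (hs : MeasurableSet s) {f g : ℝ → ℝ} (h : EqOn f g s)
    (hg : MemLp g 2 (volume.restrict s)) : MemLp f 2 (volume.restrict s) :=
  hg.ae_eq ((ae_restrict_iff' hs).2 (Eventually.of_forall fun _ hx => (h hx).symm))

theorem memH2_of_hasDerivAt (hs : UniqueDiffOn ℝ s) (hm : MeasurableSet s) (hc : s.OrdConnected)
    {f f' f'' : ℝ → ℝ} (h : ∀ x, HasDerivAt f (f' x) x) (h' : ∀ x, HasDerivAt f' (f'' x) x)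
    (hcont : Continuous f'') (m : MemLp f 2 (volume.restrict s))
    (m' : MemLp f' 2 (volume.restrict s)) (m'' : MemLp f'' 2 (volume.restrict s)) :
    MemH2 s f := by
  refine ⟨fun x _ => (h x).differentiableAt.differentiableWithinAt, fun a ha b hb => ?_, m,
    memLp_congr_on hm (d1_eqOn hs h) m', memLp_congr_on hm (d2_eqOn hs h h') m''⟩
  have hC : ContDiff ℝ 1 f' := by
    rw [contDiff_one_iff_deriv]
    refine ⟨fun x => (h' x).differentiableAt, ?_⟩
    rw [show deriv f' = f'' from funext fun x => (h' x).deriv]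
    exact hcont
  exact ContDiffOn.absolutelyContinuousOnInterval
    (hC.contDiffOn.congr fun x hx => d1_eqOn hs h (hc.uIcc_subset ha hb hx))

theorem edgeJet_eq (hs : UniqueDiffOn ℝ s) (hm : MeasurableSet s) {f f' f'' : ℝ → ℝ}
    (h : ∀ x, HasDerivAt f (f' x) x) (h' : ∀ x, HasDerivAt f' (f'' x) x) :
    edgeJet s f = WithLp.toLp 2 ![toL2 s f, toL2 s f', toL2 s f''] := by
  unfold edgeJet
  rw [toL2_congr hm (d1_eqOn hs h), toL2_congr hm (d2_eqOn hs h h')]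

theorem memLp_loopEdge_of_continuous {f : ℝ → ℝ} (hf : Continuous f) :
    MemLp f 2 (volume.restrict loopEdge) := by
  obtain ⟨M, hM⟩ := isCompact_Icc.exists_bound_of_continuousOn (s := loopEdge) hf.continuousOn
  exact memLp_of_abs_le measurableSet_Icc (memLp_const_loopEdge M) hf.aestronglyMeasurable hM

end Edges

/-! ### Rescaled and shifted profiles -/

section Waves

/-- The force of the pendulum equation, `prof'' = force`. -/
noncomputable def force (t a : ℝ) : ℝ := prof t a - 2 * prof t a ^ 3

theorem contDiff_force : ContDiff ℝ (⊤ : ℕ∞) fun q : ℝ × ℝ => force q.1 q.2 :=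
  contDiff_prof.sub (contDiff_const.mul (contDiff_prof.pow 3))

theorem hasDerivAt_force (t a : ℝ) :
    HasDerivAt (fun s => force s a) (profD t a * (1 - 6 * prof t a ^ 2)) t := by
  have h := (hasDerivAt_prof t a).sub (((hasDerivAt_prof t a).pow 3).const_mul 2)
  exact h.congr_deriv (by push_cast; ring)

/-- All components of the states, and their derivatives, have the form `k * H (l * x + c) a`. Loops
are the case `c = 0`, whence the `+ 0` in later formulas; the half-line is the case `a = 1`. -/
theorem hasDerivAt_wave {H : ℝ → ℝ → ℝ} {H' : ℝ → ℝ → ℝ} {a : ℝ}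
    (h : ∀ t, HasDerivAt (fun s => H s a) (H' t a) t) (k l c x : ℝ) :
    HasDerivAt (fun y => k * H (l * y + c) a) (k * l * H' (l * x + c) a) x := by
  have h1 : HasDerivAt (fun y => l * y + c) l x := by
    simpa using ((hasDerivAt_id x).const_mul l).add_const c
  have h2 : HasDerivAt (fun y => H (l * y + c) a) (H' (l * x + c) a * l) x :=
    HasDerivAt.comp (h₂ := fun s => H s a) x (h (l * x + c)) h1
  exact (h2.const_mul k).congr_deriv (by ring)

theorem hasDerivAt_wave_prof (l c a x : ℝ) :
    HasDerivAt (fun y => l * prof (l * y + c) a) (l ^ 2 * profD (l * x + c) a) x :=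
  (hasDerivAt_wave (fun t => hasDerivAt_prof t a) l l c x).congr_deriv (by ring)

theorem hasDerivAt_wave_profD (l c a x : ℝ) :
    HasDerivAt (fun y => l ^ 2 * profD (l * y + c) a) (l ^ 3 * force (l * x + c) a) x :=
  (hasDerivAt_wave (H' := force) (fun t => hasDerivAt_profD t a) (l ^ 2) l c x).congr_deriv
    (by ring)

theorem continuous_wave {H : ℝ → ℝ → ℝ} (hH : ContDiff ℝ (⊤ : ℕ∞) fun q : ℝ × ℝ => H q.1 q.2)
    (k l c a : ℝ) : Continuous fun x => k * H (l * x + c) a :=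
  continuous_const.mul (hH.continuous.comp (by fun_prop : Continuous fun x : ℝ => (l * x + c, a)))

theorem contDiffOn_wave {U : Set ℝ} {H : ℝ → ℝ → ℝ}
    (hH : ContDiff ℝ (⊤ : ℕ∞) fun q : ℝ × ℝ => H q.1 q.2) {k l c a : ℝ → ℝ}
    (hk : ContDiffOn ℝ 1 k U) (hl : ContDiffOn ℝ 1 l U) (hc : ContDiffOn ℝ 1 c U)
    (ha : ContDiffOn ℝ 1 a U) : ContDiffOn ℝ 1
      (fun q : ℝ × ℝ => k q.1 * H (l q.1 * q.2 + c q.1) (a q.1)) (U ×ˢ univ) := by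
  have lift : ∀ {f : ℝ → ℝ}, ContDiffOn ℝ 1 f U →
      ContDiffOn ℝ 1 (fun q : ℝ × ℝ => f q.1) (U ×ˢ univ) := fun hf =>
    hf.comp contDiffOn_fst fun q hq => hq.1
  have h1 : ContDiffOn ℝ 1 (fun q : ℝ × ℝ => (l q.1 * q.2 + c q.1, a q.1)) (U ×ˢ univ) :=
    (((lift hl).mul contDiffOn_snd).add (lift hc)).prodMk (lift ha)
  exact (lift hk).mul ((hH.of_le (by exact_mod_cast le_top)).comp_contDiffOn h1)

theorem contDiffOn_edgeJet_loop {U : Set ℝ} (hU : IsOpen U) {l c a : ℝ → ℝ}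
    (hl : ContDiffOn ℝ 1 l U) (hc : ContDiffOn ℝ 1 c U) (ha : ContDiffOn ℝ 1 a U) :
    ContDiffOn ℝ 1 (fun w => edgeJet loopEdge fun x => l w * prof (l w * x + c w) (a w)) U := by
  have e : ∀ w, (edgeJet loopEdge fun x => l w * prof (l w * x + c w) (a w)) = _ := fun w =>
    edgeJet_eq uniqueDiffOn_loopEdge measurableSet_Icc (hasDerivAt_wave_prof (l w) (c w) (a w))
      (hasDerivAt_wave_profD (l w) (c w) (a w))
  simp_rw [e]
  refine contDiffOn_piLp' 2 fun i => ?_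
  fin_cases i
  · exact contDiffOn_toL2_loopEdge hU (contDiffOn_wave contDiff_prof hl hl hc ha)
  · exact contDiffOn_toL2_loopEdge hU (contDiffOn_wave contDiff_profD (hl.pow 2) hl hc ha)
  · exact contDiffOn_toL2_loopEdge hU (contDiffOn_wave contDiff_force (hl.pow 3) hl hc ha)

end Waves

/-! ### Decay and smooth dependence on the half-line -/

section Ray

theorem soliton_pos {y : ℝ} (hy : 0 ≤ y) : 0 < prof y 1 := by
  rw [(prof_one hy).1]
  exact inv_pos.2 (Real.cosh_pos y)

theorem soliton_le_one {y : ℝ} (hy : 0 ≤ y) : prof y 1 ≤ 1 := by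
  rw [(prof_one hy).1]
  exact inv_le_one_of_one_le₀ (Real.one_le_cosh y)

theorem soliton_le_exp {y : ℝ} (hy : 0 ≤ y) : prof y 1 ≤ 2 * Real.exp (-y) := by
  rw [(prof_one hy).1, inv_le_iff_one_le_mul₀ (Real.cosh_pos y), Real.cosh_eq]
  have h : Real.exp (-y) * Real.exp y = 1 := by rw [← Real.exp_add]; simp
  nlinarith [sq_nonneg (Real.exp (-y))]

theorem abs_profD_one_le {y : ℝ} (hy : 0 ≤ y) : |profD y 1| ≤ prof y 1 := by
  have h := prof_energy y 1
  refine abs_le_of_sq_le_sq ?_ (soliton_pos hy).le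
  nlinarith [sq_nonneg (prof y 1 ^ 2)]

theorem abs_force_one_le {y : ℝ} (hy : 0 ≤ y) : |force y 1| ≤ prof y 1 := by
  have h0 := soliton_pos hy
  have h1 := soliton_le_one hy
  have h2 : prof y 1 ^ 2 ≤ 1 := by nlinarith
  have h3 : prof y 1 ^ 3 = prof y 1 ^ 2 * prof y 1 := by ring
  rw [force, h3, abs_le]
  constructor <;> nlinarith [sq_nonneg (prof y 1)]

theorem abs_deriv_force_one_le {y : ℝ} (hy : 0 ≤ y) :
    |profD y 1 * (1 - 6 * prof y 1 ^ 2)| ≤ 7 * prof y 1 := by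
  have h0 := soliton_pos hy
  have h1 := soliton_le_one hy
  have h2 : |1 - 6 * prof y 1 ^ 2| ≤ 7 := by
    have : prof y 1 ^ 2 ≤ 1 := by nlinarith
    rw [abs_le]
    constructor <;> nlinarith [sq_nonneg (prof y 1)]
  rw [abs_mul]
  have := abs_profD_one_le hy
  calc _ ≤ prof y 1 * 7 := mul_le_mul this h2 (abs_nonneg _) h0.le
    _ = _ := by ring

theorem soliton_strictAntiOn : StrictAntiOn (fun y => prof y 1) (Ici 0) := by
  intro x hx y hy hxy
  simp only
  rw [(prof_one hx).1, (prof_one hy).1]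
  refine inv_strictAnti₀ (Real.cosh_pos x) (Real.cosh_lt_cosh.2 ?_)
  rwa [abs_of_nonneg hx, abs_of_nonneg hy]

theorem memLp_ray_wave {H : ℝ → ℝ → ℝ} (hH : ContDiff ℝ (⊤ : ℕ∞) fun q : ℝ × ℝ => H q.1 q.2)
    (hb : ∀ y, 0 ≤ y → |H y 1| ≤ prof y 1) {l c : ℝ} (hl : 0 < l) (hc : 0 ≤ c) (k : ℝ) :
    MemLp (fun x => k * H (l * x + c) 1) 2 (volume.restrict rayEdge) := by
  refine memLp_of_abs_le measurableSet_Ici (memLp_exp_rayEdge hl (|k| * 2))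
    (continuous_wave hH k l c 1).aestronglyMeasurable fun x hx => ?_
  have hx0 : 0 ≤ x := hx
  have hy : 0 ≤ l * x + c := by positivity
  rw [abs_mul, mul_assoc]
  refine mul_le_mul_of_nonneg_left ((hb _ hy).trans ((soliton_le_exp hy).trans ?_)) (abs_nonneg k)
  have : Real.exp (-(l * x + c)) ≤ Real.exp (-l * x) := Real.exp_le_exp.2 (by linarith)
  linarith

/-- On an unbounded edge the parameter derivative contains the factor `deriv l w * x`. Exponential
decay of the soliton absorbs it at the cost of half the decay rate. -/
theorem contDiffOn_toL2_rayEdge {U : Set ℝ} (hU : IsOpen U) {H H' : ℝ → ℝ → ℝ}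
    (hH : ContDiff ℝ (⊤ : ℕ∞) fun q : ℝ × ℝ => H q.1 q.2)
    (hd : ∀ t, HasDerivAt (fun s => H s 1) (H' t 1) t) (hb : ∀ y, 0 ≤ y → |H y 1| ≤ prof y 1)
    (hb' : ∀ y, 0 ≤ y → |H' y 1| ≤ 7 * prof y 1) {k l c : ℝ → ℝ} (hk : ContDiffOn ℝ 1 k U)
    (hl : ContDiffOn ℝ 1 l U) (hc : ContDiffOn ℝ 1 c U) (hl0 : ∀ w ∈ U, 0 < l w)
    (hc0 : ∀ w ∈ U, 0 ≤ c w) :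
    ContDiffOn ℝ 1 (fun w => toL2 rayEdge fun x => k w * H (l w * x + c w) 1) U := by
  refine contDiffOn_toL2 hU measurableSet_Ici
    (contDiffOn_wave hH hk hl hc (a := fun _ => 1) contDiffOn_const) fun w₀ hw₀ => ?_
  have hdiff : ∀ {f : ℝ → ℝ}, ContDiffOn ℝ 1 f U → ∀ w ∈ U, HasDerivAt f (deriv f w) w :=
    fun hf w hw => ((hf.differentiableOn (by simp)).differentiableAt (hU.mem_nhds hw)).hasDerivAt
  have hbd : ∀ {f : ℝ → ℝ}, ContDiffOn ℝ 1 f U →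
      ∀ᶠ w in 𝓝 w₀, |f w| ≤ |f w₀| + |deriv f w₀| + 1 ∧ |deriv f w| ≤ |f w₀| + |deriv f w₀| + 1 := by
    intro f hf
    have c1 : ContinuousAt (fun w => |f w|) w₀ := (hdiff hf w₀ hw₀).continuousAt.abs
    have c2 : ContinuousAt (fun w => |deriv f w|) w₀ :=
      ((hf.continuousOn_deriv_of_isOpen hU (by simp)).continuousAt (hU.mem_nhds hw₀)).abs
    have n1 := abs_nonneg (f w₀)
    have n2 := abs_nonneg (deriv f w₀)
    exact (c1.eventually_le_const (by linarith)).and (c2.eventually_le_const (by linarith))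
  obtain ⟨M, hM0, hM⟩ : ∃ M : ℝ, 0 < M ∧ ∀ᶠ w in 𝓝 w₀, |k w| ≤ M ∧ |deriv k w| ≤ M ∧
      |deriv l w| ≤ M ∧ |deriv c w| ≤ M := by
    refine ⟨(|k w₀| + |deriv k w₀| + 1) + (|l w₀| + |deriv l w₀| + 1) +
      (|c w₀| + |deriv c w₀| + 1), by positivity, ?_⟩
    filter_upwards [hbd hk, hbd hl, hbd hc] with w h1 h2 h3
    have := abs_nonneg (k w)
    have := abs_nonneg (deriv l w)
    have := abs_nonneg (deriv c w)
    refine ⟨?_, ?_, ?_, ?_⟩ <;> linarith [h1.1, h1.2, h2.2, h3.2]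
  -- Half the rate at `w₀` is a lower bound for the rate at all nearby parameters.
  set δ := l w₀ / 2 with hδ
  have hδ0 : 0 < δ := half_pos (hl0 w₀ hw₀)
  have hlδ : ∀ᶠ w in 𝓝 w₀, δ ≤ l w :=
    (hdiff hl w₀ hw₀).continuousAt.eventually_const_le (half_lt_self (hl0 w₀ hw₀))
  refine ⟨fun x => (14 * (M + M * M + M * M * (2 / δ))) * Real.exp (-(δ / 2) * x),
    memLp_exp_rayEdge (half_pos hδ0) _, ?_⟩
  filter_upwards [hM, hlδ, hU.mem_nhds hw₀] with w hw hwl hwU x hx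
  have hx0 : 0 ≤ x := hx
  have hy : 0 ≤ l w * x + c w := by
    have := hl0 w hwU
    have := hc0 w hwU
    positivity
  obtain ⟨k1, k2, k3, k4⟩ := hw
  set E := Real.exp (-(δ / 2) * x) with hE
  have hE0 : 0 < E := Real.exp_pos _
  have hE1 : E ≤ 1 := Real.exp_le_one_iff.2 (by nlinarith)
  have hprof : prof (l w * x + c w) 1 ≤ 2 * (E * E) := by
    refine (soliton_le_exp hy).trans ?_
    rw [hE, ← Real.exp_add]
    have : Real.exp (-(l w * x + c w)) ≤ Real.exp (-(δ / 2) * x + -(δ / 2) * x) :=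
      Real.exp_le_exp.2 (by nlinarith [hc0 w hwU])
    linarith
  -- The profile is bounded by `2 E²`: one factor `E` absorbs the growth of `x`, the other remains
  -- as the majorant.
  have hxE : x * E ≤ 2 / δ := by
    have h1 : δ / 2 * x + 1 ≤ Real.exp (δ / 2 * x) := Real.add_one_le_exp _
    have h2 : Real.exp (δ / 2 * x) * E = 1 := by
      rw [hE, ← Real.exp_add]
      simp
    rw [le_div_iff₀ hδ0]
    nlinarith
  have hEE : E * E ≤ E := by nlinarith
  have hfac : 0 ≤ M * M * (2 / δ) := by positivity
  constructor
  · rw [abs_mul]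
    calc |k w| * |H (l w * x + c w) 1| ≤ M * (2 * E) :=
          mul_le_mul k1 ((hb _ hy).trans (hprof.trans (by linarith))) (abs_nonneg _) hM0.le
      _ ≤ _ := by nlinarith
  · have hder : HasDerivAt (fun v => k v * H (l v * x + c v) 1)
        (deriv k w * H (l w * x + c w) 1 +
          k w * (H' (l w * x + c w) 1 * (deriv l w * x + deriv c w))) w := by
      have h1 : HasDerivAt (fun v => l v * x + c v) (deriv l w * x + deriv c w) w :=
        ((hdiff hl w hwU).mul_const x).add (hdiff hc w hwU)
      have h2 : HasDerivAt (fun v => H (l v * x + c v) 1)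
          (H' (l w * x + c w) 1 * (deriv l w * x + deriv c w)) w :=
        HasDerivAt.comp (h₂ := fun s => H s 1) w (hd (l w * x + c w)) h1
      exact (hdiff hk w hwU).mul h2
    rw [hder.deriv]
    have g1 : |deriv k w * H (l w * x + c w) 1| ≤ M * (2 * E) := by
      rw [abs_mul]
      exact mul_le_mul k2 ((hb _ hy).trans (hprof.trans (by linarith))) (abs_nonneg _) hM0.le
    have g2 : |deriv l w * x + deriv c w| ≤ M * x + M := by
      refine (abs_add_le _ _).trans (add_le_add ?_ k4)
      rw [abs_mul, abs_of_nonneg hx0]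
      exact mul_le_mul_of_nonneg_right k3 hx0
    have g3 : |H' (l w * x + c w) 1| ≤ 14 * (E * E) := (hb' _ hy).trans (by linarith)
    have g4 : |k w * (H' (l w * x + c w) 1 * (deriv l w * x + deriv c w))| ≤
        M * (14 * (E * E) * (M * x + M)) := by
      rw [abs_mul, abs_mul]
      exact mul_le_mul k1 (mul_le_mul g3 g2 (abs_nonneg _) (by positivity)) (by positivity) hM0.le
    have g5 : E * E * (M * x + M) ≤ (M * (2 / δ) + M) * E := by
      have : E * E * (M * x + M) = (M * (x * E) + M * E) * E := by ring
      rw [this]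
      refine mul_le_mul_of_nonneg_right ?_ hE0.le
      nlinarith
    refine (abs_add_le _ _).trans ((add_le_add g1 g4).trans ?_)
    have g6 : M * (14 * (E * E) * (M * x + M)) ≤ M * (14 * ((M * (2 / δ) + M) * E)) := by
      rw [mul_assoc 14]
      exact mul_le_mul_of_nonneg_left (by linarith) hM0.le
    have g7 : 0 < M * E := by positivity
    nlinarith

theorem contDiffOn_edgeJet_ray {U : Set ℝ} (hU : IsOpen U) {l c : ℝ → ℝ}
    (hl : ContDiffOn ℝ 1 l U) (hc : ContDiffOn ℝ 1 c U) (hl0 : ∀ w ∈ U, 0 < l w)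
    (hc0 : ∀ w ∈ U, 0 ≤ c w) :
    ContDiffOn ℝ 1 (fun w => edgeJet rayEdge fun x => l w * prof (l w * x + c w) 1) U := by
  have e : ∀ w, (edgeJet rayEdge fun x => l w * prof (l w * x + c w) 1) = _ := fun w =>
    edgeJet_eq uniqueDiffOn_rayEdge measurableSet_Ici (hasDerivAt_wave_prof (l w) (c w) 1)
      (hasDerivAt_wave_profD (l w) (c w) 1)
  simp_rw [e]
  refine contDiffOn_piLp' 2 fun i => ?_
  fin_cases i
  · exact contDiffOn_toL2_rayEdge hU contDiff_prof (fun t => hasDerivAt_prof t 1)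
      (fun y hy => (abs_of_pos (soliton_pos hy)).le)
      (fun y hy => (abs_profD_one_le hy).trans (by linarith [soliton_pos hy])) hl hl hc hl0 hc0
  · exact contDiffOn_toL2_rayEdge hU contDiff_profD (H' := force) (fun t => hasDerivAt_profD t 1)
      (fun y hy => abs_profD_one_le hy)
      (fun y hy => (abs_force_one_le hy).trans (by linarith [soliton_pos hy])) (hl.pow 2) hl hc
      hl0 hc0
  · exact contDiffOn_toL2_rayEdge hU contDiff_force
      (H' := fun t a => profD t a * (1 - 6 * prof t a ^ 2)) (fun t => hasDerivAt_force t 1)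
      (fun y hy => abs_force_one_le hy) (fun y hy => abs_deriv_force_one_le hy) (hl.pow 3) hl hc
      hl0 hc0

end Ray

/-! ### Position of the vertex on the soliton -/

section RayShift

/-- The position on the soliton with value `p`. -/
noncomputable def rayShift (p : ℝ) : ℝ := Real.arsinh (√(1 - p ^ 2) / p)

variable {p : ℝ}

theorem rayShift_nonneg (hp : 0 < p) : 0 ≤ rayShift p :=
  Real.arsinh_nonneg_iff.2 (div_nonneg (Real.sqrt_nonneg _) hp.le)

theorem sinh_rayShift (p : ℝ) : Real.sinh (rayShift p) = √(1 - p ^ 2) / p := Real.sinh_arsinh _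

theorem cosh_rayShift (hp : 0 < p) (hp1 : p < 1) : Real.cosh (rayShift p) = p⁻¹ := by
  have h1 : 0 ≤ 1 - p ^ 2 := by nlinarith
  rw [rayShift, Real.cosh_arsinh, div_pow, Real.sq_sqrt h1]
  have : 1 + (1 - p ^ 2) / p ^ 2 = (p⁻¹) ^ 2 := by
    field_simp
    ring
  rw [this, Real.sqrt_sq (inv_pos.2 hp).le]

theorem prof_rayShift (hp : 0 < p) (hp1 : p < 1) : prof (rayShift p) 1 = p := by
  rw [(prof_one (rayShift_nonneg hp)).1, cosh_rayShift hp hp1, inv_inv]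

theorem profD_rayShift (hp : 0 < p) (hp1 : p < 1) :
    profD (rayShift p) 1 = -vertexSlope p := by
  rw [(prof_one (rayShift_nonneg hp)).2, cosh_rayShift hp hp1, sinh_rayShift, vertexSlope]
  field_simp

/-- The mass of the soliton beyond position `c` is `1 - tanh c`; this identity is why `1 - √(1 -
p²)` appears in `scaledMass`. -/
theorem tanh_rayShift (hp : 0 < p) (hp1 : p < 1) : Real.tanh (rayShift p) = √(1 - p ^ 2) := by
  rw [Real.tanh_eq_sinh_div_cosh, cosh_rayShift hp hp1, sinh_rayShift]
  field_simp

theorem contDiffAt_rayShift (hp : 0 < p) (hp1 : p < 1) : ContDiffAt ℝ 1 rayShift p := by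
  have h1 : 0 < 1 - p ^ 2 := by nlinarith
  unfold rayShift
  exact ((((contDiffAt_const.sub (contDiffAt_id.pow 2)).sqrt h1.ne').div contDiffAt_id hp.ne')).arsinh

end RayShift

/-! ### Even single-lobe functions on a loop -/

section Shape

variable {f : ℝ → ℝ}

theorem even_eq_abs (he : ∀ x ∈ loopEdge, f (-x) = f x) {x : ℝ} (hx : x ∈ loopEdge) :
    f x = f |x| := by
  rcases abs_cases x with ⟨h, -⟩ | ⟨h, -⟩ <;> rw [h]
  exact (he x hx).symm

theorem abs_mem_loop {x : ℝ} (hx : x ∈ loopEdge) : |x| ∈ Icc 0 Real.pi :=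
  ⟨abs_nonneg x, abs_le.2 hx⟩

theorem pi_mem_loop : Real.pi ∈ Icc 0 Real.pi := ⟨Real.pi_pos.le, le_rfl⟩

theorem zero_mem_loop : (0 : ℝ) ∈ Icc 0 Real.pi := ⟨le_rfl, Real.pi_pos.le⟩

theorem isSingleLobe_of_strictAntiOn (he : ∀ x ∈ loopEdge, f (-x) = f x)
    (hf : StrictAntiOn f (Icc 0 Real.pi)) : GraphFun.IsSingleLobe f := by
  have hπ := Real.pi_pos
  have hmin : ∀ x ∈ loopEdge, f Real.pi ≤ f x := fun x hx => by
    rw [even_eq_abs he hx]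
    exact hf.antitoneOn (abs_mem_loop hx) pi_mem_loop (abs_mem_loop hx).2
  refine Or.inl ⟨0, ⟨by linarith, hπ⟩, fun x hx hx0 => ?_, fun x hx => ?_, fun x hx => hmin x hx⟩
  · rw [even_eq_abs he hx]
    exact hf zero_mem_loop (abs_mem_loop hx) (abs_pos.2 hx0)
  · change f (-Real.pi) ≤ f x
    rw [he Real.pi ⟨by linarith, le_rfl⟩]
    exact hmin x hx

theorem isSingleLobe_of_strictMonoOn (he : ∀ x ∈ loopEdge, f (-x) = f x)
    (hf : StrictMonoOn f (Icc 0 Real.pi)) : GraphFun.IsSingleLobe f := by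
  have hπ := Real.pi_pos
  have hmax : ∀ x ∈ loopEdge, f x ≤ f Real.pi := fun x hx => by
    rw [even_eq_abs he hx]
    exact hf.monotoneOn (abs_mem_loop hx) pi_mem_loop (abs_mem_loop hx).2
  refine Or.inr ⟨0, ⟨by linarith, hπ⟩, fun x hx hx0 => ?_, fun x hx => ?_, fun x hx => hmax x hx⟩
  · rw [even_eq_abs he hx]
    exact hf zero_mem_loop (abs_mem_loop hx) (abs_pos.2 hx0)
  · change f x ≤ f (-Real.pi)
    rw [he Real.pi ⟨by linarith, le_rfl⟩]
    exact hmax x hx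

theorem amplitude_eq {x₀ : ℝ} (hx₀ : x₀ ∈ loopEdge) (hpos : 0 < f x₀)
    (h : ∀ x ∈ loopEdge, 0 < f x ∧ f x ≤ f x₀) : GraphFun.amplitude f = f x₀ := by
  refine IsGreatest.csSup_eq ⟨⟨x₀, hx₀, abs_of_pos hpos⟩, ?_⟩
  rintro y ⟨x, hx, rfl⟩
  simp only
  rw [abs_of_pos (h x hx).1]
  exact (h x hx).2

end Shape

/-! ### The state with `K` peaks and its mass -/

section SplitState

/-- The state with `K` peaks, at frequency `ω`. -/
noncomputable def splitState (N K : ℕ) (ω : ℝ) : GraphFun N where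
  loop j x := √(-ω) * prof (√(-ω) * x + 0) (if j.val < K then (ampPair N K (Real.pi * √(-ω))).1
    else (ampPair N K (Real.pi * √(-ω))).2)
  ray x := √(-ω) * prof (√(-ω) * x + rayShift (prof (Real.pi * √(-ω))
    (ampPair N K (Real.pi * √(-ω))).1)) 1

variable {N K : ℕ} {ω : ℝ}

theorem sum_ite_lt (hKN : K ≤ N) (x y : ℝ) :
    ∑ j : Fin N, (if j.val < K then x else y) = K * x + (N - K : ℝ) * y := by
  have h1 := Fin.sum_univ_eq_sum_range (fun i => if i < K then x else y) N
  rw [h1, Finset.sum_ite]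
  have h2 : (Finset.range N).filter (fun i => i < K) = Finset.range K := by
    ext i
    simp only [Finset.mem_filter, Finset.mem_range]
    omega
  have h3 : ((Finset.range N).filter (fun i => ¬ i < K)).card = N - K := by
    have := Finset.card_filter_add_card_filter_not (s := Finset.range N) (fun i => i < K)
    rw [h2, Finset.card_range, Finset.card_range] at this
    omega
  rw [h2, Finset.sum_const, Finset.sum_const, h3, Finset.card_range, nsmul_eq_mul, nsmul_eq_mul,
    Nat.cast_sub hKN]

theorem hasDerivAt_loop_mass (l a x : ℝ) :
    HasDerivAt (fun x => l * sqMass (l * x + 0) a) ((l * prof (l * x + 0) a) ^ 2) x :=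
  (hasDerivAt_wave (H' := fun t a => prof t a ^ 2) (fun t => hasDerivAt_sqMass t a) l l 0
    x).congr_deriv (by ring)

theorem sqMass_neg (t a : ℝ) : sqMass (-t) a = -sqMass t a := by
  have h := intervalIntegral.integral_comp_neg (a := 0) (b := t) (fun s => prof s a ^ 2)
  simp only [prof_neg, neg_zero] at h
  rw [sqMass, sqMass, intervalIntegral.integral_symm, ← h]

theorem integral_loop_wave (l a : ℝ) :
    ∫ x in loopEdge, (l * prof (l * x + 0) a) ^ 2 = l * (2 * sqMass (Real.pi * l) a) := by
  rw [integral_Icc_eq_integral_Ioc, ← intervalIntegral.integral_of_le (by linarith [Real.pi_pos]),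
    intervalIntegral.integral_eq_sub_of_hasDerivAt (fun x _ => hasDerivAt_loop_mass l a x)
      (((continuous_wave contDiff_prof l l 0 a).pow 2).intervalIntegrable _ _)]
  have e1 : l * -Real.pi + 0 = -(Real.pi * l) := by ring
  have e2 : l * Real.pi + 0 = Real.pi * l := by ring
  rw [e1, e2, sqMass_neg]
  ring

theorem tendsto_tanh_atTop : Tendsto Real.tanh atTop (𝓝 1) := by
  have h1 : Tendsto (fun x : ℝ => 1 / Real.cosh x ^ 2) atTop (𝓝 0) := by
    have h2 : Tendsto (fun x : ℝ => 1 / x) atTop (𝓝 0) := by simpa using tendsto_inv_atTop_zero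
    refine squeeze_zero' (Eventually.of_forall fun x => by positivity) ?_ h2
    filter_upwards [eventually_ge_atTop 1] with x hx
    have h3 := (Real.self_le_sinh_iff.2 (by linarith : 0 ≤ x)).trans (Real.sinh_lt_cosh x).le
    refine one_div_le_one_div_of_le (by linarith) ?_
    nlinarith
  have h4 : Tendsto (fun x => 1 - Real.tanh x) atTop (𝓝 0) := by
    refine squeeze_zero' ?_ ?_ h1
    · filter_upwards [eventually_ge_atTop 0] with x hx using (one_sub_tanh_le hx).1
    · filter_upwards [eventually_ge_atTop 0] with x hx using (one_sub_tanh_le hx).2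
  simpa using h4.const_sub 1

theorem integral_ray_wave {l c : ℝ} (hl : 0 < l) (hc : 0 ≤ c) :
    ∫ x in rayEdge, (l * prof (l * x + c) 1) ^ 2 = l * (1 - Real.tanh c) := by
  rw [integral_Ici_eq_integral_Ioi]
  have hd : ∀ x, HasDerivAt (fun x => l * sqMass (l * x + c) 1) ((l * prof (l * x + c) 1) ^ 2) x :=
    fun x => (hasDerivAt_wave (H' := fun t a => prof t a ^ 2) (fun t => hasDerivAt_sqMass t 1)
      l l c x).congr_deriv (by ring)
  have hint : IntegrableOn (fun x => (l * prof (l * x + c) 1) ^ 2) (Ioi 0) := by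
    have := (memLp_ray_wave contDiff_prof (fun y hy => (abs_of_pos (soliton_pos hy)).le) hl hc
      l).integrable_sq
    exact IntegrableOn.mono_set this Ioi_subset_Ici_self
  have hlim : Tendsto (fun x => l * sqMass (l * x + c) 1) atTop (𝓝 (l * 1)) := by
    have h1 : Tendsto (fun x => l * x + c) atTop atTop :=
      tendsto_atTop_add_const_right _ _ (tendsto_id.const_mul_atTop hl)
    refine ((tendsto_tanh_atTop.comp h1).const_mul l).congr' ?_
    filter_upwards [eventually_ge_atTop 0] with x hx
    rw [sqMass_one (by positivity)]
    rfl
  rw [integral_Ioi_of_hasDerivAt_of_tendsto (hd 0).continuousAt.continuousWithinAt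
    (fun x _ => hd x) hint hlim]
  rw [mul_zero, zero_add, sqMass_one hc]
  ring

/-- Frequencies with long rescaled loops are negative. -/
theorem lengthBound_sqrt_pos {ω : ℝ} (hω : lengthBound < Real.pi * √(-ω)) :
    0 < √(-ω) ∧ ω < 0 := by
  have h0 : 0 < Real.pi * √(-ω) := by linarith [three_lt_lengthBound]
  have h1 : 0 < √(-ω) := by
    rcases (Real.sqrt_nonneg (-ω)).lt_or_eq with h | h
    · exact h
    · rw [← h, mul_zero] at h0
      exact absurd h0 (lt_irrefl _)
  exact ⟨h1, by linarith [Real.sqrt_pos.1 h1]⟩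

theorem mass_splitState (hK : 1 ≤ K) (hKN : K ≤ N) (hω : lengthBound < Real.pi * √(-ω)) :
    (splitState N K ω).mass = √(-ω) * scaledMass N K (Real.pi * √(-ω)) := by
  obtain ⟨hl, -⟩ := lengthBound_sqrt_pos hω
  have h := isAmpPair_ampPair hK hKN hω.le
  have hp := h.prof_pos
  have hp1 : prof (Real.pi * √(-ω)) (ampPair N K (Real.pi * √(-ω))).1 < 1 := by
    linarith [h.prof_lt]
  unfold GraphFun.mass splitState scaledMass
  simp only
  rw [integral_ray_wave hl (rayShift_nonneg hp), tanh_rayShift hp hp1]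
  simp only [integral_loop_wave]
  have e : ∀ j : Fin N, √(-ω) * (2 * sqMass (Real.pi * √(-ω))
      (if j.val < K then (ampPair N K (Real.pi * √(-ω))).1
        else (ampPair N K (Real.pi * √(-ω))).2)) =
      if j.val < K then √(-ω) * (2 * sqMass (Real.pi * √(-ω)) (ampPair N K (Real.pi * √(-ω))).1)
      else √(-ω) * (2 * sqMass (Real.pi * √(-ω)) (ampPair N K (Real.pi * √(-ω))).2) := by
    intro j
    split_ifs <;> rfl
  simp only [e]
  rw [sum_ite_lt hKN]
  ring

end SplitState

/-! ### Verification that the split functions are states -/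

section IsState

variable {N K : ℕ} {ω : ℝ}

theorem wave_neg (l a x : ℝ) : l * prof (l * -x + 0) a = l * prof (l * x + 0) a := by
  rw [← prof_neg (l * x + 0)]
  congr 2
  ring

theorem memH2_loop_wave (l a : ℝ) : MemH2 loopEdge fun x => l * prof (l * x + 0) a :=
  memH2_of_hasDerivAt uniqueDiffOn_loopEdge measurableSet_Icc ordConnected_Icc
    (hasDerivAt_wave_prof l 0 a) (hasDerivAt_wave_profD l 0 a)
    (continuous_wave contDiff_force _ _ _ _)
    (memLp_loopEdge_of_continuous (continuous_wave contDiff_prof _ _ _ _))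
    (memLp_loopEdge_of_continuous (continuous_wave contDiff_profD _ _ _ _))
    (memLp_loopEdge_of_continuous (continuous_wave contDiff_force _ _ _ _))

theorem memH2_ray_wave {l c : ℝ} (hl : 0 < l) (hc : 0 ≤ c) :
    MemH2 rayEdge fun x => l * prof (l * x + c) 1 :=
  memH2_of_hasDerivAt uniqueDiffOn_rayEdge measurableSet_Ici ordConnected_Ici
    (hasDerivAt_wave_prof l c 1) (hasDerivAt_wave_profD l c 1)
    (continuous_wave contDiff_force _ _ _ _)
    (memLp_ray_wave contDiff_prof (fun _ hy => (abs_of_pos (soliton_pos hy)).le) hl hc _)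
    (memLp_ray_wave contDiff_profD (fun _ hy => abs_profD_one_le hy) hl hc _)
    (memLp_ray_wave contDiff_force (fun _ hy => abs_force_one_le hy) hl hc _)

theorem mul_mem_length {l x : ℝ} (hl : 0 < l) (hx : x ∈ Icc 0 Real.pi) :
    l * x + 0 ∈ Icc 0 (Real.pi * l) := by
  have h1 := mul_nonneg hl.le hx.1
  have h2 := mul_le_mul_of_nonneg_left hx.2 hl.le
  exact ⟨by linarith, by linarith⟩

theorem strictAntiOn_wave {l a : ℝ} (hl : 0 < l)
    (h : StrictAntiOn (fun t => prof t a) (Icc 0 (Real.pi * l))) :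
    StrictAntiOn (fun x => l * prof (l * x + 0) a) (Icc 0 Real.pi) := by
  intro x hx y hy hxy
  have := h (mul_mem_length hl hx) (mul_mem_length hl hy) (by nlinarith)
  exact mul_lt_mul_of_pos_left this hl

theorem strictMonoOn_wave {l a : ℝ} (hl : 0 < l)
    (h : StrictMonoOn (fun t => prof t a) (Icc 0 (Real.pi * l))) :
    StrictMonoOn (fun x => l * prof (l * x + 0) a) (Icc 0 Real.pi) := by
  intro x hx y hy hxy
  have := h (mul_mem_length hl hx) (mul_mem_length hl hy) (by nlinarith)
  exact mul_lt_mul_of_pos_left this hl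

theorem splitState_loop_even (j : Fin N) (x : ℝ) :
    (splitState N K ω).loop j (-x) = (splitState N K ω).loop j x := wave_neg _ _ _

theorem splitState_strictAntiOn (hK : 1 ≤ K) (hKN : K ≤ N) (hω : lengthBound < Real.pi * √(-ω))
    {j : Fin N} (hj : j.val < K) :
    StrictAntiOn ((splitState N K ω).loop j) (Icc 0 Real.pi) := by
  obtain ⟨hl, -⟩ := lengthBound_sqrt_pos hω
  have h := isAmpPair_ampPair hK hKN hω.le
  simp only [splitState, if_pos hj]
  exact strictAntiOn_wave hl (h.1.strictAntiOn h.prof_pos (h.profD_neg hK hKN))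

theorem splitState_strictMonoOn (hK : 1 ≤ K) (hKN : K ≤ N) (hω : lengthBound < Real.pi * √(-ω))
    {j : Fin N} (hj : K ≤ j.val) :
    StrictMonoOn ((splitState N K ω).loop j) (Icc 0 Real.pi) := by
  obtain ⟨hl, -⟩ := lengthBound_sqrt_pos hω
  have h := isAmpPair_ampPair hK hKN hω.le
  simp only [splitState, if_neg (not_lt.2 hj)]
  exact strictMonoOn_wave hl h.2.1.strictMonoOn

theorem IsAmpPair.loop_pos {T a b : ℝ} (hK : 1 ≤ K) (hKN : K ≤ N) (h : IsAmpPair N K T a b) {t : ℝ}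
    (ht : t ∈ Icc 0 T) (c : Prop) [Decidable c] : 0 < prof t (if c then a else b) := by
  split_ifs
  · exact h.1.pos h.prof_pos (h.profD_neg hK hKN).le ht
  · exact h.2.1.prof_pos ht

theorem splitState_loop_pos (hK : 1 ≤ K) (hKN : K ≤ N) (hω : lengthBound < Real.pi * √(-ω))
    (j : Fin N) {x : ℝ} (hx : x ∈ loopEdge) : 0 < (splitState N K ω).loop j x := by
  obtain ⟨hl, -⟩ := lengthBound_sqrt_pos hω
  have h := isAmpPair_ampPair hK hKN hω.le
  rw [even_eq_abs (fun x _ => splitState_loop_even j x) hx]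
  exact mul_pos hl (h.loop_pos hK hKN (mul_mem_length hl (abs_mem_loop hx)) _)

theorem splitState_loop_pi (hK : 1 ≤ K) (hKN : K ≤ N) (hω : lengthBound < Real.pi * √(-ω))
    (j : Fin N) : (splitState N K ω).loop j Real.pi =
      √(-ω) * prof (Real.pi * √(-ω)) (ampPair N K (Real.pi * √(-ω))).1 := by
  have h := isAmpPair_ampPair hK hKN hω.le
  have e : √(-ω) * Real.pi + 0 = Real.pi * √(-ω) := by ring
  simp only [splitState, e]
  split_ifs
  · rfl
  · rw [h.2.2.1]

theorem memH2NK_splitState (hK : 1 ≤ K) (hKN : K ≤ N) (hω : lengthBound < Real.pi * √(-ω)) :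
    (splitState N K ω).MemH2NK := by
  obtain ⟨hl, -⟩ := lengthBound_sqrt_pos hω
  have h := isAmpPair_ampPair hK hKN hω.le
  have hπ := Real.pi_pos
  have hp := h.prof_pos
  have hp1 : prof (Real.pi * √(-ω)) (ampPair N K (Real.pi * √(-ω))).1 < 1 := by
    linarith [h.prof_lt]
  have hray0 : (splitState N K ω).ray 0 =
      √(-ω) * prof (Real.pi * √(-ω)) (ampPair N K (Real.pi * √(-ω))).1 := by
    simp only [splitState, mul_zero, zero_add, prof_rayShift hp hp1]
  refine ⟨fun j => memH2_loop_wave _ _, memH2_ray_wave hl (rayShift_nonneg hp), fun j => ?_, ?_⟩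
  · rw [splitState_loop_even, splitState_loop_pi hK hKN hω, hray0]
    exact ⟨rfl, rfl⟩
  · have hd1 : ∀ j : Fin N, ∀ x ∈ loopEdge, d1 loopEdge ((splitState N K ω).loop j) x =
        √(-ω) ^ 2 * profD (√(-ω) * x + 0) (if j.val < K then (ampPair N K (Real.pi * √(-ω))).1
          else (ampPair N K (Real.pi * √(-ω))).2) := fun j =>
      d1_eqOn uniqueDiffOn_loopEdge (hasDerivAt_wave_prof _ _ _)
    have hd0 : d1 rayEdge (splitState N K ω).ray 0 = _ :=
      d1_eqOn uniqueDiffOn_rayEdge (hasDerivAt_wave_prof _ _ _) (mem_Ici.2 le_rfl)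
    rw [hd0, mul_zero, zero_add, profD_rayShift hp hp1]
    have e1 : √(-ω) * -Real.pi + 0 = -(Real.pi * √(-ω)) := by ring
    have e2 : √(-ω) * Real.pi + 0 = Real.pi * √(-ω) := by ring
    have e3 : ∀ j : Fin N, d1 loopEdge ((splitState N K ω).loop j) Real.pi -
        d1 loopEdge ((splitState N K ω).loop j) (-Real.pi) = if j.val < K then
          √(-ω) ^ 2 * (2 * profD (Real.pi * √(-ω)) (ampPair N K (Real.pi * √(-ω))).1) else
          √(-ω) ^ 2 * (2 * profD (Real.pi * √(-ω)) (ampPair N K (Real.pi * √(-ω))).2) := by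
      intro j
      rw [hd1 j _ ⟨by linarith, le_rfl⟩, hd1 j _ ⟨le_rfl, by linarith⟩, e1, e2, profD_neg]
      split_ifs <;> ring
    simp only [e3]
    rw [sum_ite_lt hKN]
    have := h.2.2.2
    unfold vertexBalance at this
    linear_combination √(-ω) ^ 2 * this

theorem wave_solves {s : Set ℝ} (hs : UniqueDiffOn ℝ s) (hm : MeasurableSet s) (hω : ω < 0)
    (c a : ℝ) : ∀ᵐ x ∂(volume.restrict s), ω * (√(-ω) * prof (√(-ω) * x + c) a) =
      -d2 s (fun x => √(-ω) * prof (√(-ω) * x + c) a) x -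
        2 * (√(-ω) * prof (√(-ω) * x + c) a) ^ 3 := by
  refine (ae_restrict_iff' hm).2 (Eventually.of_forall fun x hx => ?_)
  rw [d2_eqOn hs (hasDerivAt_wave_prof _ _ _) (hasDerivAt_wave_profD _ _ _) hx]
  unfold force
  have h : √(-ω) ^ 2 = -ω := Real.sq_sqrt (by linarith)
  have h3 : √(-ω) ^ 3 = √(-ω) * √(-ω) ^ 2 := by ring
  rw [mul_pow, h3, h]
  ring

theorem isState_splitState (hK : 1 ≤ K) (hKN : K ≤ N) (hω : lengthBound < Real.pi * √(-ω)) :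
    (splitState N K ω).IsState ω := by
  obtain ⟨hl, hω0⟩ := lengthBound_sqrt_pos hω
  have h := isAmpPair_ampPair hK hKN hω.le
  refine ⟨memH2NK_splitState hK hKN hω,
    ⟨fun j => wave_solves uniqueDiffOn_loopEdge measurableSet_Icc hω0 _ _,
      wave_solves uniqueDiffOn_rayEdge measurableSet_Ici hω0 _ _⟩,
    ⟨fun j x hx => splitState_loop_pos hK hKN hω j hx, fun x hx => ?_⟩, fun j => ?_,
    fun j x _ => splitState_loop_even j x, ?_⟩
  · have hx0 : 0 ≤ x := hx
    have := rayShift_nonneg h.prof_pos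
    exact mul_pos hl (soliton_pos (by positivity))
  · rcases lt_or_ge j.val K with hj | hj
    · exact isSingleLobe_of_strictAntiOn (fun x _ => splitState_loop_even j x)
        (splitState_strictAntiOn hK hKN hω hj)
    · exact isSingleLobe_of_strictMonoOn (fun x _ => splitState_loop_even j x)
        (splitState_strictMonoOn hK hKN hω hj)
  · intro x hx y hy hxy
    have hx0 : 0 ≤ x := hx
    have hy0 : 0 ≤ y := hy
    have := rayShift_nonneg h.prof_pos
    have h1 : √(-ω) * x < √(-ω) * y := mul_lt_mul_of_pos_left hxy hl
    refine mul_lt_mul_of_pos_left (soliton_strictAntiOn ?_ ?_ ?_) hl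
    · exact mem_Ici.2 (by positivity)
    · exact mem_Ici.2 (by positivity)
    · linarith

/-- An increasing loop attains its norm at the vertex, where all loops agree, and a decreasing loop
strictly exceeds that common value at its centre. -/
theorem isSplit_splitState (hK : 1 ≤ K) (hKN : K ≤ N) (hω : lengthBound < Real.pi * √(-ω)) :
    (splitState N K ω).IsSplit K := by
  obtain ⟨hl, -⟩ := lengthBound_sqrt_pos hω
  have h := isAmpPair_ampPair hK hKN hω.le
  have hπ := Real.pi_pos
  refine ⟨fun i j hi hj => ?_, fun i j hi hj => ?_, fun i j hi hj => ?_⟩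
  · simp only [splitState, if_pos hi, if_pos hj]
    exact eqOn_refl _ _
  · simp only [splitState, if_neg (not_lt.2 hi), if_neg (not_lt.2 hj)]
    exact eqOn_refl _ _
  · have even : ∀ j, ∀ x ∈ loopEdge,
        (splitState N K ω).loop j (-x) = (splitState N K ω).loop j x :=
      fun j x _ => splitState_loop_even j x
    have h1 : GraphFun.amplitude ((splitState N K ω).loop j) =
        (splitState N K ω).loop j Real.pi := by
      have hmem : Real.pi ∈ loopEdge := ⟨by linarith, le_rfl⟩
      refine amplitude_eq hmem (splitState_loop_pos hK hKN hω j hmem) fun x hx =>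
        ⟨splitState_loop_pos hK hKN hω j hx, ?_⟩
      rw [even_eq_abs (even j) hx]
      exact (splitState_strictMonoOn hK hKN hω hj).monotoneOn (abs_mem_loop hx) pi_mem_loop
        (abs_mem_loop hx).2
    have h2 : GraphFun.amplitude ((splitState N K ω).loop i) = (splitState N K ω).loop i 0 := by
      have hmem : (0 : ℝ) ∈ loopEdge := ⟨by linarith, hπ.le⟩
      refine amplitude_eq hmem (splitState_loop_pos hK hKN hω i hmem) fun x hx =>
        ⟨splitState_loop_pos hK hKN hω i hx, ?_⟩
      rw [even_eq_abs (even i) hx]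
      exact (splitState_strictAntiOn hK hKN hω hi).antitoneOn zero_mem_loop (abs_mem_loop hx)
        (abs_mem_loop hx).1
    rw [h1, h2, splitState_loop_pi hK hKN hω, ← splitState_loop_pi hK hKN hω i]
    exact splitState_strictAntiOn hK hKN hω hi zero_mem_loop pi_mem_loop hπ

end IsState

/-! ### Smoothness of the branches and of the rescaled mass -/

section Smooth

variable {N K : ℕ}

theorem contDiffOn_toH2_splitState (hK : 1 ≤ K) (hKN : K ≤ N) {W : ℝ}
    (hW : ∀ ω < W, lengthBound < Real.pi * √(-ω)) :
    ContDiffOn ℝ 1 (fun ω => (splitState N K ω).toH2) (Iio W) := by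
  have hl : ContDiffOn ℝ 1 (fun ω : ℝ => √(-ω)) (Iio W) := fun ω hω =>
    (contDiffAt_id.neg.sqrt (by
      have := (lengthBound_sqrt_pos (hW ω hω)).2
      simp only [id]
      linarith)).contDiffWithinAt
  have hT : ContDiffOn ℝ 1 (fun ω : ℝ => Real.pi * √(-ω)) (Iio W) := contDiffOn_const.mul hl
  have hpair : ContDiffOn ℝ 1 (fun ω => ampPair N K (Real.pi * √(-ω))) (Iio W) := fun ω hω =>
    ContDiffAt.comp_contDiffWithinAt (g := ampPair N K) (f := fun ω : ℝ => Real.pi * √(-ω)) ω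
      (contDiffAt_ampPair hK hKN (hW ω hω)) (hT ω hω)
  have hA : ContDiffOn ℝ 1 (fun ω => (ampPair N K (Real.pi * √(-ω))).1) (Iio W) :=
    contDiff_fst.comp_contDiffOn hpair
  have hB : ContDiffOn ℝ 1 (fun ω => (ampPair N K (Real.pi * √(-ω))).2) (Iio W) :=
    contDiff_snd.comp_contDiffOn hpair
  have hP : ContDiffOn ℝ 1 (fun ω => prof (Real.pi * √(-ω)) (ampPair N K (Real.pi * √(-ω))).1)
      (Iio W) :=
    ContDiff.comp_contDiffOn (g := fun q : ℝ × ℝ => prof q.1 q.2)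
      (contDiff_prof.of_le (by exact_mod_cast le_top)) (hT.prodMk hA)
  have hp : ∀ ω ∈ Iio W, 0 < prof (Real.pi * √(-ω)) (ampPair N K (Real.pi * √(-ω))).1 ∧
      prof (Real.pi * √(-ω)) (ampPair N K (Real.pi * √(-ω))).1 < 1 := fun ω hω => by
    have h := isAmpPair_ampPair hK hKN (hW ω hω).le
    exact ⟨h.prof_pos, by linarith [h.prof_lt]⟩
  have hC : ContDiffOn ℝ 1 (fun ω => rayShift (prof (Real.pi * √(-ω))
      (ampPair N K (Real.pi * √(-ω))).1)) (Iio W) := fun ω hω =>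
    ContDiffAt.comp_contDiffWithinAt (g := rayShift) ω
      (contDiffAt_rayShift (hp ω hω).1 (hp ω hω).2) (hP ω hω)
  have hloops : ContDiffOn ℝ 1 (fun ω => (WithLp.toLp 2 fun j =>
      edgeJet loopEdge ((splitState N K ω).loop j) :
        PiLp 2 (fun _ : Fin N => EdgeJet loopEdge))) (Iio W) := by
    refine contDiffOn_piLp' 2 fun j => ?_
    simp only [splitState]
    rcases lt_or_ge j.val K with hj | hj
    · simp only [if_pos hj]
      exact contDiffOn_edgeJet_loop isOpen_Iio hl (c := fun _ => 0) contDiffOn_const hA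
    · simp only [if_neg (not_lt.2 hj)]
      exact contDiffOn_edgeJet_loop isOpen_Iio hl (c := fun _ => 0) contDiffOn_const hB
  have hray : ContDiffOn ℝ 1 (fun ω => edgeJet rayEdge (splitState N K ω).ray) (Iio W) :=
    contDiffOn_edgeJet_ray isOpen_Iio hl hC (fun ω hω => (lengthBound_sqrt_pos (hW ω hω)).1)
      fun ω hω => rayShift_nonneg (hp ω hω).1
  exact WithLp.contDiff_toLp.comp_contDiffOn (hloops.prodMk hray)

theorem contDiffOn_scaledMass (hK : 1 ≤ K) (hKN : K ≤ N) :
    ContDiffOn ℝ 1 (scaledMass N K) (Ioi lengthBound) := by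
  intro T hT
  have h := isAmpPair_ampPair hK hKN (le_of_lt hT)
  have hp := h.prof_pos
  have hpl := h.prof_lt
  have hpair := contDiffAt_ampPair hK hKN hT
  have hA : ContDiffAt ℝ 1 (fun T => (ampPair N K T).1) T := contDiff_fst.contDiffAt.comp T hpair
  have hB : ContDiffAt ℝ 1 (fun T => (ampPair N K T).2) T := contDiff_snd.contDiffAt.comp T hpair
  have along : ∀ {H : ℝ → ℝ → ℝ}, (ContDiff ℝ (⊤ : ℕ∞) fun q : ℝ × ℝ => H q.1 q.2) →
      ∀ {A : ℝ → ℝ}, ContDiffAt ℝ 1 A T → ContDiffAt ℝ 1 (fun T => H T (A T)) T :=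
    fun {H} hH {A} hA => ContDiffAt.comp (g := fun q : ℝ × ℝ => H q.1 q.2)
      (f := fun T => (T, A T)) T (hH.contDiffAt.of_le (by exact_mod_cast le_top))
      (contDiffAt_id.prodMk hA)
  have h1 : (1 : ℝ) - prof T (ampPair N K T).1 ^ 2 ≠ 0 := by nlinarith
  have := ((contDiffAt_const (c := 2 * (K : ℝ))).mul (along contDiff_sqMass hA)).add
    ((contDiffAt_const (c := 2 * (N - K : ℝ))).mul (along contDiff_sqMass hB)) |>.add
    ((contDiffAt_const (c := (1 : ℝ))).sub ((contDiffAt_const.sub ((along contDiff_prof hA).pow 2)).sqrt h1))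
  exact this.contDiffWithinAt

end Smooth

/-! ### From weak to classical solutions -/

section Regularity

variable {s : Set ℝ} {f k : ℝ → ℝ}

theorem MemH2.hasDerivWithinAt (h : MemH2 s f) {x : ℝ} (hx : x ∈ s) :
    HasDerivWithinAt f (d1 s f x) s x := (h.1 x hx).hasDerivWithinAt

/-- If the weak second derivative is a continuous function, it is a classical derivative. -/
theorem MemH2.hasDerivWithinAt_d1_of_retract (h : MemH2 s f) (hm : MeasurableSet s)
    (hc : s.OrdConnected) {a : ℝ} (ha : a ∈ s) (hle : ∀ x ∈ s, a ≤ x) {r : ℝ → ℝ}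
    (hr : Continuous r) (hrs : ∀ x, r x ∈ s) (hid : ∀ x ∈ s, r x = x) (hk : ContinuousOn k s)
    (hae : ∀ᵐ x ∂(volume.restrict s), d2 s f x = k x) {x : ℝ} (hx : x ∈ s) :
    HasDerivWithinAt (d1 s f) (k x) s x := by
  have hK : Continuous fun y => k (r y) :=
    continuousOn_univ.1 (hk.comp hr.continuousOn fun y _ => hrs y)
  have hint : ∀ y ∈ s, d1 s f y = d1 s f a + ∫ t in a..y, k (r t) := by
    intro y hy
    have h1 := (h.2.1 a ha y hy).integral_deriv_eq_sub
    have h2 : ∫ t in a..y, deriv (d1 s f) t = ∫ t in a..y, k (r t) := by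
      refine intervalIntegral.integral_congr_ae ?_
      -- The one-sided derivative along `s` agrees with the two-sided one only where `s` is a
      -- neighbourhood, so the end point `y` is discarded as a null set.
      have h3 : ∀ᵐ t : ℝ, t ≠ y := by simp [ae_iff]
      filter_upwards [(ae_restrict_iff' hm).1 hae, h3] with t ht hty htm
      rw [uIoc_of_le (hle y hy)] at htm
      have hIcc : Icc a y ⊆ s := hc.out ha hy
      have hts : t ∈ s := hIcc ⟨htm.1.le, htm.2⟩
      have hnh : s ∈ 𝓝 t :=
        mem_of_superset (Icc_mem_nhds htm.1 (lt_of_le_of_ne htm.2 hty)) hIcc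
      rw [hid t hts, ← ht hts, ← derivWithin_of_mem_nhds hnh]
      rfl
    rw [← h2, h1]
    ring
  have hd : HasDerivAt (fun y => d1 s f a + ∫ t in a..y, k (r t)) (k (r x)) x :=
    (intervalIntegral.integral_hasDerivAt_right (hK.intervalIntegrable _ _)
      (hK.stronglyMeasurableAtFilter _ _) hK.continuousAt).const_add _
  rw [hid x hx] at hd
  exact hd.hasDerivWithinAt.congr hint (hint x hx)

theorem MemH2.hasDerivWithinAt_d1_loop (h : MemH2 loopEdge f) (hk : ContinuousOn k loopEdge)
    (hae : ∀ᵐ x ∂(volume.restrict loopEdge), d2 loopEdge f x = k x) {x : ℝ} (hx : x ∈ loopEdge) :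
    HasDerivWithinAt (d1 loopEdge f) (k x) loopEdge x := by
  have hπ := Real.pi_pos
  refine h.hasDerivWithinAt_d1_of_retract (r := fun x => max (-Real.pi) (min x Real.pi))
    measurableSet_Icc ordConnected_Icc (a := -Real.pi) ⟨le_rfl, by linarith⟩
    (fun x hx => hx.1) (by fun_prop) (fun x => ⟨le_max_left _ _, max_le (by linarith)
      (min_le_right _ _)⟩) (fun x hx => ?_) hk hae hx
  rw [min_eq_left hx.2, max_eq_right hx.1]

theorem MemH2.hasDerivWithinAt_d1_ray (h : MemH2 rayEdge f) (hk : ContinuousOn k rayEdge)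
    (hae : ∀ᵐ x ∂(volume.restrict rayEdge), d2 rayEdge f x = k x) {x : ℝ} (hx : x ∈ rayEdge) :
    HasDerivWithinAt (d1 rayEdge f) (k x) rayEdge x :=
  h.hasDerivWithinAt_d1_of_retract (r := fun x => max 0 x) measurableSet_Ici ordConnected_Ici
    (a := 0) (mem_Ici.2 le_rfl) (fun _ hx => hx) (by fun_prop) (fun _ => mem_Ici.2 (le_max_left _ _))
    (fun _ hx => max_eq_right hx) hk hae hx

theorem eq_zero_of_integrableOn_rayEdge {g : ℝ → ℝ} {C : ℝ} (hg : IntegrableOn g rayEdge)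
    (hC : ∀ x ∈ rayEdge, g x = C) : C = 0 := by
  have h1 : IntegrableOn (fun _ => C) rayEdge := hg.congr_fun hC measurableSet_Ici
  rw [integrableOn_const_iff] at h1
  rcases h1 with h1 | h1
  · simpa using h1
  · simp at h1

/-- A quantity with zero derivative along the half-line is constant. -/
theorem ray_const_of_hasDerivWithinAt_zero {g : ℝ → ℝ}
    (h : ∀ x ∈ rayEdge, HasDerivWithinAt g 0 rayEdge x) : ∀ x ∈ rayEdge, g x = g 0 := by
  intro x hx
  have := (convex_Ici (0 : ℝ)).norm_image_sub_le_of_norm_hasDerivWithin_le (C := 0) h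
    (fun _ _ => by simp) (mem_Ici.2 le_rfl) hx
  rw [zero_mul] at this
  exact sub_eq_zero.1 (norm_le_zero_iff.1 this)

end Regularity

/-! ### Every even loop component is a rescaled profile -/

section LoopShape

variable {l : ℝ} {f : ℝ → ℝ}

theorem d1_loop_zero_of_even (h : MemH2 loopEdge f) (he : ∀ x ∈ loopEdge, f (-x) = f x) :
    d1 loopEdge f 0 = 0 := by
  have hπ := Real.pi_pos
  have hn : loopEdge ∈ 𝓝 (0 : ℝ) := Icc_mem_nhds (by linarith) hπ
  have h1 : HasDerivAt f (d1 loopEdge f 0) 0 :=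
    (h.hasDerivWithinAt (mem_of_mem_nhds hn)).hasDerivAt hn
  have h1' : HasDerivAt f (d1 loopEdge f 0) (-0) := by simpa using h1
  have h2 : HasDerivAt (fun x => f (-x)) (d1 loopEdge f 0 * -1) 0 :=
    HasDerivAt.comp (0 : ℝ) h1' (hasDerivAt_neg 0)
  have h3 := (h2.congr_of_eventuallyEq
    (show f =ᶠ[𝓝 0] fun x => f (-x) from mem_of_superset hn fun x hx => (he x hx).symm)).unique h1
  linarith

/-- Evenness gives zero slope at the centre, so the value there fixes the solution of the Cauchy
problem. -/
theorem loop_eq_wave (hl : 0 < l) (h : MemH2 loopEdge f) (he : ∀ x ∈ loopEdge, f (-x) = f x)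
    (hs : ∀ᵐ x ∂(volume.restrict loopEdge), -l ^ 2 * f x = -d2 loopEdge f x - 2 * f x ^ 3) :
    EqOn f (fun x => l * prof (l * x + 0) (f 0 / l)) loopEdge := by
  have hπ := Real.pi_pos
  have hk : ContinuousOn (fun x => l ^ 2 * f x - 2 * f x ^ 3) loopEdge :=
    (continuousOn_const.mul h.1.continuousOn).sub (continuousOn_const.mul (h.1.continuousOn.pow 3))
  have h2 := fun x (hx : x ∈ loopEdge) => h.hasDerivWithinAt_d1_loop hk
    (hs.mono fun x hx => by linarith) hx
  have hsub : Icc 0 Real.pi ⊆ loopEdge := Icc_subset_Icc_left (by linarith)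
  have hpos : ∀ x ∈ Icc 0 Real.pi, f x = l * prof (l * x + 0) (f 0 / l) := by
    intro x hx
    refine (nls_unique (ω := l ^ 2) (s := 0) (T := Real.pi)
      (fun y hy => (h.hasDerivWithinAt (hsub hy)).mono hsub)
      (fun y hy => (h2 y (hsub hy)).mono hsub)
      (fun y _ => (hasDerivAt_wave_prof l 0 (f 0 / l) y).hasDerivWithinAt)
      (fun y _ => ((hasDerivAt_wave_profD l 0 (f 0 / l) y).congr_deriv ?_).hasDerivWithinAt)
      ?_ ?_ x hx).1
    · unfold force
      ring
    · simp
      field_simp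
    · rw [d1_loop_zero_of_even h he]
      simp
  intro x hx
  rw [even_eq_abs he hx, hpos _ (abs_mem_loop hx)]
  exact (even_eq_abs (f := fun x => l * prof (l * x + 0) (f 0 / l))
    (fun x _ => wave_neg _ _ _) hx).symm

end LoopShape

/-! ### Every half-line component is a soliton tail -/

section RayShape

variable {l : ℝ} {f : ℝ → ℝ}

/-- The energy `f'² - l² f² + f⁴` is constant and integrable on the half-line, hence zero. At the
vertex this fixes the square of the slope, and monotonicity fixes its sign. -/
theorem ray_vertex_slope (hl : 0 < l) (h : MemH2 rayEdge f) (hpos : ∀ x ∈ rayEdge, 0 < f x)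
    (hanti : StrictAntiOn f rayEdge)
    (hs : ∀ᵐ x ∂(volume.restrict rayEdge), -l ^ 2 * f x = -d2 rayEdge f x - 2 * f x ^ 3) :
    f 0 / l ≤ 1 ∧ d1 rayEdge f 0 = -(l ^ 2 * vertexSlope (f 0 / l)) := by
  have h0 : (0 : ℝ) ∈ rayEdge := mem_Ici.2 le_rfl
  have hk : ContinuousOn (fun x => l ^ 2 * f x - 2 * f x ^ 3) rayEdge :=
    (continuousOn_const.mul h.1.continuousOn).sub (continuousOn_const.mul (h.1.continuousOn.pow 3))
  have h2 := fun x (hx : x ∈ rayEdge) => h.hasDerivWithinAt_d1_ray hk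
    (hs.mono fun x hx => by linarith) hx
  have hE := ray_const_of_hasDerivWithinAt_zero
    (g := fun x => d1 rayEdge f x ^ 2 - l ^ 2 * f x ^ 2 + f x ^ 4) fun x hx => by
      have e1 := (h2 x hx).pow 2
      have e2 := ((h.hasDerivWithinAt hx).pow 2).const_mul (l ^ 2)
      have e3 := (h.hasDerivWithinAt hx).pow 4
      exact ((e1.sub e2).add e3).congr_deriv (by push_cast; ring)
  have hi : IntegrableOn (fun x => d1 rayEdge f x ^ 2 - l ^ 2 * f x ^ 2 + f x ^ 4) rayEdge := by
    have i1 : IntegrableOn (fun x => d1 rayEdge f x ^ 2) rayEdge := h.2.2.2.1.integrable_sq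
    have i2 : IntegrableOn (fun x => f x ^ 2) rayEdge := h.2.2.1.integrable_sq
    have i4 : IntegrableOn (fun x => f x ^ 4) rayEdge := by
      refine Integrable.mono' (i2.const_mul (f 0 ^ 2)) ?_ ?_
      · exact (h.1.continuousOn.pow 4).aestronglyMeasurable measurableSet_Ici
      · refine (ae_restrict_iff' measurableSet_Ici).2 (Eventually.of_forall fun x hx => ?_)
        have b1 := hanti.antitoneOn h0 hx hx
        have b2 := hpos x hx
        have b3 : f x ^ 2 ≤ f 0 ^ 2 := by nlinarith
        rw [Real.norm_eq_abs, abs_of_nonneg (by positivity)]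
        have : f x ^ 4 = f x ^ 2 * f x ^ 2 := by ring
        rw [this]
        exact mul_le_mul_of_nonneg_right b3 (sq_nonneg _)
    exact (i1.sub (i2.const_mul _)).add i4
  have hE0 := eq_zero_of_integrableOn_rayEdge hi hE
  have hd : d1 rayEdge f 0 ≤ 0 := hanti.antitoneOn.derivWithin_nonpos
  have hp : 0 < f 0 / l := div_pos (hpos 0 h0) hl
  have hf0 : f 0 = l * (f 0 / l) := by field_simp
  set p := f 0 / l with hpd
  have hl4 : 0 < l ^ 4 := by positivity
  have hd2 : d1 rayEdge f 0 ^ 2 = l ^ 4 * (p ^ 2 - p ^ 4) := by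
    rw [hf0] at hE0
    linear_combination hE0
  have hp1 : p ≤ 1 := by
    by_contra hcon
    push Not at hcon
    have h1 : p ^ 2 - p ^ 4 < 0 := by
      have : p ^ 2 - p ^ 4 = p ^ 2 * (1 - p ^ 2) := by ring
      rw [this]
      exact mul_neg_of_pos_of_neg (by positivity) (by nlinarith)
    nlinarith [sq_nonneg (d1 rayEdge f 0)]
  refine ⟨hp1, ?_⟩
  have hv : vertexSlope p ^ 2 = p ^ 2 - p ^ 4 := by
    rw [vertexSlope, mul_pow, Real.sq_sqrt (by nlinarith)]
    ring
  have hv0 : 0 ≤ l ^ 2 * vertexSlope p := mul_nonneg (sq_nonneg l) (vertexSlope_nonneg hp.le)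
  have : (-d1 rayEdge f 0) ^ 2 = (l ^ 2 * vertexSlope p) ^ 2 := by
    rw [mul_pow, hv, neg_sq, hd2]
    ring
  have := (sq_eq_sq₀ (by linarith) hv0).1 this
  linarith

theorem ray_eq_wave (hl : 0 < l) (h : MemH2 rayEdge f) (hpos : ∀ x ∈ rayEdge, 0 < f x)
    (hanti : StrictAntiOn f rayEdge)
    (hs : ∀ᵐ x ∂(volume.restrict rayEdge), -l ^ 2 * f x = -d2 rayEdge f x - 2 * f x ^ 3)
    (hp1 : f 0 / l < 1) :
    EqOn f (fun x => l * prof (l * x + rayShift (f 0 / l)) 1) rayEdge := by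
  have h0 : (0 : ℝ) ∈ rayEdge := mem_Ici.2 le_rfl
  have hp : 0 < f 0 / l := div_pos (hpos 0 h0) hl
  have hk : ContinuousOn (fun x => l ^ 2 * f x - 2 * f x ^ 3) rayEdge :=
    (continuousOn_const.mul h.1.continuousOn).sub (continuousOn_const.mul (h.1.continuousOn.pow 3))
  have h2 := fun x (hx : x ∈ rayEdge) => h.hasDerivWithinAt_d1_ray hk
    (hs.mono fun x hx => by linarith) hx
  intro x hx
  have hsub : Icc 0 x ⊆ rayEdge := fun y hy => hy.1
  refine (nls_unique (ω := l ^ 2) (s := 0) (T := x)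
    (fun y hy => (h.hasDerivWithinAt (hsub hy)).mono hsub)
    (fun y hy => (h2 y (hsub hy)).mono hsub)
    (fun y _ => (hasDerivAt_wave_prof l (rayShift (f 0 / l)) 1 y).hasDerivWithinAt)
    (fun y _ => ((hasDerivAt_wave_profD l (rayShift (f 0 / l)) 1 y).congr_deriv
      ?_).hasDerivWithinAt) ?_ ?_ x ⟨hx, le_rfl⟩).1
  · unfold force
    ring
  · rw [mul_zero, zero_add, prof_rayShift hp hp1]
    field_simp
  · rw [mul_zero, zero_add, profD_rayShift hp hp1, (ray_vertex_slope hl h hpos hanti hs).2]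
    ring

end RayShape

/-! ### Single lobes in terms of the pendulum angle -/

section Shapes

variable {T a : ℝ}

/-- The maximum of the profile on `[0, T]` is only attained at `0`, and the minimum at `T`. -/
def PeakShape (T a : ℝ) : Prop :=
  (∀ t ∈ Ioc 0 T, prof t a < a) ∧ ∀ t ∈ Icc 0 T, prof T a ≤ prof t a

/-- The minimum of the profile on `[0, T]` is only attained at `0`, and the maximum at `T`. -/
def LowShape (T a : ℝ) : Prop :=
  (∀ t ∈ Ioc 0 T, a < prof t a) ∧ ∀ t ∈ Icc 0 T, prof t a ≤ prof T a

theorem ang_strictMonoOn (hpos : ∀ t ∈ Icc 0 T, 0 < prof t a) :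
    StrictMonoOn (fun t => ang t a) (Icc 0 T) := by
  refine strictMonoOn_of_deriv_pos (convex_Icc _ _) (continuous_ang_left a).continuousOn
    fun s hs => ?_
  rw [(hasDerivAt_ang s a).deriv]
  exact hpos s (interior_subset hs)

/-- An angle beyond `π/2` but below `π` at time `T` would have smaller `sin²` than the one at `π/2`;
reaching `π` would make the sine vanish on the way. -/
theorem ang_le_pi_div_two (hT : 0 < T) (h1 : ∀ t ∈ Ioc 0 T, Real.sin (ang t a) ≠ 0)
    (h2 : ∀ t ∈ Icc 0 T, Real.sin (ang t a) ^ 2 ≤ Real.sin (ang T a) ^ 2) :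
    ang T a ≤ Real.pi / 2 := by
  by_contra hcon
  push Not at hcon
  have hπ := Real.pi_pos
  have hivt := intermediate_value_Icc hT.le (continuous_ang_left a).continuousOn
  rw [ang_zero] at hivt
  obtain ⟨t, ht, hte⟩ := hivt ⟨by positivity, hcon.le⟩
  have h3 := h2 t ht
  simp only at hte
  rw [hte, Real.sin_pi_div_two, one_pow] at h3
  rcases lt_or_ge (ang T a) Real.pi with hlt | hge
  · have h4 := Real.cos_neg_of_pi_div_two_lt_of_lt hcon (by linarith)
    nlinarith [Real.sin_sq_add_cos_sq (ang T a)]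
  · obtain ⟨r, hr, hre⟩ := hivt ⟨hπ.le, hge⟩
    simp only at hre
    rcases hr.1.lt_or_eq with h0 | h0
    · exact h1 r ⟨h0, hr.2⟩ (by rw [hre, Real.sin_pi])
    · rw [← h0, ang_zero] at hre
      linarith

/-- By `prof_sq` the profile depends on time only through `(2a² - 1) sin² (ang)`. A strict maximum
at `0` forces `2a² > 1`, and a minimum at `T` makes `sin² (ang)` largest there. -/
theorem PeakShape.ang_le (hT : 0 < T) (hpos : ∀ t ∈ Icc 0 T, 0 < prof t a) (h : PeakShape T a) :
    1 < 2 * a ^ 2 ∧ ang T a ≤ Real.pi / 2 := by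
  have key : ∀ t ∈ Ioc 0 T, 0 < (2 * a ^ 2 - 1) * Real.sin (ang t a) ^ 2 := fun t ht => by
    have e := prof_sq t a
    have h1 := h.1 t ht
    have h2 := hpos t ⟨ht.1.le, ht.2⟩
    nlinarith
  have hk : 0 < 2 * a ^ 2 - 1 := by
    have := key T ⟨hT, le_rfl⟩
    by_contra hcon
    push Not at hcon
    nlinarith [sq_nonneg (Real.sin (ang T a))]
  refine ⟨by linarith, ang_le_pi_div_two hT (fun t ht h0 => ?_) fun t ht => ?_⟩
  · have := key t ht
    rw [h0] at this
    simp at this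
  · have e := prof_sq t a
    have e' := prof_sq T a
    have h1 := h.2 t ht
    have h2 := hpos T ⟨hT.le, le_rfl⟩
    have : (2 * a ^ 2 - 1) * Real.sin (ang t a) ^ 2 ≤ (2 * a ^ 2 - 1) * Real.sin (ang T a) ^ 2 := by
      nlinarith
    exact le_of_mul_le_mul_left this hk

theorem LowShape.ang_le (hT : 0 < T) (ha : 0 < a) (hpos : ∀ t ∈ Icc 0 T, 0 < prof t a)
    (h : LowShape T a) : 2 * a ^ 2 < 1 ∧ ang T a ≤ Real.pi / 2 := by
  have key : ∀ t ∈ Ioc 0 T, 0 < (1 - 2 * a ^ 2) * Real.sin (ang t a) ^ 2 := fun t ht => by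
    have e := prof_sq t a
    have h1 := h.1 t ht
    nlinarith
  have hk : 0 < 1 - 2 * a ^ 2 := by
    have := key T ⟨hT, le_rfl⟩
    by_contra hcon
    push Not at hcon
    nlinarith [sq_nonneg (Real.sin (ang T a))]
  refine ⟨by linarith, ang_le_pi_div_two hT (fun t ht h0 => ?_) fun t ht => ?_⟩
  · have := key t ht
    rw [h0] at this
    simp at this
  · have e := prof_sq t a
    have e' := prof_sq T a
    have h1 := h.2 t ht
    have h2 := hpos t ht
    have : (1 - 2 * a ^ 2) * Real.sin (ang t a) ^ 2 ≤ (1 - 2 * a ^ 2) * Real.sin (ang T a) ^ 2 := by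
      nlinarith
    exact le_of_mul_le_mul_left this hk

theorem sin_two_ang_nonneg (hT : 0 < T) (hpos : ∀ t ∈ Icc 0 T, 0 < prof t a)
    (h : ang T a ≤ Real.pi / 2) : 0 ≤ Real.sin (2 * ang T a) := by
  have h0 := ang_strictMonoOn hpos ⟨le_rfl, hT.le⟩ ⟨hT.le, le_rfl⟩ hT
  simp only [ang_zero] at h0
  exact Real.sin_nonneg_of_nonneg_of_le_pi (by linarith) (by linarith)

theorem PeakShape.profD_nonpos (hT : 0 < T) (hpos : ∀ t ∈ Icc 0 T, 0 < prof t a)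
    (h : PeakShape T a) : profD T a ≤ 0 := by
  obtain ⟨h1, h2⟩ := h.ang_le hT hpos
  have := sin_two_ang_nonneg hT hpos h2
  rw [profD_eq]
  nlinarith

theorem LowShape.profD_bounds (hT : 0 < T) (ha : 0 < a) (hpos : ∀ t ∈ Icc 0 T, 0 < prof t a)
    (h : LowShape T a) : 0 ≤ profD T a ∧ profD T a ≤ prof T a := by
  obtain ⟨h1, h2⟩ := h.ang_le hT ha hpos
  have h3 := sin_two_ang_nonneg hT hpos h2
  refine ⟨by rw [profD_eq]; nlinarith, ?_⟩
  have h4 := prof_energy T a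
  have h5 := hpos T ⟨hT.le, le_rfl⟩
  have h6 : a ^ 4 ≤ a ^ 2 := by nlinarith [sq_nonneg a]
  exact (abs_le_of_sq_le_sq' (by nlinarith [sq_nonneg (prof T a ^ 2)]) h5.le).2

/-- The angle grows at rate `prof ≥ prof T a`, yet its total is at most `π/2 ≤ 2`. This first
smallness of `p` uses neither `IsPeak` nor the balance. -/
theorem PeakShape.vertex_value_mul_le (hT : 0 < T) (hpos : ∀ t ∈ Icc 0 T, 0 < prof t a)
    (h : PeakShape T a) : prof T a * T ≤ 2 := by
  have h1 := (convex_Icc 0 T).mul_sub_le_image_sub_of_le_deriv (f := fun t => ang t a)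
    (continuous_ang_left a).continuousOn
    (fun r _ => (hasDerivAt_ang r a).differentiableAt.differentiableWithinAt) (C := prof T a)
    (fun r hr => by
      rw [(hasDerivAt_ang r a).deriv]
      exact h.2 r (interior_subset hr)) 0 ⟨le_rfl, hT.le⟩ T ⟨hT.le, le_rfl⟩ hT.le
  simp only [ang_zero, sub_zero] at h1
  linarith [(h.ang_le hT hpos).2, Real.pi_le_four]

/-- The angle increases within `[0, π/2]`, so `prof` does not increase after time `3`, where it is
already below `3/20`. -/
theorem PeakShape.isPeak (hT : 3 < T) (hpos : ∀ t ∈ Icc 0 T, 0 < prof t a) (h : PeakShape T a)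
    (ha : |a - 1| < ampRadius) : IsPeak T a := by
  refine ⟨hT, ha, fun t ht => ?_⟩
  have hT0 : 0 < T := by linarith
  obtain ⟨h1, h2⟩ := h.ang_le hT0 hpos
  have h3 : (3 : ℝ) ∈ Icc 0 T := ⟨by norm_num, hT.le⟩
  have ht' : t ∈ Icc 0 T := ⟨by linarith [ht.1], ht.2⟩
  have hm := (ang_strictMonoOn hpos).monotoneOn
  have m0 := hm ⟨le_rfl, hT0.le⟩ h3 h3.1
  have m1 := hm h3 ht' ht.1
  have m2 := hm ht' ⟨hT0.le, le_rfl⟩ ht.2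
  simp only [ang_zero] at m0 m1 m2
  have hs : Real.sin (ang 3 a) ≤ Real.sin (ang t a) :=
    Real.sin_le_sin_of_le_of_le_pi_div_two (by linarith [Real.pi_pos]) (by linarith) m1
  have hs0 : 0 ≤ Real.sin (ang 3 a) :=
    Real.sin_nonneg_of_nonneg_of_le_pi m0 (by linarith [Real.pi_pos])
  have hsq : Real.sin (ang 3 a) ^ 2 ≤ Real.sin (ang t a) ^ 2 := by nlinarith
  have e := prof_sq t a
  have e3 := prof_sq 3 a
  have p3 := hpos 3 h3
  have pt := hpos t ht'
  have c3 := (central_spec ha).2.2.2.1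
  have hle : prof t a ^ 2 ≤ prof 3 a ^ 2 := by nlinarith
  rw [abs_of_pos pt]
  nlinarith

theorem LowShape.isLow (hT : 0 < T) (ha : 0 < a) (hpos : ∀ t ∈ Icc 0 T, 0 < prof t a)
    (h : LowShape T a) (hp : prof T a < 2 / 5) : IsLow T a :=
  ⟨hT, ha, fun t ht => by
    rw [abs_of_pos (hpos t ht)]
    exact (h.2 t ht).trans_lt hp⟩

end Shapes

/-! ### Sorting the loops -/

section Permutation

theorem exists_perm_lt {N : ℕ} (P : Fin N → Prop) [DecidablePred P] :
    ∃ σ : Equiv.Perm (Fin N), ∀ j, P j ↔ (σ j).val < (Finset.univ.filter P).card := by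
  set K := (Finset.univ.filter P).card with hK
  have hKN : K ≤ N := by
    have := Finset.card_le_univ (Finset.univ.filter P)
    simpa using this
  have hcard : Fintype.card {j : Fin N // P j} = Fintype.card {i : Fin N // i.val < K} := by
    rw [Fintype.card_subtype, Fintype.card_subtype]
    have h := Finset.card_map (s := Finset.univ.filter fun i : Fin N => i.val < K) Fin.valEmbedding
    rw [← h]
    have h2 : (Finset.univ.filter fun i : Fin N => i.val < K).map Fin.valEmbedding =
        Finset.range K := by
      ext i
      simp only [Finset.mem_map, Finset.mem_filter, Finset.mem_univ, true_and,
        Fin.valEmbedding_apply, Finset.mem_range]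
      constructor
      · rintro ⟨x, hx, rfl⟩
        exact hx
      · intro hi
        exact ⟨⟨i, by omega⟩, hi, rfl⟩
    rw [h2, Finset.card_range]
  set e := Fintype.equivOfCardEq hcard
  refine ⟨e.extendSubtype, fun j => ⟨fun hj => e.extendSubtype_mem j hj, fun hj => ?_⟩⟩
  by_contra hn
  exact e.extendSubtype_not_mem j hn hj

end Permutation

/-! ### Classification of the amplitudes -/

section Classification

variable {N : ℕ} {T p : ℝ} {a : Fin N → ℝ}

/-- If all loops were low, no term of the balance could be negative, so all would vanish. Then `p =
1` with zero slope, and the energy forces `a² (a² - 1) = 0`, against `0 < a` and `2a² < 1`. -/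
theorem exists_peakShape (hN : 1 ≤ N) (hT : 0 < T) (ha : ∀ j, 0 < a j)
    (hpos : ∀ j, ∀ t ∈ Icc 0 T, 0 < prof t (a j)) (hp : ∀ j, prof T (a j) = p)
    (hshape : ∀ j, PeakShape T (a j) ∨ LowShape T (a j)) (hp1 : p ≤ 1)
    (hsum : ∑ j, 2 * profD T (a j) + vertexSlope p = 0) : ∃ j, PeakShape T (a j) := by
  by_contra hcon
  push Not at hcon
  have hlow : ∀ j, LowShape T (a j) := fun j => (hshape j).resolve_left (hcon j)
  have hD := fun j => (hlow j).profD_bounds hT (ha j) (hpos j)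
  set j₀ : Fin N := ⟨0, hN⟩
  have hp0 : 0 < p := by
    rw [← hp j₀]
    exact hpos j₀ T ⟨hT.le, le_rfl⟩
  have hv := vertexSlope_nonneg hp0.le
  have hs0 : 0 ≤ ∑ j, 2 * profD T (a j) := Finset.sum_nonneg fun j _ => by linarith [(hD j).1]
  have hv0 : vertexSlope p = 0 := by linarith
  have hpe : p = 1 := by
    by_contra hne
    exact (vertexSlope_pos hp0 (lt_of_le_of_ne hp1 hne)).ne' hv0
  have hterm : 2 * profD T (a j₀) = 0 :=
    (Finset.sum_eq_zero_iff_of_nonneg (f := fun j => 2 * profD T (a j))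
      fun j _ => mul_nonneg two_pos.le (hD j).1).1 (by linarith) j₀ (Finset.mem_univ _)
  have he := prof_energy T (a j₀)
  rw [hp j₀, hpe, show profD T (a j₀) = 0 by linarith] at he
  have h1 := ((hlow j₀).ang_le hT (ha j₀) (hpos j₀)).1
  have h2 : a j₀ ^ 2 * (a j₀ ^ 2 - 1) = 0 := by linarith
  have h3 := ha j₀
  nlinarith

/-- Here the other loops are arbitrary: each slope is at most `p`, so the balance gives `-profD ≤ N
p`. The energy identity then bounds `a - 1`; only `2a² > 1` is known, whence the extra factor `2`.
-/
theorem PeakShape.amp_close (hN : 1 ≤ N) (hT : 0 < T) (ha : ∀ j, 0 < a j)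
    (hpos : ∀ j, ∀ t ∈ Icc 0 T, 0 < prof t (a j)) (hp : ∀ j, prof T (a j) = p)
    (hshape : ∀ j, PeakShape T (a j) ∨ LowShape T (a j)) (hp1 : p ≤ 1)
    (hsum : ∑ j, 2 * profD T (a j) + vertexSlope p = 0) {j : Fin N} (h : PeakShape T (a j)) :
    |a j - 1| ≤ 2 * (N ^ 2 + 2) * p ^ 2 := by
  have hp0 : 0 < p := by
    rw [← hp j]
    exact hpos j T ⟨hT.le, le_rfl⟩
  have hle : ∀ i, profD T (a i) ≤ p := fun i => by
    rcases hshape i with hi | hi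
    · exact (hi.profD_nonpos hT (hpos i)).trans hp0.le
    · exact (hi.profD_bounds hT (ha i) (hpos i)).2.trans (hp i).le
  have hv := vertexSlope_le hp0.le
  have hsum' := Finset.add_sum_erase Finset.univ (fun i => 2 * profD T (a i)) (Finset.mem_univ j)
  have hrest : ∑ i ∈ Finset.univ.erase j, 2 * profD T (a i) ≤ (N - 1) * (2 * p) := by
    have h1 := Finset.sum_le_card_nsmul (Finset.univ.erase j) (fun i => 2 * profD T (a i)) (2 * p)
      fun i _ => by linarith [hle i]
    rw [Finset.card_erase_of_mem (Finset.mem_univ j), Finset.card_univ, Fintype.card_fin,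
      nsmul_eq_mul, Nat.cast_sub hN, Nat.cast_one] at h1
    exact h1
  have hq : -profD T (a j) ≤ N * p := by
    nlinarith
  have hq0 := h.profD_nonpos hT (hpos j)
  have hk := (h.ang_le hT (hpos j)).1
  have he := prof_energy T (a j)
  rw [hp j] at he
  have hq2 : profD T (a j) ^ 2 ≤ N ^ 2 * p ^ 2 := by
    rw [← mul_pow, ← neg_sq]
    exact pow_le_pow_left₀ (by linarith) hq 2
  have hp4 : p ^ 4 ≤ p ^ 2 := by
    have : p ^ 2 ≤ 1 := by nlinarith
    nlinarith [sq_nonneg p]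
  have h6 : |a j ^ 4 - a j ^ 2| ≤ (N ^ 2 + 2) * p ^ 2 := by
    have := sq_nonneg (profD T (a j))
    have := sq_nonneg (p ^ 2)
    have := sq_nonneg p
    rw [abs_le]
    constructor <;> nlinarith
  have e : a j ^ 4 - a j ^ 2 = a j ^ 2 * (a j + 1) * (a j - 1) := by ring
  rw [e, abs_mul] at h6
  have h7 : 1 / 2 ≤ |a j ^ 2 * (a j + 1)| := by
    have := ha j
    rw [abs_of_pos (by positivity)]
    nlinarith
  nlinarith [abs_nonneg (a j - 1)]

/-- From `p T ≤ 2` the value `p` is small, so peak shapes have amplitude within `ampRadius` of `1`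
and are genuine peaks. Equal vertex values then make all peaks equal and all low profiles equal, and
uniqueness of the amplitude pair finishes. -/
theorem exists_perm_ampPair (N : ℕ) (hN : 1 ≤ N) : ∃ T₂ : ℝ, lengthBound < T₂ ∧
    ∀ T, T₂ ≤ T → ∀ (a : Fin N → ℝ) (p : ℝ), (∀ j, 0 < a j) →
    (∀ j, ∀ t ∈ Icc 0 T, 0 < prof t (a j)) → (∀ j, prof T (a j) = p) →
    (∀ j, PeakShape T (a j) ∨ LowShape T (a j)) → p ≤ 1 →
    ∑ j, 2 * profD T (a j) + vertexSlope p = 0 →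
    p < 2 / 5 ∧ ∃ K : ℕ, 1 ≤ K ∧ K ≤ N ∧ ∃ σ : Equiv.Perm (Fin N), ∀ j,
      a j = if (σ j).val < K then (ampPair N K T).1 else (ampPair N K T).2 := by
  have hr := ampRadius_pos
  have hX0 : 0 ≤ 4 * ((N : ℝ) ^ 2 + 2) / ampRadius := by positivity
  -- With `p T ≤ 2` the second entry yields `2 (N² + 2) p < ampRadius`, and its `6` yields `p ≤ 1/3
  -- < 2/5`.
  refine ⟨max (lengthBound + 1) (4 * (N ^ 2 + 2) / ampRadius + 6),
    lt_max_of_lt_left (by linarith), fun T hT a p ha hpos hp hshape hp1 hsum => ?_⟩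
  have hTB : lengthBound ≤ T := by linarith [(le_max_left _ _).trans hT]
  have hTX : 4 * (N ^ 2 + 2) / ampRadius + 6 ≤ T := (le_max_right _ _).trans hT
  have hT3 : 3 < T := three_lt_lengthBound.trans_le hTB
  have hT0 : 0 < T := by linarith
  obtain ⟨j₀, hj₀⟩ := exists_peakShape hN hT0 ha hpos hp hshape hp1 hsum
  have hp0 : 0 < p := by
    rw [← hp j₀]
    exact hpos j₀ T ⟨hT0.le, le_rfl⟩
  have hpT : p * T ≤ 2 := by
    rw [← hp j₀]
    exact hj₀.vertex_value_mul_le hT0 (hpos j₀)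
  have hp25 : p < 2 / 5 := by nlinarith
  have hsmall : 2 * ((N : ℝ) ^ 2 + 2) * p ^ 2 < ampRadius := by
    have h1 : p * (4 * (N ^ 2 + 2) / ampRadius + 6) ≤ 2 := by nlinarith
    have h2 : (4 * ((N : ℝ) ^ 2 + 2) / ampRadius) * p < 2 := by nlinarith
    have h3 : (4 * ((N : ℝ) ^ 2 + 2) / ampRadius) * p = 4 * (N ^ 2 + 2) * p / ampRadius := by ring
    rw [h3, div_lt_iff₀ hr] at h2
    have h4 : 2 * ((N : ℝ) ^ 2 + 2) * p ^ 2 ≤ 2 * (N ^ 2 + 2) * p := by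
      have : (0 : ℝ) ≤ 2 * (N ^ 2 + 2) := by positivity
      exact mul_le_mul_of_nonneg_left (by nlinarith) this
    linarith
  have hpeak : ∀ j, PeakShape T (a j) → IsPeak T (a j) := fun j hj =>
    hj.isPeak hT3 (hpos j)
      ((hj.amp_close hN hT0 ha hpos hp hshape hp1 hsum).trans_lt hsmall)
  obtain ⟨B, hB, hBp⟩ := exists_isLow hT0 hp0 hp25
  classical
  set A := a j₀ with hA
  have hAp : ∀ j, PeakShape T (a j) → a j = A := fun j hj =>
    (hpeak j hj).prof_inj (hpeak j₀ hj₀) (by rw [hp, hp])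
  have hBl : ∀ j, ¬ PeakShape T (a j) → a j = B := fun j hj =>
    (((hshape j).resolve_left hj).isLow hT0 (ha j) (hpos j) (by rw [hp]; exact hp25)).prof_inj hB
      (by rw [hp, hBp])
  obtain ⟨σ, hσ⟩ := exists_perm_lt fun j => PeakShape T (a j)
  set K := (Finset.univ.filter fun j => PeakShape T (a j)).card with hK
  have hK1 : 1 ≤ K := Finset.card_pos.2 ⟨j₀, by simpa using hj₀⟩
  have hKN : K ≤ N := by
    have := Finset.card_le_univ (Finset.univ.filter fun j => PeakShape T (a j))
    simpa using this
  have haσ : ∀ j, a j = if (σ j).val < K then A else B := fun j => by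
    by_cases hj : PeakShape T (a j)
    · rw [if_pos ((hσ j).1 hj)]
      exact hAp j hj
    · rw [if_neg (fun h => hj ((hσ j).2 h))]
      exact hBl j hj
  have hbal : vertexBalance N K T A B = 0 := by
    have h1 : ∑ j, 2 * profD T (a j) =
        ∑ j : Fin N, if j.val < K then 2 * profD T A else 2 * profD T B := by
      rw [← Equiv.sum_comp σ fun j : Fin N => if j.val < K then 2 * profD T A else 2 * profD T B]
      refine Finset.sum_congr rfl fun j _ => ?_
      rw [haσ j]
      split_ifs <;> rfl
    rw [h1, sum_ite_lt hKN] at hsum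
    have hpA : prof T A = p := hp j₀
    unfold vertexBalance
    rw [hpA]
    linarith
  have hpair : IsAmpPair N K T A B := ⟨hpeak j₀ hj₀, hB, by rw [hBp]; exact hp j₀, hbal⟩
  have hu := hpair.unique hK1 hKN (isAmpPair_ampPair hK1 hKN hTB)
  refine ⟨hp25, K, hK1, hKN, σ, fun j => ?_⟩
  rw [← hu.1, ← hu.2]
  exact haσ j

end Classification

/-! ### Classification of the states -/

section Classification

variable {N K : ℕ} {ω : ℝ}

theorem d1_congr {s : Set ℝ} {f g : ℝ → ℝ} (h : EqOn f g s) {x : ℝ} (hx : x ∈ s) :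
    d1 s f x = d1 s g x := derivWithin_congr h (h hx)

theorem pi_mem_loopEdge : Real.pi ∈ loopEdge := ⟨by linarith [Real.pi_pos], le_rfl⟩

theorem neg_pi_mem_loopEdge : -Real.pi ∈ loopEdge := ⟨le_rfl, by linarith [Real.pi_pos]⟩

theorem zero_mem_loopEdge : (0 : ℝ) ∈ loopEdge := ⟨by linarith [Real.pi_pos], Real.pi_pos.le⟩

/-- The jump of the derivative of an even loop component at the vertex. -/
theorem d1_loop_jump {f : ℝ → ℝ} {l a : ℝ}
    (h : EqOn f (fun x => l * prof (l * x + 0) a) loopEdge) :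
    d1 loopEdge f Real.pi - d1 loopEdge f (-Real.pi) =
      l ^ 2 * (2 * profD (Real.pi * l) a) := by
  have h1 := d1_eqOn uniqueDiffOn_loopEdge (hasDerivAt_wave_prof l 0 a)
  rw [d1_congr h pi_mem_loopEdge, d1_congr h neg_pi_mem_loopEdge, h1 pi_mem_loopEdge,
    h1 neg_pi_mem_loopEdge]
  have e1 : l * -Real.pi + 0 = -(Real.pi * l) := by ring
  have e2 : l * Real.pi + 0 = Real.pi * l := by ring
  simp only
  rw [e1, e2, profD_neg]
  ring

theorem shape_of_isSingleLobe {f : ℝ → ℝ} {l a : ℝ} (hl : 0 < l)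
    (h : EqOn f (fun x => l * prof (l * x + 0) a) loopEdge)
    (he : ∀ x ∈ loopEdge, f (-x) = f x) (hf : GraphFun.IsSingleLobe f) :
    PeakShape (Real.pi * l) a ∨ LowShape (Real.pi * l) a := by
  have hπ := Real.pi_pos
  have hsub : Icc 0 Real.pi ⊆ loopEdge := Icc_subset_Icc_left (by linarith)
  have hval : ∀ t ∈ Icc 0 (Real.pi * l), t / l ∈ loopEdge ∧ f (t / l) = l * prof t a :=
    fun t ht => by
      have hm : t / l ∈ Icc 0 Real.pi := ⟨div_nonneg ht.1 hl.le, (div_le_iff₀ hl).2 ht.2⟩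
      refine ⟨hsub hm, ?_⟩
      rw [h (hsub hm)]
      simp only
      congr 2
      field_simp
      ring
  have h0 : f 0 = l * a := by
    rw [h zero_mem_loopEdge]
    simp
  have hT : f Real.pi = l * prof (Real.pi * l) a := by
    have := (hval (Real.pi * l) ⟨by positivity, le_rfl⟩).2
    rwa [mul_div_assoc, div_self hl.ne', mul_one] at this
  -- A unique interior extremum of an even function lies at the centre, since its mirror image is
  -- another one.
  have hc0 : ∀ c ∈ Ioo (-Real.pi) Real.pi, (∀ x ∈ loopEdge, x ≠ c → f x ≠ f c) → c = 0 := by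
    intro c hc hne
    by_contra hc0
    refine hne (-c) ⟨by linarith [hc.2], by linarith [hc.1]⟩ (fun hcc => hc0 (by linarith)) ?_
    exact he c ⟨hc.1.le, hc.2.le⟩
  rcases hf with ⟨c, hc, h1, -, h2⟩ | ⟨c, hc, h1, -, h2⟩
  · have hcz := hc0 c hc fun x hx hxc => (h1 x hx hxc).ne
    subst hcz
    refine Or.inl ⟨fun t ht => ?_, fun t ht => ?_⟩
    · obtain ⟨m, e⟩ := hval t ⟨ht.1.le, ht.2⟩
      have := h1 _ m (div_pos ht.1 hl).ne'
      rw [e, h0] at this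
      exact lt_of_mul_lt_mul_left this hl.le
    · obtain ⟨m, e⟩ := hval t ht
      have : f Real.pi ≤ f (t / l) := h2 m
      rw [e, hT] at this
      exact le_of_mul_le_mul_left this hl
  · have hcz := hc0 c hc fun x hx hxc => (h1 x hx hxc).ne'
    subst hcz
    refine Or.inr ⟨fun t ht => ?_, fun t ht => ?_⟩
    · obtain ⟨m, e⟩ := hval t ⟨ht.1.le, ht.2⟩
      have := h1 _ m (div_pos ht.1 hl).ne'
      rw [e, h0] at this
      exact lt_of_mul_lt_mul_left this hl.le
    · obtain ⟨m, e⟩ := hval t ht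
      have : f (t / l) ≤ f Real.pi := h2 m
      rw [e, hT] at this
      exact le_of_mul_le_mul_left this hl

theorem exists_eqOnGraph_splitState (N : ℕ) (hN : 1 ≤ N) : ∃ T₂ : ℝ, lengthBound < T₂ ∧
    ∀ ω : ℝ, T₂ ≤ Real.pi * √(-ω) → ∀ Ψ : GraphFun N, Ψ.IsState ω →
      ∃ K : ℕ, 1 ≤ K ∧ K ≤ N ∧ ∃ σ : Equiv.Perm (Fin N),
        Ψ.EqOnGraph ((splitState N K ω).permute σ) := by
  obtain ⟨T₂, hT₂, hperm⟩ := exists_perm_ampPair N hN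
  refine ⟨T₂, hT₂, fun ω hω Ψ hΨ => ?_⟩
  obtain ⟨hl, hω0⟩ := lengthBound_sqrt_pos (hT₂.trans_le hω)
  obtain ⟨⟨hH, hHr, hcont, hkirch⟩, ⟨hsol, hsolr⟩, ⟨hpos, hposr⟩, hlobe, heven, hanti⟩ := hΨ
  have hl2 : -√(-ω) ^ 2 = ω := by rw [Real.sq_sqrt (by linarith)]; ring
  set l := √(-ω) with hldef
  have hπ := Real.pi_pos
  have hTpos : 0 < Real.pi * l := by positivity
  set a : Fin N → ℝ := fun j => Ψ.loop j 0 / l with ha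
  have hwave : ∀ j, EqOn (Ψ.loop j) (fun x => l * prof (l * x + 0) (a j)) loopEdge := fun j =>
    loop_eq_wave hl (hH j) (heven j) (by rw [hl2]; exact hsol j)
  have hsolr' : ∀ᵐ x ∂(volume.restrict rayEdge),
      -l ^ 2 * Ψ.ray x = -d2 rayEdge Ψ.ray x - 2 * Ψ.ray x ^ 3 := by rw [hl2]; exact hsolr
  obtain ⟨hp1, hslope⟩ := ray_vertex_slope hl hHr hposr hanti hsolr'
  have hsub : Icc 0 Real.pi ⊆ loopEdge := Icc_subset_Icc_left (by linarith)
  have hval : ∀ j, ∀ t ∈ Icc 0 (Real.pi * l), t / l ∈ loopEdge ∧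
      Ψ.loop j (t / l) = l * prof t (a j) := fun j t ht => by
    have hm : t / l ∈ Icc 0 Real.pi := ⟨div_nonneg ht.1 hl.le, (div_le_iff₀ hl).2 ht.2⟩
    refine ⟨hsub hm, ?_⟩
    rw [hwave j (hsub hm)]
    simp only
    congr 2
    field_simp
    ring
  have hprofpos : ∀ j, ∀ t ∈ Icc 0 (Real.pi * l), 0 < prof t (a j) := fun j t ht => by
    obtain ⟨m, e⟩ := hval j t ht
    have := hpos j _ m
    rw [e] at this
    exact pos_of_mul_pos_right this hl.le
  have hvertex : ∀ j, prof (Real.pi * l) (a j) = Ψ.ray 0 / l := fun j => by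
    have := (hval j (Real.pi * l) ⟨hTpos.le, le_rfl⟩).2
    rw [mul_div_assoc, div_self hl.ne', mul_one, (hcont j).1] at this
    rw [this]
    field_simp
  have hsum : ∑ j, 2 * profD (Real.pi * l) (a j) + vertexSlope (Ψ.ray 0 / l) = 0 := by
    have h1 : ∑ j, l ^ 2 * (2 * profD (Real.pi * l) (a j)) =
        -(l ^ 2 * vertexSlope (Ψ.ray 0 / l)) := by
      rw [← hslope, ← hkirch]
      exact Finset.sum_congr rfl fun j _ => (d1_loop_jump (hwave j)).symm
    rw [← Finset.mul_sum] at h1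
    have h2 : l ^ 2 * (∑ j, 2 * profD (Real.pi * l) (a j) + vertexSlope (Ψ.ray 0 / l)) = 0 := by
      rw [mul_add, h1]
      ring
    exact (mul_eq_zero.1 h2).resolve_left (by positivity)
  obtain ⟨hp25, K, hK1, hKN, σ, hσ⟩ := hperm (Real.pi * l) hω a (Ψ.ray 0 / l)
    (fun j => div_pos (hpos j 0 zero_mem_loopEdge) hl) hprofpos hvertex
    (fun j => shape_of_isSingleLobe hl (hwave j) (heven j) (hlobe j)) hp1 hsum
  refine ⟨K, hK1, hKN, σ, fun j x hx => ?_, fun x hx => ?_⟩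
  · rw [hwave j hx, hσ j]
    rfl
  · have h := isAmpPair_ampPair hK1 hKN (hT₂.le.trans hω)
    have hpeq : prof (Real.pi * l) (ampPair N K (Real.pi * l)).1 = Ψ.ray 0 / l := by
      -- As `K ≥ 1`, the loop sent to index `0` is a peak, and it identifies the vertex value on the
      -- half-line.
      set j := σ.symm ⟨0, hN⟩ with hj
      have h1 := hσ j
      have h2 : (σ j).val < K := by
        rw [hj, Equiv.apply_symm_apply]
        exact hK1
      rw [if_pos h2] at h1
      rw [← h1]
      exact hvertex j
    rw [ray_eq_wave hl hHr hposr hanti hsolr' (by linarith) hx, ← hpeq]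
    rfl

/-- The number of peaks can be read off from the values on the loops. -/
theorem card_peaks (hK : 1 ≤ K) (hKN : K ≤ N) (hω : lengthBound < Real.pi * √(-ω))
    {Ψ : GraphFun N} {σ : Equiv.Perm (Fin N)}
    (h : Ψ.EqOnGraph ((splitState N K ω).permute σ)) :
    (Finset.univ.filter fun j => Ψ.loop j Real.pi < Ψ.loop j 0).card = K := by
  have hiff : ∀ j, Ψ.loop j Real.pi < Ψ.loop j 0 ↔ (σ j).val < K := fun j => by
    rw [h.1 j pi_mem_loopEdge, h.1 j zero_mem_loopEdge]
    change (splitState N K ω).loop (σ j) Real.pi < (splitState N K ω).loop (σ j) 0 ↔ _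
    constructor
    · intro hlt
      by_contra hge
      exact absurd (splitState_strictMonoOn hK hKN hω (not_lt.1 hge) zero_mem_loop pi_mem_loop
        Real.pi_pos) hlt.not_gt
    · intro hlt
      exact splitState_strictAntiOn hK hKN hω hlt zero_mem_loop pi_mem_loop Real.pi_pos
  simp only [hiff]
  have h1 : ((Finset.univ.filter fun j => (σ j).val < K).card : ℝ) = K := by
    rw [Finset.card_filter]
    push_cast
    rw [Equiv.sum_comp σ fun j : Fin N => if j.val < K then (1 : ℝ) else 0, sum_ite_lt hKN]
    simp
  exact_mod_cast h1

theorem isSymmetricState_splitState (hN : 1 ≤ N) (hω : lengthBound < Real.pi * √(-ω)) :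
    (splitState N N ω).IsSymmetricState ω := by
  refine ⟨isState_splitState hN le_rfl hω,
    fun i j => (isSplit_splitState hN le_rfl hω).1 i j i.2 j.2,
    fun j => splitState_strictAntiOn hN le_rfl hω j.2⟩

/-- All `N` loops count as peaks, so `K = N`; the permutation is then immaterial because all loop
components coincide. -/
theorem eqOnGraph_of_isSymmetricState (hN : 1 ≤ N) {T₂ : ℝ} (hT₂ : lengthBound < T₂)
    (hclass : ∀ ω : ℝ, T₂ ≤ Real.pi * √(-ω) → ∀ Ψ : GraphFun N, Ψ.IsState ω →
      ∃ K : ℕ, 1 ≤ K ∧ K ≤ N ∧ ∃ σ : Equiv.Perm (Fin N),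
        Ψ.EqOnGraph ((splitState N K ω).permute σ))
    (hω : T₂ ≤ Real.pi * √(-ω)) {Ψ : GraphFun N} (hΨ : Ψ.IsSymmetricState ω) :
    Ψ.EqOnGraph (splitState N N ω) := by
  obtain ⟨K, hK, hKN, σ, h⟩ := hclass ω hω Ψ hΨ.1
  have hω' := hT₂.trans_le hω
  have hcard := card_peaks hK hKN hω' h
  have hall : (Finset.univ.filter fun j => Ψ.loop j Real.pi < Ψ.loop j 0) = Finset.univ :=
    Finset.filter_true_of_mem fun j _ => hΨ.2.2 j zero_mem_loop pi_mem_loop Real.pi_pos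
  rw [hall, Finset.card_univ, Fintype.card_fin] at hcard
  subst hcard
  refine ⟨fun j x hx => ?_, h.2⟩
  rw [h.1 j hx]
  exact (isSplit_splitState hN le_rfl hω').1 (σ j) j (σ j).2 j.2 hx

end Classification

/-! ### Kernel of the linearisation on a loop -/

section LoopKernel

variable {l a : ℝ} {V : ℝ → ℝ}

/-- The solutions on a loop are spanned by the even `profA` and the odd `profD`. Equal values at the
two ends eliminate the odd one, as `profD` does not vanish there. -/
theorem loop_kernel (hl : 0 < l) (ha : 1 < 2 * a ^ 2) (ha0 : a ≠ 0)
    (hZ : profD (Real.pi * l) a ≠ 0) (hV : MemH2 loopEdge V)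
    (hs : ∀ᵐ x ∂(volume.restrict loopEdge),
      d2 loopEdge V x = (l ^ 2 - 6 * (l * prof (l * x + 0) a) ^ 2) * V x)
    (hv : V Real.pi = V (-Real.pi)) :
    (∀ x ∈ loopEdge, V x = V 0 * profA (l * x + 0) a) ∧
      d1 loopEdge V Real.pi - d1 loopEdge V (-Real.pi) =
        2 * l * (V 0 * profDA (Real.pi * l) a) := by
  have hπ := Real.pi_pos
  have hcont : Continuous fun x => l ^ 2 - 6 * (l * prof (l * x + 0) a) ^ 2 :=
    continuous_const.sub (continuous_const.mul ((continuous_wave contDiff_prof l l 0 a).pow 2))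
  have hV2 : ∀ x ∈ loopEdge, HasDerivWithinAt (d1 loopEdge V)
      ((l ^ 2 - 6 * (l * prof (l * x + 0) a) ^ 2) * V x) loopEdge x := fun x hx =>
    hV.hasDerivWithinAt_d1_loop (k := fun x => (l ^ 2 - 6 * (l * prof (l * x + 0) a) ^ 2) * V x)
      (hcont.continuousOn.mul hV.1.continuousOn) hs hx
  have hf0 : force 0 a ≠ 0 := by
    unfold force
    rw [prof_zero]
    intro h
    have : a * (1 - 2 * a ^ 2) = 0 := by linarith
    rcases mul_eq_zero.1 this with h | h
    · exact ha0 h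
    · linarith
  set β := d1 loopEdge V 0 / (l * force 0 a) with hβ
  set D : ℝ → ℝ := fun x => V x - V 0 * profA (l * x + 0) a - β * profD (l * x + 0) a with hD
  set D' : ℝ → ℝ := fun x => d1 loopEdge V x - V 0 * l * profDA (l * x + 0) a -
    β * l * force (l * x + 0) a with hD'
  have hd : ∀ x ∈ loopEdge, HasDerivWithinAt D (D' x) loopEdge x := fun x hx =>
    ((hV.hasDerivWithinAt hx).sub (hasDerivAt_wave (H' := profDA)
      (fun t => hasDerivAt_profA t a) (V 0) l 0 x).hasDerivWithinAt).sub
      (hasDerivAt_wave (H' := force) (fun t => hasDerivAt_profD t a) β l 0 x).hasDerivWithinAt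
  have hd' : ∀ x ∈ loopEdge, HasDerivWithinAt D'
      ((l ^ 2 - 6 * (l * prof (l * x + 0) a) ^ 2) * D x) loopEdge x := fun x hx =>
    (((hV2 x hx).sub (hasDerivAt_wave (H' := fun t a => (1 - 6 * prof t a ^ 2) * profA t a)
      (fun t => hasDerivAt_profDA t a) (V 0 * l) l 0 x).hasDerivWithinAt).sub
      (hasDerivAt_wave (H' := fun t a => profD t a * (1 - 6 * prof t a ^ 2))
        (fun t => hasDerivAt_force t a) (β * l) l 0 x).hasDerivWithinAt).congr_deriv
      (by simp only [hD]; ring)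
  have hD0 : D 0 = 0 := by simp [hD]
  have hD0' : D' 0 = 0 := by
    simp only [hD', mul_zero, zero_add, profDA_zero, hβ]
    field_simp
    ring
  obtain ⟨C, hC⟩ := isCompact_Icc.exists_bound_of_continuousOn (s := loopEdge) hcont.continuousOn
  have hsub : Icc 0 Real.pi ⊆ loopEdge := Icc_subset_Icc_left (by linarith)
  have hright := eq_zero_of_linear_ode (s := 0) (T := Real.pi)
    (fun x hx => (hd x (hsub hx)).mono hsub) (fun x hx => (hd' x (hsub hx)).mono hsub)
    (fun x hx => hC x (hsub hx)) hD0 hD0'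
  have hneg : MapsTo (fun x : ℝ => -x) (Icc 0 Real.pi) loopEdge := fun x hx =>
    ⟨by linarith [hx.2], by linarith [hx.1]⟩
  have hleft := eq_zero_of_linear_ode (s := 0) (T := Real.pi) (f := fun x => D (-x))
    (f' := fun x => -D' (-x)) (c := fun x => l ^ 2 - 6 * (l * prof (l * -x + 0) a) ^ 2)
    (fun x hx => (HasDerivWithinAt.comp (h₂ := D) x (hd (-x) (hneg hx))
      (hasDerivAt_neg x).hasDerivWithinAt hneg).congr_deriv (by ring))
    (fun x hx => (HasDerivWithinAt.comp (h₂ := D') x (hd' (-x) (hneg hx))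
      (hasDerivAt_neg x).hasDerivWithinAt hneg).neg.congr_deriv (by ring))
    (fun x hx => hC (-x) (hneg hx)) (by simpa using hD0) (by simpa using hD0')
  have hall : ∀ x ∈ loopEdge, D x = 0 ∧ D' x = 0 := fun x hx => by
    rcases le_total 0 x with h | h
    · exact hright x ⟨h, hx.2⟩
    · have := hleft (-x) ⟨by linarith, by linarith [hx.1]⟩
      simp only [neg_neg, neg_eq_zero] at this
      exact this
  have e1 : l * -Real.pi + 0 = -(Real.pi * l) := by ring
  have e2 : l * Real.pi + 0 = Real.pi * l := by ring
  obtain ⟨p1, p2⟩ := hall _ pi_mem_loopEdge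
  obtain ⟨m1, m2⟩ := hall _ neg_pi_mem_loopEdge
  simp only [hD, hD', e1, e2, profA_neg, profD_neg, profDA_neg] at p1 p2 m1 m2
  have hβ0 : β = 0 := by
    have : β * profD (Real.pi * l) a = 0 := by
      rw [hv] at p1
      linarith
    exact (mul_eq_zero.1 this).resolve_right hZ
  refine ⟨fun x hx => ?_, ?_⟩
  · have := (hall x hx).1
    simp only [hD, hβ0] at this
    linarith
  · rw [hβ0] at p2 m2
    linarith

end LoopKernel

/-! ### Kernel of the linearisation on the half-line -/

section RayKernel

variable {l c : ℝ} {V : ℝ → ℝ}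

/-- The Wronskian of `V` with the square-integrable solution `profD` is constant and integrable,
hence zero: slope and value of `V` at the vertex are tied together. -/
theorem ray_kernel (hl : 0 < l) (hc : 0 ≤ c) (hV : MemH2 rayEdge V)
    (hs : ∀ᵐ x ∂(volume.restrict rayEdge),
      d2 rayEdge V x = (l ^ 2 - 6 * (l * prof (l * x + c) 1) ^ 2) * V x) :
    V 0 * (l * force c 1) = d1 rayEdge V 0 * profD c 1 ∧
      (V 0 = 0 → d1 rayEdge V 0 = 0 → ∀ x ∈ rayEdge, V x = 0) := by
  have hcont : Continuous fun x => l ^ 2 - 6 * (l * prof (l * x + c) 1) ^ 2 :=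
    continuous_const.sub (continuous_const.mul ((continuous_wave contDiff_prof l l c 1).pow 2))
  have hV2 : ∀ x ∈ rayEdge, HasDerivWithinAt (d1 rayEdge V)
      ((l ^ 2 - 6 * (l * prof (l * x + c) 1) ^ 2) * V x) rayEdge x := fun x hx =>
    hV.hasDerivWithinAt_d1_ray (k := fun x => (l ^ 2 - 6 * (l * prof (l * x + c) 1) ^ 2) * V x)
      (hcont.continuousOn.mul hV.1.continuousOn) hs hx
  constructor
  · set g : ℝ → ℝ := fun x => V x * (l * force (l * x + c) 1) -
      d1 rayEdge V x * (1 * profD (l * x + c) 1) with hg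
    have hconst := ray_const_of_hasDerivWithinAt_zero (g := g) fun x hx => by
      have h1 := hasDerivAt_wave (H' := fun t a => profD t a * (1 - 6 * prof t a ^ 2))
        (fun t => hasDerivAt_force t 1) l l c x
      have h2 := hasDerivAt_wave (H' := force) (fun t => hasDerivAt_profD t 1) 1 l c x
      exact (((hV.hasDerivWithinAt hx).mul h1.hasDerivWithinAt).sub
        ((hV2 x hx).mul h2.hasDerivWithinAt)).congr_deriv (by ring)
    have hint : IntegrableOn g rayEdge :=
      (hV.2.2.1.integrable_mul (memLp_ray_wave contDiff_force (fun _ hy => abs_force_one_le hy)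
        hl hc l)).sub (hV.2.2.2.1.integrable_mul (memLp_ray_wave contDiff_profD
        (fun _ hy => abs_profD_one_le hy) hl hc 1))
    have h0 := eq_zero_of_integrableOn_rayEdge hint hconst
    simp only [hg, mul_zero, zero_add] at h0
    linarith
  · intro h0 h0' x hx
    have hsub : Icc 0 x ⊆ rayEdge := fun y hy => hy.1
    obtain ⟨C, hC⟩ := isCompact_Icc.exists_bound_of_continuousOn (s := Icc 0 x) hcont.continuousOn
    exact (eq_zero_of_linear_ode (s := 0) (T := x)
      (fun y hy => (hV.hasDerivWithinAt (hsub hy)).mono hsub)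
      (fun y hy => (hV2 y (hsub hy)).mono hsub) (fun y hy => hC y hy) h0 h0' x ⟨hx, le_rfl⟩).1

end RayKernel

/-! ### Nondegeneracy of the symmetric state -/

section Kernel

variable {N : ℕ} {ω : ℝ}

/-- The loops force the vertex slope on the half-line to be `2 N l (W' / W)` times the vertex value,
with `W' / W > 0`, whereas the decaying solution requires a ratio of opposite sign. So the vertex
value vanishes, and with it every component. -/
theorem not_hasKernel (hN : 1 ≤ N) (hω : lengthBound < Real.pi * √(-ω)) {Ψ : GraphFun N}
    (hΨ : Ψ.EqOnGraph (splitState N N ω)) : ¬ Ψ.HasKernel ω := by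
  rintro ⟨V, ⟨hH, hHr, hcont, hkirch⟩, hne, hs, hsr⟩
  obtain ⟨hl, hω0⟩ := lengthBound_sqrt_pos hω
  have h := isAmpPair_ampPair hN le_rfl hω.le
  have hp := h.prof_pos
  have hpl := h.prof_lt
  have hl2 : √(-ω) ^ 2 = -ω := Real.sq_sqrt (by linarith)
  have hloopφ : ∀ j, ∀ x ∈ loopEdge, Ψ.loop j x =
      √(-ω) * prof (√(-ω) * x + 0) (ampPair N N (Real.pi * √(-ω))).1 := fun j x hx => by
    rw [hΨ.1 j hx]
    simp only [splitState, if_pos j.2]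
  have hrayφ : ∀ x ∈ rayEdge, Ψ.ray x = √(-ω) * prof (√(-ω) * x + rayShift (prof
      (Real.pi * √(-ω)) (ampPair N N (Real.pi * √(-ω))).1)) 1 := fun x hx => by
    rw [hΨ.2 hx]
    rfl
  set l := √(-ω)
  set a := (ampPair N N (Real.pi * l)).1
  set p := prof (Real.pi * l) a with hpdef
  have hab := h.1.amp_bounds
  have hW := h.1.profA_le h.1.mem_right
  have hsl := ampSlope_pos
  set W := profA (Real.pi * l) a
  set W' := profDA (Real.pi * l) a
  have hk : ∀ j, (∀ x ∈ loopEdge, V.loop j x = V.loop j 0 * profA (l * x + 0) a) ∧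
      d1 loopEdge (V.loop j) Real.pi - d1 loopEdge (V.loop j) (-Real.pi) =
        2 * l * (V.loop j 0 * W') := fun j => by
    refine loop_kernel hl (by nlinarith) (by linarith) (h.profD_neg hN le_rfl).ne (hH j) ?_
      ((hcont j).1.trans (hcont j).2.symm)
    filter_upwards [hs j, ae_restrict_mem measurableSet_Icc] with x hx hxm
    rw [hloopφ j x hxm] at hx
    rw [hl2]
    linarith
  have hr := ray_kernel hl (rayShift_nonneg hp) hHr (by
    filter_upwards [hsr, ae_restrict_mem measurableSet_Ici] with x hx hxm
    rw [hrayφ x hxm] at hx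
    rw [hl2]
    linarith)
  have hv0 : ∀ j, V.ray 0 = V.loop j 0 * W := fun j => by
    rw [← (hcont j).1, (hk j).1 _ pi_mem_loopEdge]
    congr 2
    ring
  have hW0 : W ≠ 0 := by linarith
  have hsum : d1 rayEdge V.ray 0 = N * (2 * l * (V.ray 0 / W * W')) := by
    rw [← hkirch]
    have : ∀ j, d1 loopEdge (V.loop j) Real.pi - d1 loopEdge (V.loop j) (-Real.pi) =
        2 * l * (V.ray 0 / W * W') := fun j => by
      rw [(hk j).2, hv0 j]
      field_simp
    simp only [this, Finset.sum_const, Finset.card_univ, Fintype.card_fin, nsmul_eq_mul]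
  obtain ⟨hr1, hr2⟩ := hr
  have hray0 : V.ray 0 = 0 := by
    rw [hsum, profD_rayShift hp (by linarith)] at hr1
    unfold force at hr1
    rw [prof_rayShift hp (by linarith)] at hr1
    have hρ : 0 < W' / W := div_pos_of_neg_of_neg (by linarith) (by linarith)
    have hvs := vertexSlope_nonneg hp.le
    have hfp : 0 < p - 2 * p ^ 3 := by
      have h1 : p - 2 * p ^ 3 = p * (1 - 2 * p ^ 2) := by ring
      rw [h1]
      exact mul_pos hp (by nlinarith)
    have hfac : V.ray 0 * (l * (p - 2 * p ^ 3) + N * (2 * l * (W' / W)) * vertexSlope p) = 0 := by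
      have : V.ray 0 / W * W' = V.ray 0 * (W' / W) := by ring
      rw [this] at hr1
      linear_combination hr1
    refine (mul_eq_zero.1 hfac).resolve_right (ne_of_gt ?_)
    have h1 : 0 < l * (p - 2 * p ^ 3) := mul_pos hl hfp
    have h2 : 0 ≤ N * (2 * l * (W' / W)) * vertexSlope p := by positivity
    linarith
  have hray0' : d1 rayEdge V.ray 0 = 0 := by
    rw [hsum, hray0]
    simp
  refine hne ⟨fun j x hx => ?_, fun x hx => hr2 hray0 hray0' x hx⟩
  have h1 := hv0 j
  rw [hray0] at h1
  have h2 : V.loop j 0 = 0 := (mul_eq_zero.1 h1.symm).resolve_right hW0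
  rw [(hk j).1 x hx, h2]
  simp

end Kernel

/-! ### Monotonicity of the mass in the scaling parameter -/

section MassFunction

variable {N : ℕ}

/-- A loop length above which all asymptotic estimates hold. -/
theorem exists_length_threshold (N : ℕ) (hN : 1 ≤ N) : ∃ T₀ : ℝ, lengthBound < T₀ ∧
    (∀ K : ℕ, 1 ≤ K → K ≤ N → ∀ T, T₀ ≤ T → |scaledMass N K T - 2 * K| ≤ 1 / 2 ∧
      ∃ m' : ℝ, HasDerivAt (scaledMass N K) m' T ∧ T * |m'| ≤ 1 / 2) ∧
    ∀ ω : ℝ, T₀ ≤ Real.pi * √(-ω) → ∀ Ψ : GraphFun N, Ψ.IsState ω →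
      ∃ K : ℕ, 1 ≤ K ∧ K ≤ N ∧ ∃ σ : Equiv.Perm (Fin N),
        Ψ.EqOnGraph ((splitState N K ω).permute σ) := by
  obtain ⟨C, hC, hderiv⟩ := exists_deriv_scaledMass_bound N
  obtain ⟨T₁, hclose⟩ := exists_scaledMass_close N
  obtain ⟨T₂, hT₂, hclass⟩ := exists_eqOnGraph_splitState N hN
  refine ⟨max (max T₁ T₂) (max 6 (2 * C)), lt_max_of_lt_left (lt_max_of_lt_right hT₂),
    fun K hK hKN T hT => ?_, fun ω hω => hclass ω
      ((le_max_right _ _).trans ((le_max_left _ _).trans hω))⟩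
  have h1 : T₁ ≤ T := (le_max_left _ _).trans ((le_max_left _ _).trans hT)
  have h2 : T₂ ≤ T := (le_max_right _ _).trans ((le_max_left _ _).trans hT)
  have h3 : 6 ≤ T := (le_max_left _ _).trans ((le_max_right _ _).trans hT)
  have h4 : 2 * C ≤ T := (le_max_right _ _).trans ((le_max_right _ _).trans hT)
  refine ⟨hclose K hK hKN T h1, ?_⟩
  obtain ⟨m', hm, hb⟩ := hderiv K hK hKN T (hT₂.trans_le h2) h3
  refine ⟨m', hm, hb.trans ?_⟩
  rw [div_le_iff₀ (by linarith)]
  linarith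

/-- With `m = scaledMass` and `T = π l`, the derivative of `l m(π l)` is `m + T m' ≥ (2K - 1/2) -
1/2 > 0`. -/
theorem strictMonoOn_mul_scaledMass {K : ℕ} {T₀ : ℝ} (hK : 1 ≤ K)
    (h : ∀ T, T₀ ≤ T → |scaledMass N K T - 2 * K| ≤ 1 / 2 ∧
      ∃ m' : ℝ, HasDerivAt (scaledMass N K) m' T ∧ T * |m'| ≤ 1 / 2) (hT₀ : 0 < T₀) :
    StrictMonoOn (fun l => l * scaledMass N K (Real.pi * l)) (Ici (T₀ / Real.pi)) := by
  have hπ := Real.pi_pos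
  have hKr : (1 : ℝ) ≤ K := by exact_mod_cast hK
  have key : ∀ l ∈ Ici (T₀ / Real.pi), ∃ d : ℝ, 0 < d ∧
      HasDerivAt (fun l => l * scaledMass N K (Real.pi * l)) d l := by
    intro l hl
    have hT : T₀ ≤ Real.pi * l := by
      have := (div_le_iff₀ hπ).1 hl
      linarith
    obtain ⟨h1, m', h2, h3⟩ := h _ hT
    have h4 : HasDerivAt (fun l => Real.pi * l) Real.pi l := by
      simpa using (hasDerivAt_id l).const_mul Real.pi
    have h5 := (hasDerivAt_id l).mul (HasDerivAt.comp (h₂ := scaledMass N K) l h2 h4)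
    refine ⟨_, ?_, h5⟩
    simp only [id, one_mul, Function.comp]
    have h6 : |Real.pi * l * m'| ≤ 1 / 2 := by
      rw [abs_mul, abs_of_pos (by linarith)]
      exact h3
    rw [abs_le] at h1 h6
    linarith
  refine strictMonoOn_of_deriv_pos (convex_Ici _) (fun l hl => ?_) fun l hl => ?_
  · obtain ⟨d, -, hd⟩ := key l hl
    exact hd.continuousAt.continuousWithinAt
  · obtain ⟨d, hd0, hd⟩ := key l (interior_subset hl)
    rw [hd.deriv]
    exact hd0

end MassFunction

end FlowerGraph

/-! ### Assembly of the theorem -/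

open FlowerGraph

theorem theorem3 (N : ℕ) (hN : 2 ≤ N) :
    ∃ ωinf : ℝ, ωinf < 0 ∧
      (∀ ωstar : ℝ, FlowerGraph.IsBifurcationFrequency N ωstar → ωinf < ωstar) ∧
      ∃ Φ : ℕ → ℝ → FlowerGraph.GraphFun N,
        -- the `N` states, their profiles and their monotonicity on the loops
        (∀ ω < ωinf, ∀ K ∈ Finset.Icc 1 N,
          (Φ K ω).IsState ω ∧ (Φ K ω).IsSplit K ∧
          (∀ j : Fin N, j.val < K → StrictAntiOn ((Φ K ω).loop j) (Set.Icc 0 Real.pi)) ∧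
          (∀ j : Fin N, K ≤ j.val → StrictMonoOn ((Φ K ω).loop j) (Set.Icc 0 Real.pi))) ∧
        -- up to permutations of the loops there are exactly these `N` states
        (∀ ω < ωinf, ∀ Ψ : FlowerGraph.GraphFun N, Ψ.IsState ω →
          ∃! K : ℕ, K ∈ Finset.Icc 1 N ∧
            ∃ σ : Equiv.Perm (Fin N), Ψ.EqOnGraph ((Φ K ω).permute σ)) ∧
        -- the state with `K = N` is the symmetric state
        (∀ ω < ωinf, (Φ N ω).IsSymmetricState ω ∧
          ∀ Ψ : FlowerGraph.GraphFun N, Ψ.IsSymmetricState ω → Ψ.EqOnGraph (Φ N ω)) ∧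
        -- the branches and their masses
        (∀ K ∈ Finset.Icc 1 N,
          ContDiffOn ℝ 1 (fun ω => (Φ K ω).toH2) (Set.Iio ωinf) ∧
          ContDiffOn ℝ 1 (fun ω => (Φ K ω).mass) (Set.Iio ωinf) ∧
          StrictAntiOn (fun ω => (Φ K ω).mass) (Set.Iio ωinf) ∧
          Filter.Tendsto (fun ω => (Φ K ω).mass) Filter.atBot Filter.atTop) ∧
        -- the ordering of the masses
        (∀ ω < ωinf, ∀ K ∈ Finset.Icc 1 N, ∀ L ∈ Finset.Icc 1 N, K < L →
          (Φ K ω).mass < (Φ L ω).mass) := by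
  have hN1 : 1 ≤ N := by omega
  have hπ := Real.pi_pos
  obtain ⟨T₀, hT₀, hmass, hclass⟩ := exists_length_threshold N hN1
  have hT₀pos : 0 < T₀ := by linarith [three_lt_lengthBound]
  have hL₀ : 0 < T₀ / Real.pi := by positivity
  have hsqrt : ∀ ω ≤ -(T₀ / Real.pi) ^ 2, T₀ / Real.pi ≤ √(-ω) := fun ω hω =>
    Real.le_sqrt_of_sq_le (by linarith)
  have hlen : ∀ ω ≤ -(T₀ / Real.pi) ^ 2, T₀ ≤ Real.pi * √(-ω) := fun ω hω => by
    have := (div_le_iff₀ hπ).1 (hsqrt ω hω)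
    linarith
  have hlen' : ∀ ω ≤ -(T₀ / Real.pi) ^ 2, lengthBound < Real.pi * √(-ω) := fun ω hω =>
    hT₀.trans_le (hlen ω hω)
  have hbd : ∀ K, 1 ≤ K → K ≤ N → ∀ ω < -(T₀ / Real.pi) ^ 2,
      (splitState N K ω).mass = √(-ω) * scaledMass N K (Real.pi * √(-ω)) ∧
        2 * K - 1 / 2 ≤ scaledMass N K (Real.pi * √(-ω)) ∧
        scaledMass N K (Real.pi * √(-ω)) ≤ 2 * K + 1 / 2 := fun K hK hKN ω hω => by
    have h1 := (hmass K hK hKN _ (hlen ω hω.le)).1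
    rw [abs_le] at h1
    exact ⟨mass_splitState hK hKN (hlen' ω hω.le), by linarith, by linarith⟩
  -- The frequency at which the rescaled half-length `π √(-ω)` equals `T₀`. The estimates hold at
  -- `T₀` itself, so bifurcation frequencies are excluded at the end point too and the inequality
  -- for them is strict.
  refine ⟨-(T₀ / Real.pi) ^ 2, by linarith [pow_pos hL₀ 2], fun ω hω => ?_,
    splitState N, fun ω hω K hK => ?_, fun ω hω Ψ hΨ => ?_, fun ω hω => ?_, fun K hK => ?_,
    fun ω hω K hK L hL hKL => ?_⟩
  · by_contra hcon
    push Not at hcon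
    obtain ⟨-, Ψ, hΨ, hker⟩ := hω
    exact not_hasKernel hN1 (hlen' ω hcon)
      (eqOnGraph_of_isSymmetricState hN1 hT₀ hclass (hlen ω hcon) hΨ) hker
  · obtain ⟨hK1, hKN⟩ := Finset.mem_Icc.1 hK
    have h := hlen' ω hω.le
    exact ⟨isState_splitState hK1 hKN h, isSplit_splitState hK1 hKN h,
      fun j hj => splitState_strictAntiOn hK1 hKN h hj,
      fun j hj => splitState_strictMonoOn hK1 hKN h hj⟩
  · obtain ⟨K, hK1, hKN, σ, hσ⟩ := hclass ω (hlen ω hω.le) Ψ hΨ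
    refine ⟨K, ⟨Finset.mem_Icc.2 ⟨hK1, hKN⟩, σ, hσ⟩, ?_⟩
    rintro L ⟨hL, τ, hτ⟩
    obtain ⟨hL1, hLN⟩ := Finset.mem_Icc.1 hL
    rw [← card_peaks hL1 hLN (hlen' ω hω.le) hτ, card_peaks hK1 hKN (hlen' ω hω.le) hσ]
  · exact ⟨isSymmetricState_splitState hN1 (hlen' ω hω.le), fun Ψ hΨ =>
      eqOnGraph_of_isSymmetricState hN1 hT₀ hclass (hlen ω hω.le) hΨ⟩
  · obtain ⟨hK1, hKN⟩ := Finset.mem_Icc.1 hK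
    have hKr : (1 : ℝ) ≤ K := by exact_mod_cast hK1
    refine ⟨contDiffOn_toH2_splitState hK1 hKN fun ω hω => hlen' ω hω.le, ?_, ?_, ?_⟩
    · have hl : ContDiffOn ℝ 1 (fun ω : ℝ => √(-ω)) (Set.Iio (-(T₀ / Real.pi) ^ 2)) :=
        fun ω hω => (contDiffAt_id.neg.sqrt (by
          have := (lengthBound_sqrt_pos (hlen' ω (le_of_lt hω))).2
          simp only [id]
          linarith)).contDiffWithinAt
      have hT : ContDiffOn ℝ 1 (fun ω : ℝ => Real.pi * √(-ω)) (Set.Iio (-(T₀ / Real.pi) ^ 2)) :=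
        contDiffOn_const.mul hl
      exact (hl.mul ((contDiffOn_scaledMass hK1 hKN).comp hT
        fun ω hω => hlen' ω (le_of_lt hω))).congr fun ω hω => (hbd K hK1 hKN ω hω).1
    · intro ω hω ω' hω' hlt
      simp only
      rw [(hbd K hK1 hKN ω hω).1, (hbd K hK1 hKN ω' hω').1]
      refine strictMonoOn_mul_scaledMass hK1 (hmass K hK1 hKN) hT₀pos
        (hsqrt ω' (le_of_lt hω')) (hsqrt ω (le_of_lt hω)) ?_
      have := (lengthBound_sqrt_pos (hlen' ω' (le_of_lt hω'))).2
      exact Real.sqrt_lt_sqrt (by linarith) (by linarith)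
    · have h1 : Filter.Tendsto (fun ω : ℝ => √(-ω)) Filter.atBot Filter.atTop :=
        Real.tendsto_sqrt_atTop.comp Filter.tendsto_neg_atBot_atTop
      -- The mass dominates `√(-ω)`, because `scaledMass ≥ 2K - 1/2 ≥ 1`.
      refine Filter.tendsto_atTop_mono' _ ?_ h1
      filter_upwards [Filter.eventually_lt_atBot (-(T₀ / Real.pi) ^ 2)] with ω hω
      obtain ⟨h2, h3, -⟩ := hbd K hK1 hKN ω hω
      rw [h2]
      nlinarith [Real.sqrt_nonneg (-ω)]
  · obtain ⟨hK1, hKN⟩ := Finset.mem_Icc.1 hK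
    obtain ⟨hL1, hLN⟩ := Finset.mem_Icc.1 hL
    -- Consecutive windows do not overlap: `2K + 1/2 < 2(K + 1) - 1/2 ≤ 2L - 1/2`.
    have hKL' : (K : ℝ) + 1 ≤ L := by exact_mod_cast hKL
    obtain ⟨h1, -, h2⟩ := hbd K hK1 hKN ω hω
    obtain ⟨h3, h4, -⟩ := hbd L hL1 hLN ω hω
    rw [h1, h3]
    exact mul_lt_mul_of_pos_left (by linarith) (lengthBound_sqrt_pos (hlen' ω hω.le)).1
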